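/- **Setting.** For a lower semicontinuous $h:\mathbb R\to[0,\infty)$ let $\Omega_h=\{(x,y)\in\mathbb R^2: 0<y<h(x)\}$, let $\int_{\mathbb R}|h'|:=\operatorname{Var}h=\sup\{\sum_i|h(x_i)-h(x_{i-1})| : x_1<\dots<x_n\}$ be its pointwise variation, put $h^-(x)=\liminf_{z\to x,\,z\neq x}h(z)$, and let $\Gamma_{\rm cuts}=\{(x,y): h(x)<h^-(x),\ h(x)\le y\le h^-(x)\}$ be the set of vertical cuts. For $V>0$ let $\mathcal A_V$ be the set of pairs $(u,h)$ such that $h\in BV(\mathbb R)$ is lower semicontinuous, $h\ge0$, $\operatorname{Var}h<\infty$, $\int_{\mathbb R}h\,dx=V$, $u\in H^1(\Omega_h)$ and $u(x,0)=x$ on $\{h>0\}$ in the sense of traces. A minimizer of the large-slope problem of volume $V$ is a pair $(u,h)\in\mathcal A_V$ that minimizes $$\int_{\Omega_h}|\nabla u|^2\,dx\,dy+\int_{\mathbb R}|h'|$$ over $\mathcal A_V$. Put $$C_W=\inf\Big\{\int_{(0,1)\times(0,\infty)}|\nabla u|^2\,dx\,dy : u(x,0)=x\Big\},$$ $$G(h)=\Big(\inf_{u(x,0)=x}\int_{\{h>0\}\times(0,\infty)}|\nabla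 u|^2\,dx\,dy\Big)+\int_{\mathbb R}|h'|+2\,\mathcal H^1(\Gamma_{\rm cuts}),$$ where the infima run over all weakly differentiable $u$ with the indicated trace. **Theorem.** Let $V_n>0$, $V_n\to\infty$, and let $(u_n,h_n)$ be a minimizer of the large-slope problem of volume $V_n$ for every $n$. Put $\tilde h_n(x)=V_n^{-2/3}h_n(V_n^{1/3}x)$. Then there are a subsequence (not relabelled), translations $\tau_n\in\mathbb R$ and a function $h$ such that 1. $\tilde h_n(\cdot-\tau_n)\to h$ in $L^1(\mathbb R)$; 2. $\mathbb R^2\setminus\Omega_{\tilde h_n(\cdot-\tau_n)}\to\mathbb R^2\setminus\Omega_h$ in the Hausdorff distance; 3. $h$ minimizes $G$ among all lower semicontinuous, nonnegative functions in $BV(\mathbb R)$ of finite pointwise variation with $\int_{\mathbb R}h\,dx=1$; 4. $0<C_W$, and $h$ is a rectangle of base $C_W^{-1/3}$: there is $a\in\mathbb R$ such that $h=C_W^{1/3}$ on $(a,a+C_W^{-1/3})$ and $h=0$ elsewhere. -/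

import Mathlib

open MeasureTheory Filter Topology Set
open scoped ENNReal ContDiff

noncomputable section

namespace Island

/-- The domain occupied by the film with height profile `h`: the points with `0 < y < h x`. -/
def subgraph (h : ℝ → ℝ) : Set (ℝ × ℝ) := {p | 0 < p.2 ∧ p.2 < h p.1}

/-- `g` is the weak gradient on `Ω` of the locally integrable function `u`. -/
structure IsWeakGrad (Ω : Set (ℝ × ℝ)) (u : ℝ × ℝ → ℝ) (g : ℝ × ℝ → ℝ × ℝ) : Prop where
  locInt : LocallyIntegrableOn u Ω volume
  locInt_grad : LocallyIntegrableOn g Ω volume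
  partial_x : ∀ φ : ℝ × ℝ → ℝ, ContDiff ℝ ∞ φ → HasCompactSupport φ → tsupport φ ⊆ Ω →
    ∫ p in Ω, u p * fderiv ℝ φ p (1, 0) = -∫ p in Ω, (g p).1 * φ p
  partial_y : ∀ φ : ℝ × ℝ → ℝ, ContDiff ℝ ∞ φ → HasCompactSupport φ → tsupport φ ⊆ Ω →
    ∫ p in Ω, u p * fderiv ℝ φ p (0, 1) = -∫ p in Ω, (g p).2 * φ p

/-- The Dirichlet energy `∫_Ω |∇u|²`. The weak gradient is unique up to null sets, so the infimum
only selects it; it gives `∞` if there is no weak gradient. -/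
def dirichletEnergy (Ω : Set (ℝ × ℝ)) (u : ℝ × ℝ → ℝ) : ℝ≥0∞ :=
  ⨅ (g : ℝ × ℝ → ℝ × ℝ) (_ : IsWeakGrad Ω u g),
    ∫⁻ p in Ω, ENNReal.ofReal ((g p).1 ^ 2 + (g p).2 ^ 2)

/-- The Sobolev class `H¹(Ω)`. -/
def MemH1 (Ω : Set (ℝ × ℝ)) (u : ℝ × ℝ → ℝ) : Prop :=
  MemLp u 2 (volume.restrict Ω) ∧
    ∃ g, IsWeakGrad Ω u g ∧ MemLp g 2 (volume.restrict Ω)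

/-- For a domain `Ω` in the upper half plane whose boundary contains the part `I × {0}` of the
axis: `u` has the trace `f` on `I × {0}`, expressed by Green's formula with the test functions that
may be nonzero on `I × {0}`. -/
def HasBottomTrace (Ω : Set (ℝ × ℝ)) (I : Set ℝ) (u : ℝ × ℝ → ℝ) (f : ℝ → ℝ) : Prop :=
  ∃ g, IsWeakGrad Ω u g ∧
    LocallyIntegrableOn (Ω.indicator u) (Ω ∪ I ×ˢ Iic 0) volume ∧
    LocallyIntegrableOn (Ω.indicator g) (Ω ∪ I ×ˢ Iic 0) volume ∧
    ∀ φ : ℝ × ℝ → ℝ, ContDiff ℝ ∞ φ → HasCompactSupport φ → tsupport φ ⊆ Ω ∪ I ×ˢ Iic 0 →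
      (∫ p in Ω, u p * fderiv ℝ φ p (0, 1)) + (∫ p in Ω, (g p).2 * φ p)
        = -∫ x in I, f x * φ (x, 0)

/-- Nonnegative lower semicontinuous profiles of bounded variation on the line with volume `V`.
The pointwise variation is required to be finite; otherwise the energies below are infinite. -/
structure IsProfile (V : ℝ) (h : ℝ → ℝ) : Prop where
  nonneg : ∀ x, 0 ≤ h x
  lsc : LowerSemicontinuous h
  integrable : Integrable h volume
  finite_variation : eVariationOn h univ ≠ ⊤
  volume_eq : ∫ x, h x = V

/-- Admissible pairs of volume `V`, with the boundary condition `u(x,0) = x` where `h > 0`. -/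
structure IsAdmissible (V : ℝ) (u : ℝ × ℝ → ℝ) (h : ℝ → ℝ) : Prop where
  profile : IsProfile V h
  memH1 : MemH1 (subgraph h) u
  trace : HasBottomTrace (subgraph h) {x | 0 < h x} u (fun x => x)

/-- The large slope energy `∫_{Ω_h} |∇u|² + Var h`, where `Var h` is the pointwise variation. -/
def filmEnergy (u : ℝ × ℝ → ℝ) (h : ℝ → ℝ) : ℝ≥0∞ :=
  dirichletEnergy (subgraph h) u + eVariationOn h univ

/-- `(u, h)` minimizes the large slope energy among admissible pairs of volume `V`. -/
def IsFilmMinimizer (V : ℝ) (u : ℝ × ℝ → ℝ) (h : ℝ → ℝ) : Prop :=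
  IsAdmissible V u h ∧ ∀ v k, IsAdmissible V v k → filmEnergy u h ≤ filmEnergy v k

/-- The lower one-sided limit `h⁻(x) = liminf_{z → x} h(z)`. -/
def lowerLimit (h : ℝ → ℝ) (x : ℝ) : ℝ := liminf h (𝓝[≠] x)

/-- The Euclidean plane copy of a set of pairs, for metric notions. -/
def euclid (A : Set (ℝ × ℝ)) : Set (WithLp 2 (ℝ × ℝ)) := WithLp.toLp 2 '' A

/-- The vertical cuts of `h`. -/
def cuts (h : ℝ → ℝ) : Set (ℝ × ℝ) :=
  {p | h p.1 < lowerLimit h p.1 ∧ h p.1 ≤ p.2 ∧ p.2 ≤ lowerLimit h p.1}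

/-- The infimum of `∫ |∇u|²` over `I × (0, ∞)` among all weakly differentiable `u` with
`u(x,0) = x` on `I`. -/
def stripEnergy (I : Set ℝ) : ℝ≥0∞ :=
  ⨅ (u : ℝ × ℝ → ℝ) (_ : HasBottomTrace (I ×ˢ Ioi 0) I u (fun x => x)),
    dirichletEnergy (I ×ˢ Ioi 0) u

/-- The limit functional `G`. -/
def limitEnergy (h : ℝ → ℝ) : ℝ≥0∞ :=
  stripEnergy {x | 0 < h x} + eVariationOn h univ
    + 2 * Measure.hausdorffMeasure 1 (euclid (cuts h))

/-- `h` minimizes `G` among the profiles of volume one. -/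
def IsLimitMinimizer (h : ℝ → ℝ) : Prop :=
  IsProfile 1 h ∧ ∀ k, IsProfile 1 k → limitEnergy h ≤ limitEnergy k

/-- The constant `C_W`, the strip energy of the unit interval. -/
def CW : ℝ := (stripEnergy (Ioo 0 1)).toReal

/-- The rescaled profile `x ↦ V^(-2/3) h(V^(1/3) x)`. -/
def rescale (V : ℝ) (h : ℝ → ℝ) (x : ℝ) : ℝ :=
  V ^ (-(2 / 3) : ℝ) * h (V ^ (1 / 3 : ℝ) * x)

/-- The rectangle with base `(a, a + b)` and unit area, as a lower semicontinuous profile. -/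
def rectangle (a b : ℝ) : ℝ → ℝ := (Ioo a (a + b)).indicator (fun _ => 1 / b)

end Island

end

/-! Rescaled by `V^(1/3)` in width and `V^(2/3)` in height, a film becomes a profile `k` of unit
volume. Measured in units of its horizontal length scale, its height is `L k` with `L = V^(1/3) →
∞`. An island that is tall compared with its base `b` pays at least about `C_W b²` of Dirichlet
energy, and one of height `M` pays at least `2M` of variation. Heuristically the problem is thus to
minimize `∑ C_W bᵢ² + 2 ∑ Mᵢ` under `∑ Mᵢ bᵢ = 1`. With `D` the Dirichlet part, `X = ∑ Mᵢ` and `H³ =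
C_W`, Cauchy–Schwarz gives `1 ≤ (∑ Mᵢ²)(∑ bᵢ²) ≤ X² D / H³`, and then `D + 2X ≥ 3H` by the
arithmetic-geometric mean inequality. Equality forces a single island of height `H` and base `1/H`.
The proof makes this chain quantitative, so almost equality already gives `L¹` closeness to the
rectangle after a translation. No compactness argument is needed, and the whole sequence converges.

The lower bound for the Dirichlet energy comes from duality. If `u` has trace `x`, pairing its
gradient with the rotated gradient of a test function `ψ` gives `∫ ψ(x,0) dx`, so the energy is at
least `2 ∫ ψ(x,0) - ∫ |∇ψ|²`. A fixed bump gives a crude bound for every interval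
(`exists_coarse_cell_bound`). Near-optimal `ψ` for the half strip give the sharp constant
(`exists_fine_cell_bound`), because an explicit Fourier series and its harmonic conjugate show that
the duality gap closes (`exists_strip_duality`). The bounds are stated for the projection of the
energy density to the horizontal axis, a measure, so they add up over disjoint intervals.

`lintegral_min_le` shows that little volume lies below a small level. Above it,
`IsProfile.exists_dominant_peak` runs the Cauchy–Schwarz argument over the components of a
superlevel set, and `eventually_exists_near_rectangle` concludes. Minimality is used only to compare
with one rectangle, which gives `D + 2X ≤ 3H`. The same lower bound holds for `G`, whose strips have
infinite height, and the rectangle attains it. Hausdorff convergence follows from `L¹` closeness and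
the convergence of the variation: a valley reaching deep into the rectangle would cost additional
variation. -/

noncomputable section

/-! ### Partial derivatives, weak gradients and the dual lower bound. -/

namespace Island

/-- The partial derivative of `φ` in the first variable. -/
def partialX (φ : ℝ × ℝ → ℝ) (p : ℝ × ℝ) : ℝ := fderiv ℝ φ p (1, 0)

/-- The partial derivative of `φ` in the second variable. -/
def partialY (φ : ℝ × ℝ → ℝ) (p : ℝ × ℝ) : ℝ := fderiv ℝ φ p (0, 1)

section Partial

variable {φ : ℝ × ℝ → ℝ}

theorem contDiff_fderiv_apply (hφ : ContDiff ℝ ∞ φ) (v : ℝ × ℝ) :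
    ContDiff ℝ ∞ (fun p => fderiv ℝ φ p v) :=
  (hφ.fderiv_right (m := ∞) (by simp)).clm_apply contDiff_const

theorem contDiff_partialX (hφ : ContDiff ℝ ∞ φ) : ContDiff ℝ ∞ (partialX φ) :=
  contDiff_fderiv_apply hφ _

theorem contDiff_partialY (hφ : ContDiff ℝ ∞ φ) : ContDiff ℝ ∞ (partialY φ) :=
  contDiff_fderiv_apply hφ _

theorem tsupport_partialX_subset : tsupport (partialX φ) ⊆ tsupport φ :=
  tsupport_fderiv_apply_subset ℝ _

theorem tsupport_partialY_subset : tsupport (partialY φ) ⊆ tsupport φ :=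
  tsupport_fderiv_apply_subset ℝ _

theorem _root_.HasCompactSupport.partialX (h : HasCompactSupport φ) : HasCompactSupport (partialX φ) :=
  h.fderiv_apply ℝ _

theorem _root_.HasCompactSupport.partialY (h : HasCompactSupport φ) : HasCompactSupport (partialY φ) :=
  h.fderiv_apply ℝ _

theorem partialX_eq_zero {p : ℝ × ℝ} (hp : p ∉ tsupport φ) : partialX φ p = 0 :=
  image_eq_zero_of_notMem_tsupport fun h => hp (tsupport_partialX_subset h)

theorem partialY_eq_zero {p : ℝ × ℝ} (hp : p ∉ tsupport φ) : partialY φ p = 0 :=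
  image_eq_zero_of_notMem_tsupport fun h => hp (tsupport_partialY_subset h)

theorem hasDerivAt_partialX {p : ℝ × ℝ} (h : DifferentiableAt ℝ φ p) :
    HasDerivAt (fun x => φ (x, p.2)) (partialX φ p) p.1 :=
  HasFDerivAt.comp_hasDerivAt (f := fun x : ℝ => (x, p.2)) p.1 (l := φ) (l' := fderiv ℝ φ p)
    h.hasFDerivAt ((hasDerivAt_id p.1).prodMk (hasDerivAt_const p.1 p.2))

theorem hasDerivAt_partialY {p : ℝ × ℝ} (h : DifferentiableAt ℝ φ p) :
    HasDerivAt (fun y => φ (p.1, y)) (partialY φ p) p.2 :=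
  HasFDerivAt.comp_hasDerivAt (f := fun y : ℝ => (p.1, y)) p.2 (l := φ) (l' := fderiv ℝ φ p)
    h.hasFDerivAt ((hasDerivAt_const p.2 p.1).prodMk (hasDerivAt_id p.2))

theorem partialX_partialY_comm (hφ : ContDiff ℝ ∞ φ) (p : ℝ × ℝ) :
    partialX (partialY φ) p = partialY (partialX φ) p := by
  have hs : IsSymmSndFDerivAt ℝ φ p :=
    (hφ.contDiffAt).isSymmSndFDerivAt (by
      rw [minSmoothness_of_isRCLikeNormedField]
      exact WithTop.coe_le_coe.2 (le_top : (2 : ℕ∞) ≤ ⊤))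
  have hd : DifferentiableAt ℝ (fderiv ℝ φ) p :=
    ((hφ.fderiv_right (m := ∞) (by simp)).differentiable (by simp)) p
  have key : ∀ v w : ℝ × ℝ, fderiv ℝ (fun q => fderiv ℝ φ q v) p w = fderiv ℝ (fderiv ℝ φ) p w v := by
    intro v w
    rw [fderiv_clm_apply hd (differentiableAt_const v)]
    simp
  have h1 := key (0, 1) (1, 0)
  have h2 := key (1, 0) (0, 1)
  have h3 := hs.eq (1, 0) (0, 1)
  change fderiv ℝ (fun q => fderiv ℝ φ q (0, 1)) p (1, 0)
    = fderiv ℝ (fun q => fderiv ℝ φ q (1, 0)) p (0, 1)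
  rw [h1, h2, h3]

end Partial

theorem _root_.MeasureTheory.LocallyIntegrableOn.integrable_mul {f φ : ℝ × ℝ → ℝ} {K : Set (ℝ × ℝ)}
    (hf : LocallyIntegrableOn f K volume) (hφ : Continuous φ) (hc : HasCompactSupport φ)
    (hK : tsupport φ ⊆ K) : Integrable (fun p => f p * φ p) := by
  have h1 : IntegrableOn f (tsupport φ) volume := hf.integrableOn_compact_subset hK hc
  obtain ⟨C, hC⟩ := hφ.bounded_above_of_compact_support hc
  have h2 : IntegrableOn (fun p => f p * φ p) (tsupport φ) volume :=
    Integrable.mul_bdd (c := C) h1 hφ.aestronglyMeasurable (Eventually.of_forall hC)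
  refine (integrableOn_iff_integrable_of_support_subset ?_).1 h2
  intro p hp
  by_contra hn
  exact hp (by simp [image_eq_zero_of_notMem_tsupport hn])

theorem _root_.MeasureTheory.LocallyIntegrableOn.integrableOn_mul {f φ : ℝ × ℝ → ℝ} {Ω K : Set (ℝ × ℝ)}
    (hΩ : MeasurableSet Ω)
    (hf : LocallyIntegrableOn (Ω.indicator f) K volume) (hφ : Continuous φ)
    (hc : HasCompactSupport φ) (hK : tsupport φ ⊆ K) : IntegrableOn (fun p => f p * φ p) Ω := by
  rw [← integrable_indicator_iff hΩ]
  refine (hf.integrable_mul hφ hc hK).congr (Eventually.of_forall fun p => ?_)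
  by_cases hp : p ∈ Ω <;> simp [hp]

theorem _root_.MeasureTheory.LocallyIntegrableOn.fst' {g : ℝ × ℝ → ℝ × ℝ} {K : Set (ℝ × ℝ)}
    (h : LocallyIntegrableOn g K volume) : LocallyIntegrableOn (fun p => (g p).1) K volume := by
  intro p hp
  obtain ⟨s, hs, hi⟩ := h p hp
  exact ⟨s, hs, hi.fst⟩

theorem _root_.MeasureTheory.LocallyIntegrableOn.snd' {g : ℝ × ℝ → ℝ × ℝ} {K : Set (ℝ × ℝ)}
    (h : LocallyIntegrableOn g K volume) : LocallyIntegrableOn (fun p => (g p).2) K volume := by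
  intro p hp
  obtain ⟨s, hs, hi⟩ := h p hp
  exact ⟨s, hs, hi.snd⟩

section Uniqueness

variable {Ω : Set (ℝ × ℝ)} {u : ℝ × ℝ → ℝ} {g g' : ℝ × ℝ → ℝ × ℝ}

theorem ae_eq_of_integral_mul_eq {f f' : ℝ × ℝ → ℝ} (hΩ : IsOpen Ω)
    (hf : LocallyIntegrableOn f Ω volume) (hf' : LocallyIntegrableOn f' Ω volume)
    (h : ∀ φ : ℝ × ℝ → ℝ, ContDiff ℝ ∞ φ → HasCompactSupport φ → tsupport φ ⊆ Ω →
      ∫ p in Ω, f p * φ p = ∫ p in Ω, f' p * φ p) :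
    ∀ᵐ p ∂volume, p ∈ Ω → f p = f' p := by
  have := IsOpen.ae_eq_zero_of_integral_contDiff_smul_eq_zero hΩ (hf.sub hf') ?_
  · filter_upwards [this] with p hp hpΩ
    exact sub_eq_zero.1 (hp hpΩ)
  · intro φ hφ hc hs
    have e := h φ hφ hc hs
    have z : ∀ F : ℝ × ℝ → ℝ, ∀ p ∉ Ω, F p * φ p = 0 := fun F p hp => by
      rw [image_eq_zero_of_notMem_tsupport (fun h => hp (hs h)), mul_zero]
    rw [setIntegral_eq_integral_of_forall_compl_eq_zero (z f),
      setIntegral_eq_integral_of_forall_compl_eq_zero (z f')] at e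
    have := integral_sub (hf.integrable_mul hφ.continuous hc hs)
      (hf'.integrable_mul hφ.continuous hc hs)
    rw [e, sub_self] at this
    rw [← this]
    refine integral_congr_ae (Eventually.of_forall fun p => ?_)
    simp only [Pi.sub_apply, smul_eq_mul]
    ring

theorem IsWeakGrad.ae_eq (hΩ : IsOpen Ω) (h : IsWeakGrad Ω u g) (h' : IsWeakGrad Ω u g') :
    ∀ᵐ p ∂volume.restrict Ω, g p = g' p := by
  rw [ae_restrict_iff' hΩ.measurableSet]
  have h1 := ae_eq_of_integral_mul_eq hΩ h.locInt_grad.fst' h'.locInt_grad.fst'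
    fun φ hφ hc hs => neg_injective ((h.partial_x φ hφ hc hs).symm.trans (h'.partial_x φ hφ hc hs))
  have h2 := ae_eq_of_integral_mul_eq hΩ h.locInt_grad.snd' h'.locInt_grad.snd'
    fun φ hφ hc hs => neg_injective ((h.partial_y φ hφ hc hs).symm.trans (h'.partial_y φ hφ hc hs))
  filter_upwards [h1, h2] with p hp1 hp2 hp
  exact Prod.ext (hp1 hp) (hp2 hp)

/-- Weak gradients on an open set agree almost everywhere, so the infimum in the definition runs
over a single value. -/
theorem IsWeakGrad.dirichletEnergy_eq (hΩ : IsOpen Ω) (h : IsWeakGrad Ω u g) :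
    dirichletEnergy Ω u = ∫⁻ p in Ω, ENNReal.ofReal ((g p).1 ^ 2 + (g p).2 ^ 2) := by
  refine le_antisymm (iInf₂_le g h) (le_iInf₂ fun g' h' => le_of_eq ?_)
  refine lintegral_congr_ae ?_
  filter_upwards [h.ae_eq hΩ h'] with p hp
  rw [hp]

end Uniqueness

section Dual

variable {Ω : Set (ℝ × ℝ)} {I : Set ℝ} {u : ℝ × ℝ → ℝ} {g : ℝ × ℝ → ℝ × ℝ} {ψ : ℝ × ℝ → ℝ}

/-- A cutoff in `y` alone commutes with `∂ₓ`, so removing it near the axis leaves no boundary term.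
The horizontal identity therefore holds for test functions that do not vanish on the axis, whatever
the trace is. -/
theorem integral_grad_fst_mul (hΩ : IsOpen Ω) (hpos : ∀ p ∈ Ω, 0 < p.2)
    (hg : IsWeakGrad Ω u g)
    (hu : LocallyIntegrableOn (Ω.indicator u) (Ω ∪ I ×ˢ Iic 0) volume)
    (hgi : LocallyIntegrableOn (Ω.indicator g) (Ω ∪ I ×ˢ Iic 0) volume)
    {φ : ℝ × ℝ → ℝ} (hφ : ContDiff ℝ ∞ φ) (hc : HasCompactSupport φ)
    (hs : tsupport φ ⊆ Ω ∪ I ×ˢ Iic 0) :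
    ∫ p in Ω, u p * partialX φ p = -∫ p in Ω, (g p).1 * φ p := by
  have hgi1 : LocallyIntegrableOn (Ω.indicator fun p => (g p).1) (Ω ∪ I ×ˢ Iic 0) volume := by
    refine .congr (Eventually.of_forall fun p => ?_) hgi.fst'
    by_cases hp : p ∈ Ω <;> simp [hp]
  let θ : ℕ → ℝ × ℝ → ℝ := fun n p => Real.smoothTransition (n * p.2 - 1)
  have hθ : ∀ n, ContDiff ℝ ∞ (θ n) := fun n =>
    Real.smoothTransition.contDiff.comp ((contDiff_const.mul contDiff_snd).sub contDiff_const)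
  have hθx : ∀ n p, partialX (θ n) p = 0 := by
    intro n p
    have h1 := hasDerivAt_partialX (φ := θ n) (((hθ n).differentiable (by simp)) p)
    exact h1.unique (hasDerivAt_const p.1 (Real.smoothTransition (n * p.2 - 1)))
  have hθb : ∀ n p, ‖θ n p‖ ≤ 1 := fun n p => by
    rw [Real.norm_eq_abs, abs_of_nonneg (Real.smoothTransition.nonneg _)]
    exact Real.smoothTransition.le_one _
  have hlim : ∀ p ∈ Ω, Tendsto (fun n => θ n p) atTop (𝓝 1) := by
    intro p hp
    refine tendsto_const_nhds.congr' ?_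
    obtain ⟨N, hN⟩ := exists_nat_gt (2 / p.2)
    filter_upwards [eventually_ge_atTop N] with n hn
    symm
    apply Real.smoothTransition.one_of_one_le
    have hp' := hpos p hp
    have : 2 / p.2 < n := hN.trans_le (by exact_mod_cast hn)
    rw [div_lt_iff₀ hp'] at this
    linarith
  have hprod : ∀ n p, partialX (fun q => θ n q * φ q) p = θ n p * partialX φ p := by
    intro n p
    have e := fderiv_fun_mul (((hθ n).differentiable (by simp)) p) ((hφ.differentiable (by simp)) p)
    have := hθx n p
    unfold partialX at this ⊢
    rw [e]
    simp [this]
  have heq : ∀ n, ∫ p in Ω, θ n p * (u p * partialX φ p) = -∫ p in Ω, θ n p * ((g p).1 * φ p) := by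
    intro n
    have hts : tsupport (fun q => θ n q * φ q) ⊆ Ω := by
      have h1 : tsupport (fun q => θ n q * φ q) ⊆ tsupport φ := tsupport_mul_subset_right
      have h2 : tsupport (fun q => θ n q * φ q) ⊆ {p : ℝ × ℝ | 1 ≤ n * p.2} := by
        refine closure_minimal (fun p hp => ?_)
          (isClosed_le continuous_const (continuous_const.mul continuous_snd))
        by_contra hn
        refine hp ?_
        simp only [mem_ofPred_eq, not_le] at hn
        simp [θ, Real.smoothTransition.zero_of_nonpos (show (n : ℝ) * p.2 - 1 ≤ 0 by linarith)]
      intro p hp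
      rcases hs (h1 hp) with h | h
      · exact h
      · exfalso
        have := h2 hp
        have h0 : p.2 ≤ 0 := h.2
        have : (n : ℝ) * p.2 ≤ 0 := mul_nonpos_of_nonneg_of_nonpos (Nat.cast_nonneg n) h0
        simp only [mem_ofPred_eq] at *
        linarith
    have := hg.partial_x _ ((hθ n).mul hφ) hc.mul_left hts
    have e : ∀ p, u p * fderiv ℝ (fun q => θ n q * φ q) p (1, 0) = θ n p * (u p * partialX φ p) := by
      intro p
      have := hprod n p
      unfold partialX at this ⊢
      rw [this]; ring
    have e2 : ∀ p, (g p).1 * (θ n p * φ p) = θ n p * ((g p).1 * φ p) := fun p => by ring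
    simp_rw [e, e2] at this
    exact this
  have dct : ∀ F : ℝ × ℝ → ℝ, IntegrableOn F Ω volume →
      Tendsto (fun n => ∫ p in Ω, θ n p * F p) atTop (𝓝 (∫ p in Ω, F p)) := by
    intro F hF
    refine tendsto_integral_of_dominated_convergence (fun p => ‖F p‖) ?_ hF.norm ?_ ?_
    · exact fun n => (hθ n).continuous.aestronglyMeasurable.mul hF.aestronglyMeasurable
    · intro n
      refine Eventually.of_forall fun p => ?_
      rw [norm_mul]
      exact mul_le_of_le_one_left (norm_nonneg _) (hθb n p)
    · filter_upwards [ae_restrict_mem hΩ.measurableSet] with p hp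
      simpa using (hlim p hp).mul_const (F p)
  have l1 := dct _ (hu.integrableOn_mul hΩ.measurableSet (contDiff_partialX hφ).continuous
    hc.partialX (tsupport_partialX_subset.trans hs))
  have l2 := (dct _ (hgi1.integrableOn_mul hΩ.measurableSet hφ.continuous hc hs)).neg
  simp_rw [heq] at l1
  exact tendsto_nhds_unique l1 l2

theorem contDiff_slice (hψ : ContDiff ℝ ∞ ψ) : ContDiff ℝ ∞ (fun x : ℝ => ψ (x, 0)) :=
  hψ.comp (contDiff_id.prodMk contDiff_const)

theorem hasCompactSupport_slice (hc : HasCompactSupport ψ) (y : ℝ) :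
    HasCompactSupport (fun x : ℝ => ψ (x, y)) := by
  refine HasCompactSupport.intro (hc.image continuous_fst) fun x hx => ?_
  refine image_eq_zero_of_notMem_tsupport fun h => hx ⟨(x, y), h, rfl⟩

/-- The gradient of a function with trace `x` pairs with the rotated gradient of `ψ` to the integral
of `ψ` along the axis. -/
theorem integral_grad_mul_rotated (hΩ : IsOpen Ω) (hpos : ∀ p ∈ Ω, 0 < p.2)
    (hg : IsWeakGrad Ω u g)
    (hu : LocallyIntegrableOn (Ω.indicator u) (Ω ∪ I ×ˢ Iic 0) volume)
    (hgi : LocallyIntegrableOn (Ω.indicator g) (Ω ∪ I ×ˢ Iic 0) volume)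
    (htr : ∀ φ : ℝ × ℝ → ℝ, ContDiff ℝ ∞ φ → HasCompactSupport φ → tsupport φ ⊆ Ω ∪ I ×ˢ Iic 0 →
      (∫ p in Ω, u p * fderiv ℝ φ p (0, 1)) + (∫ p in Ω, (g p).2 * φ p)
        = -∫ x in I, x * φ (x, 0))
    (hψ : ContDiff ℝ ∞ ψ) (hc : HasCompactSupport ψ) (hs : tsupport ψ ⊆ Ω ∪ I ×ˢ Iic 0) :
    IntegrableOn (fun p => (g p).2 * partialX ψ p - (g p).1 * partialY ψ p) Ω ∧
    ∫ p in Ω, ((g p).2 * partialX ψ p - (g p).1 * partialY ψ p) = ∫ x, ψ (x, 0) := by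
  have hgi1 : LocallyIntegrableOn (Ω.indicator fun p => (g p).1) (Ω ∪ I ×ˢ Iic 0) volume := by
    refine .congr (Eventually.of_forall fun p => ?_) hgi.fst'
    by_cases hp : p ∈ Ω <;> simp [hp]
  have hgi2 : LocallyIntegrableOn (Ω.indicator fun p => (g p).2) (Ω ∪ I ×ˢ Iic 0) volume := by
    refine .congr (Eventually.of_forall fun p => ?_) hgi.snd'
    by_cases hp : p ∈ Ω <;> simp [hp]
  have hX := contDiff_partialX hψ
  have hY := contDiff_partialY hψ
  have hsX := (tsupport_partialX_subset (φ := ψ)).trans hs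
  have hsY := (tsupport_partialY_subset (φ := ψ)).trans hs
  have i1 := hgi1.integrableOn_mul hΩ.measurableSet hY.continuous hc.partialY hsY
  have i2 := hgi2.integrableOn_mul hΩ.measurableSet hX.continuous hc.partialX hsX
  refine ⟨i2.sub i1, ?_⟩
  -- The horizontal identity is tested with `∂ᵧψ` and the trace identity with `∂ₓψ`. The terms in
  -- `u` cancel by symmetry of second derivatives, and the boundary term `-∫ x ∂ₓψ(x,0)` is
  -- integrated by parts.
  have e1 := integral_grad_fst_mul hΩ hpos hg hu hgi hY hc.partialY hsY
  have e2 := htr _ hX hc.partialX hsX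
  have e3 : ∫ p in Ω, u p * fderiv ℝ (partialX ψ) p (0, 1)
      = ∫ p in Ω, u p * partialX (partialY ψ) p := by
    simp_rw [partialX_partialY_comm hψ]; rfl
  rw [integral_sub i2 i1]
  have e4 : ∫ x in I, x * partialX ψ (x, 0) = ∫ x, x * partialX ψ (x, 0) := by
    refine setIntegral_eq_integral_of_forall_compl_eq_zero fun x hx => ?_
    rw [partialX_eq_zero, mul_zero]
    intro h
    rcases hs h with h | h
    · exact lt_irrefl _ (hpos _ h)
    · exact hx h.1
  have hsl := contDiff_slice hψ
  have hcs := hasCompactSupport_slice hc 0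
  have hcX := hasCompactSupport_slice (HasCompactSupport.partialX hc) 0
  have e5 : ∫ x, x * partialX ψ (x, 0) = -∫ x, 1 * ψ (x, 0) := by
    refine integral_mul_deriv_eq_deriv_mul_of_integrable (u := fun x => x)
      (v := fun x => ψ (x, 0)) (u' := fun _ => 1) (v' := fun x => partialX ψ (x, 0))
      (fun x _ => hasDerivAt_id x)
      (fun x _ => hasDerivAt_partialX (p := (x, 0)) ((hψ.differentiable (by simp)) _)) ?_ ?_ ?_
    · exact (continuous_id.mul (contDiff_slice hX).continuous).integrable_of_hasCompactSupport
        hcX.mul_left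
    · exact (continuous_const.mul hsl.continuous).integrable_of_hasCompactSupport hcs.mul_left
    · exact (continuous_id.mul hsl.continuous).integrable_of_hasCompactSupport hcs.mul_left
  simp only [one_mul] at e5
  linarith

/-- The dual functional: a lower bound for the Dirichlet energy of functions with trace `x`. -/
def dualValue (ψ : ℝ × ℝ → ℝ) : ℝ :=
  2 * (∫ x, ψ (x, 0)) - ∫ p in univ ×ˢ Ioi (0 : ℝ), (partialX ψ p ^ 2 + partialY ψ p ^ 2)

theorem integrable_partial_sq (hψ : ContDiff ℝ ∞ ψ) (hc : HasCompactSupport ψ) :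
    Integrable (fun p => partialX ψ p ^ 2 + partialY ψ p ^ 2) := by
  have h1 : Continuous fun p => partialX ψ p ^ 2 + partialY ψ p ^ 2 :=
    ((contDiff_partialX hψ).continuous.pow 2).add ((contDiff_partialY hψ).continuous.pow 2)
  refine h1.integrable_of_hasCompactSupport (HasCompactSupport.intro hc fun p hp => ?_)
  simp [partialX_eq_zero hp, partialY_eq_zero hp]

/-- Weak duality: integrate `2 (g₂ ∂ₓψ - g₁ ∂ᵧψ) ≤ |g|² + |∇ψ|²`. The set `B` localizes the bound to
the energy above the support of `ψ`, which later allows summation over disjoint intervals. -/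
theorem HasBottomTrace.dualValue_le (hΩ : IsOpen Ω) (hpos : ∀ p ∈ Ω, 0 < p.2)
    (h : HasBottomTrace Ω I u (fun x => x)) (hg : IsWeakGrad Ω u g)
    (hψ : ContDiff ℝ ∞ ψ) (hc : HasCompactSupport ψ) (hs : tsupport ψ ⊆ Ω ∪ I ×ˢ Iic 0)
    {B : Set (ℝ × ℝ)} (hB : MeasurableSet B) (hsB : tsupport ψ ⊆ B ∪ univ ×ˢ Iic 0) :
    ENNReal.ofReal (dualValue ψ)
      ≤ ∫⁻ p in B ∩ Ω, ENNReal.ofReal ((g p).1 ^ 2 + (g p).2 ^ 2) := by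
  obtain ⟨g', hg', hu, hgi, htr⟩ := h
  have hae := hg.ae_eq hΩ hg'
  have hae' : ∀ᵐ p ∂volume.restrict (B ∩ Ω), g p = g' p :=
    ae_restrict_of_ae_restrict_of_subset inter_subset_right hae
  have hrw : ∫⁻ p in B ∩ Ω, ENNReal.ofReal ((g p).1 ^ 2 + (g p).2 ^ 2)
      = ∫⁻ p in B ∩ Ω, ENNReal.ofReal ((g' p).1 ^ 2 + (g' p).2 ^ 2) := by
    refine lintegral_congr_ae ?_
    filter_upwards [hae'] with p hp
    rw [hp]
  rw [hrw]
  by_cases hfin : ∫⁻ p in B ∩ Ω, ENNReal.ofReal ((g' p).1 ^ 2 + (g' p).2 ^ 2) = ⊤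
  · rw [hfin]; exact le_top
  obtain ⟨hint, hval⟩ := integral_grad_mul_rotated hΩ hpos hg' hu hgi htr hψ hc hs
  have hBΩ : MeasurableSet (B ∩ Ω) := hB.inter hΩ.measurableSet
  have hmeas : AEStronglyMeasurable (fun p => (g' p).1 ^ 2 + (g' p).2 ^ 2)
      (volume.restrict (B ∩ Ω)) := by
    have h0 : AEStronglyMeasurable g' (volume.restrict (B ∩ Ω)) :=
      (hg'.locInt_grad.aestronglyMeasurable).mono_measure
        (Measure.restrict_mono inter_subset_right le_rfl)
    exact (h0.fst.pow 2).add (h0.snd.pow 2)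
  have hnn : ∀ p, 0 ≤ (g' p).1 ^ 2 + (g' p).2 ^ 2 := fun p => by positivity
  have hi : IntegrableOn (fun p => (g' p).1 ^ 2 + (g' p).2 ^ 2) (B ∩ Ω) := by
    refine ⟨hmeas, ?_⟩
    rw [hasFiniteIntegral_iff_ofReal (Eventually.of_forall hnn)]
    exact lt_top_iff_ne_top.2 hfin
  rw [← ofReal_integral_eq_lintegral_ofReal hi (Eventually.of_forall hnn)]
  refine ENNReal.ofReal_le_ofReal ?_
  have hsq := integrable_partial_sq hψ hc
  have e1 : ∫ p in Ω, ((g' p).2 * partialX ψ p - (g' p).1 * partialY ψ p)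
      = ∫ p in B ∩ Ω, ((g' p).2 * partialX ψ p - (g' p).1 * partialY ψ p) := by
    refine setIntegral_eq_of_subset_of_forall_sdiff_eq_zero hΩ.measurableSet inter_subset_right ?_
    intro p hp
    have : p ∉ tsupport ψ := by
      intro h
      rcases hsB h with h | h
      · exact hp.2 ⟨h, hp.1⟩
      · exact absurd (hpos p hp.1) (not_lt.2 h.2)
    simp [partialX_eq_zero this, partialY_eq_zero this]
  have e2 : ∫ p in B ∩ Ω, (partialX ψ p ^ 2 + partialY ψ p ^ 2)
      ≤ ∫ p in univ ×ˢ Ioi (0 : ℝ), (partialX ψ p ^ 2 + partialY ψ p ^ 2) := by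
    refine setIntegral_mono_set hsq.integrableOn
      (Eventually.of_forall fun p => by positivity) (Eventually.of_forall fun p hp => ?_)
    exact ⟨trivial, hpos p hp.2⟩
  have e3 : ∫ p in B ∩ Ω, (2 * ((g' p).2 * partialX ψ p - (g' p).1 * partialY ψ p)
      - (partialX ψ p ^ 2 + partialY ψ p ^ 2)) ≤ ∫ p in B ∩ Ω, ((g' p).1 ^ 2 + (g' p).2 ^ 2) := by
    refine integral_mono_ae
      (((hint.mono_set inter_subset_right).const_mul 2).sub hsq.integrableOn) hi
      (Eventually.of_forall fun p => ?_)
    have a := sq_nonneg ((g' p).2 - partialX ψ p)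
    have b := sq_nonneg ((g' p).1 + partialY ψ p)
    simp only
    linarith
  rw [integral_sub ((hint.mono_set inter_subset_right).const_mul 2) hsq.integrableOn,
    integral_const_mul, ← e1, hval] at e3
  unfold dualValue
  linarith

end Dual

end Island

end

/-! ### Smooth functions as competitors, and their behaviour under dilations. -/

noncomputable section

namespace Island

section Smooth

variable {Ω : Set (ℝ × ℝ)} {I : Set ℝ} {U : ℝ × ℝ → ℝ}

/-- The classical gradient. -/
def grad (U : ℝ × ℝ → ℝ) (p : ℝ × ℝ) : ℝ × ℝ := (partialX U p, partialY U p)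

theorem continuous_grad (hU : ContDiff ℝ ∞ U) : Continuous (grad U) :=
  (contDiff_partialX hU).continuous.prodMk (contDiff_partialY hU).continuous

theorem setIntegral_mul_fderiv (hU : ContDiff ℝ ∞ U) {φ : ℝ × ℝ → ℝ} (hφ : ContDiff ℝ ∞ φ)
    (hc : HasCompactSupport φ) (hs : tsupport φ ⊆ Ω) (v : ℝ × ℝ) :
    ∫ p in Ω, U p * fderiv ℝ φ p v = -∫ p in Ω, fderiv ℝ U p v * φ p := by
  have hcv : HasCompactSupport fun p => fderiv ℝ φ p v := hc.fderiv_apply ℝ v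
  rw [setIntegral_eq_integral_of_forall_compl_eq_zero,
    setIntegral_eq_integral_of_forall_compl_eq_zero]
  · refine integral_mul_fderiv_eq_neg_fderiv_mul_of_integrable ?_ ?_ ?_ ?_ ?_
    · exact ((contDiff_fderiv_apply hU v).continuous.mul
        hφ.continuous).integrable_of_hasCompactSupport hc.mul_left
    · exact (hU.continuous.mul (contDiff_fderiv_apply hφ v).continuous).integrable_of_hasCompactSupport
        hcv.mul_left
    · exact (hU.continuous.mul hφ.continuous).integrable_of_hasCompactSupport hc.mul_left
    · exact fun x _ => (hU.differentiable (by simp)) x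
    · exact fun x _ => (hφ.differentiable (by simp)) x
  · intro p hp
    rw [image_eq_zero_of_notMem_tsupport (fun h => hp (hs h)), mul_zero]
  · intro p hp
    have : fderiv ℝ φ p v = 0 :=
      image_eq_zero_of_notMem_tsupport (f := fun p => fderiv ℝ φ p v)
        fun h => hp (hs (tsupport_fderiv_apply_subset ℝ v h))
    rw [this, mul_zero]

theorem isWeakGrad_of_contDiff (hU : ContDiff ℝ ∞ U) : IsWeakGrad Ω U (grad U) where
  locInt := hU.continuous.locallyIntegrable.locallyIntegrableOn _
  locInt_grad := (continuous_grad hU).locallyIntegrable.locallyIntegrableOn _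
  partial_x := fun _ hφ hc hs => setIntegral_mul_fderiv hU hφ hc hs (1, 0)
  partial_y := fun _ hφ hc hs => setIntegral_mul_fderiv hU hφ hc hs (0, 1)

theorem integral_upper_partialY {f : ℝ × ℝ → ℝ} (hf : ContDiff ℝ ∞ f) (hc : HasCompactSupport f) :
    ∫ p in univ ×ˢ Ioi (0 : ℝ), partialY f p = -∫ x, f (x, 0) := by
  have hi : Integrable (partialY f) :=
    (contDiff_partialY hf).continuous.integrable_of_hasCompactSupport hc.partialY
  have h1 := setIntegral_prod (μ := volume) (ν := volume) (s := (univ : Set ℝ)) (t := Ioi (0 : ℝ))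
    (partialY f) hi.integrableOn
  rw [Measure.volume_eq_prod, h1, Measure.restrict_univ, ← integral_neg]
  refine integral_congr_ae (Eventually.of_forall fun x => ?_)
  have hfx : ContDiff ℝ 1 (fun y => f (x, y)) :=
    (hf.comp (contDiff_const.prodMk contDiff_id)).of_le (by simp)
  have hcx : HasCompactSupport (fun y => f (x, y)) := by
    refine HasCompactSupport.intro (hc.image continuous_snd) fun y hy => ?_
    exact image_eq_zero_of_notMem_tsupport fun h => hy ⟨(x, y), h, rfl⟩
  have := hcx.integral_Ioi_deriv_eq hfx 0
  refine Eq.trans ?_ this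
  refine setIntegral_congr_fun measurableSet_Ioi fun y _ => ?_
  exact ((hasDerivAt_partialY (φ := f) (p := (x, y)) ((hf.differentiable (by simp)) _)).deriv).symm

/-- In the upper half plane the support of a test function stays inside `Ω`, so Green's formula on
the half plane applies and the rest of the boundary of `Ω` is never seen. -/
theorem hasBottomTrace_of_contDiff (hΩ : IsOpen Ω) (hpos : ∀ p ∈ Ω, 0 < p.2)
    (hU : ContDiff ℝ ∞ U) (hU0 : ∀ x, U (x, 0) = x) :
    HasBottomTrace Ω I U (fun x => x) := by
  refine ⟨grad U, isWeakGrad_of_contDiff hU, ?_, ?_, ?_⟩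
  · exact (hU.continuous.locallyIntegrable.indicator hΩ.measurableSet).locallyIntegrableOn _
  · exact ((continuous_grad hU).locallyIntegrable.indicator hΩ.measurableSet).locallyIntegrableOn _
  intro φ hφ hc hs
  have hd := hU.differentiable (by simp)
  have hd' := hφ.differentiable (by simp)
  have hprod : ∀ p, partialY (fun q => U q * φ q) p = U p * fderiv ℝ φ p (0, 1)
      + (grad U p).2 * φ p := by
    intro p
    change fderiv ℝ (fun q => U q * φ q) p (0, 1) = U p * _ + fderiv ℝ U p (0, 1) * _
    rw [fderiv_fun_mul (hd p) (hd' p)]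
    simp [mul_comm]
  have i1 : Integrable fun p => U p * fderiv ℝ φ p (0, 1) :=
    (hU.continuous.mul (contDiff_fderiv_apply hφ _).continuous).integrable_of_hasCompactSupport
        (HasCompactSupport.mul_left (hc.fderiv_apply ℝ _))
  have i2 : Integrable fun p => (grad U p).2 * φ p :=
    ((contDiff_partialY hU).continuous.mul hφ.continuous).integrable_of_hasCompactSupport
      hc.mul_left
  rw [← integral_add i1.integrableOn i2.integrableOn]
  simp_rw [← hprod]
  have hcU : HasCompactSupport fun q => U q * φ q := hc.mul_left
  have hext : ∫ p in univ ×ˢ Ioi (0 : ℝ), partialY (fun q => U q * φ q) p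
      = ∫ p in Ω, partialY (fun q => U q * φ q) p := by
    refine setIntegral_eq_of_subset_of_forall_sdiff_eq_zero
      (MeasurableSet.univ.prod measurableSet_Ioi) (fun p hp => ⟨trivial, hpos p hp⟩) ?_
    intro p hp
    apply partialY_eq_zero
    intro h
    rcases hs (tsupport_mul_subset_right h) with h | h
    · exact hp.2 h
    · exact absurd (mem_Ioi.1 hp.1.2) (not_lt.2 h.2)
  rw [← hext, integral_upper_partialY (hU.mul hφ) hcU]
  congr 1
  simp_rw [hU0]
  symm
  refine setIntegral_eq_integral_of_forall_compl_eq_zero fun x hx => ?_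
  have h0 : φ (x, 0) = 0 := by
    refine image_eq_zero_of_notMem_tsupport fun h => ?_
    rcases hs h with h | h
    · exact lt_irrefl _ (hpos _ h)
    · exact hx h.1
  rw [h0, mul_zero]

theorem dirichletEnergy_of_contDiff (hΩ : IsOpen Ω) (hU : ContDiff ℝ ∞ U) :
    dirichletEnergy Ω U = ∫⁻ p in Ω, ENNReal.ofReal (partialX U p ^ 2 + partialY U p ^ 2) :=
  (isWeakGrad_of_contDiff hU).dirichletEnergy_eq hΩ

theorem memLp_two_of_continuous_of_bounded {E : Type*} [NormedAddCommGroup E]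
    [SecondCountableTopologyEither (ℝ × ℝ) E] {f : ℝ × ℝ → E}
    (hf : Continuous f) (hb : Bornology.IsBounded Ω) : MemLp f 2 (volume.restrict Ω) := by
  have hK : IsCompact (closure Ω) := hb.isCompact_closure
  have : MemLp f 2 (volume.restrict (closure Ω)) := by
    obtain ⟨C, hC⟩ := hK.exists_bound_of_continuousOn hf.continuousOn
    have : IsFiniteMeasure (volume.restrict (closure Ω)) :=
      ⟨by simpa using hK.measure_lt_top⟩
    refine MemLp.of_bound hf.aestronglyMeasurable C ?_
    filter_upwards [ae_restrict_mem isClosed_closure.measurableSet] with p hp using hC p hp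
  exact this.mono_measure (Measure.restrict_mono subset_closure le_rfl)

theorem memH1_of_contDiff (hU : ContDiff ℝ ∞ U) (hb : Bornology.IsBounded Ω) : MemH1 Ω U :=
  ⟨memLp_two_of_continuous_of_bounded hU.continuous hb, grad U, isWeakGrad_of_contDiff hU,
    memLp_two_of_continuous_of_bounded (continuous_grad hU) hb⟩

end Smooth

section Scaling

/-- The affine dilation of the plane that maps `(a, a + b) × (0, t)` to the unit square. -/
def dilation (a : ℝ) {b t : ℝ} (hb : b ≠ 0) (ht : t ≠ 0) : ℝ × ℝ ≃ₜ ℝ × ℝ :=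
  ((Homeomorph.addRight (-a)).trans (Homeomorph.mulLeft₀ b⁻¹ (inv_ne_zero hb))).prodCongr
    (Homeomorph.mulLeft₀ t⁻¹ (inv_ne_zero ht))

theorem dilation_apply (a : ℝ) {b t : ℝ} (hb : b ≠ 0) (ht : t ≠ 0) (p : ℝ × ℝ) :
    dilation a hb ht p = ((p.1 - a) / b, p.2 / t) := by
  rw [div_eq_inv_mul, div_eq_inv_mul, sub_eq_add_neg]
  rfl

theorem map_dilation (a : ℝ) {b t : ℝ} (hb : 0 < b) (ht : 0 < t) :
    Measure.map (dilation a hb.ne' ht.ne') (volume : Measure (ℝ × ℝ))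
      = ENNReal.ofReal (b * t) • volume := by
  have h1 : Measure.map ((Homeomorph.addRight (-a)).trans
      (Homeomorph.mulLeft₀ b⁻¹ (inv_ne_zero hb.ne'))) (volume : Measure ℝ)
      = ENNReal.ofReal b • volume := by
    have : (⇑((Homeomorph.addRight (-a)).trans (Homeomorph.mulLeft₀ b⁻¹ (inv_ne_zero hb.ne'))) :
        ℝ → ℝ) = (fun x => b⁻¹ * x) ∘ (fun x => x + -a) := rfl
    rw [this, ← Measure.map_map (by fun_prop) (by fun_prop), map_add_right_eq_self,
      Real.map_volume_mul_left (inv_ne_zero hb.ne'), inv_inv, abs_of_pos hb]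
  have h2 : Measure.map (Homeomorph.mulLeft₀ t⁻¹ (inv_ne_zero ht.ne')) (volume : Measure ℝ)
      = ENNReal.ofReal t • volume := by
    have : (⇑(Homeomorph.mulLeft₀ t⁻¹ (inv_ne_zero ht.ne')) : ℝ → ℝ) = fun x => t⁻¹ * x := rfl
    rw [this, Real.map_volume_mul_left (inv_ne_zero ht.ne'), inv_inv, abs_of_pos ht]
  change Measure.map (Prod.map ((Homeomorph.addRight (-a)).trans
    (Homeomorph.mulLeft₀ b⁻¹ (inv_ne_zero hb.ne'))) (Homeomorph.mulLeft₀ t⁻¹ (inv_ne_zero ht.ne')))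
    (volume.prod volume) = _ • (volume.prod volume)
  rw [← Measure.map_prod_map _ _ (Homeomorph.measurable _) (Homeomorph.measurable _), h1, h2,
    Measure.prod_smul_left, Measure.prod_smul_right, smul_smul, ENNReal.ofReal_mul hb.le]

theorem setIntegral_dilation (a : ℝ) {b t : ℝ} (hb : 0 < b) (ht : 0 < t) (F : ℝ × ℝ → ℝ)
    (s : Set (ℝ × ℝ)) :
    ∫ p in dilation a hb.ne' ht.ne' ⁻¹' s, F (dilation a hb.ne' ht.ne' p)
      = b * t * ∫ p in s, F p := by
  rw [← (dilation a hb.ne' ht.ne').measurableEmbedding.setIntegral_map, map_dilation a hb ht,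
    Measure.restrict_smul, integral_smul_measure, ENNReal.toReal_ofReal (by positivity),
    smul_eq_mul]

theorem setLIntegral_dilation (a : ℝ) {b t : ℝ} (hb : 0 < b) (ht : 0 < t) (F : ℝ × ℝ → ℝ≥0∞)
    (s : Set (ℝ × ℝ)) :
    ∫⁻ p in dilation a hb.ne' ht.ne' ⁻¹' s, F (dilation a hb.ne' ht.ne' p)
      = ENNReal.ofReal (b * t) * ∫⁻ p in s, F p := by
  have he := (dilation a hb.ne' ht.ne').measurableEmbedding
  rw [← he.lintegral_map F, ← he.restrict_map, map_dilation a hb ht,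
    Measure.restrict_smul, lintegral_smul_measure, smul_eq_mul]

/-- The function `A f((x - a) / b, y / t)`. -/
def dilate (A a b t : ℝ) (f : ℝ × ℝ → ℝ) (p : ℝ × ℝ) : ℝ := A * f ((p.1 - a) / b, p.2 / t)

variable {A a b t : ℝ} {f : ℝ × ℝ → ℝ}

theorem contDiff_dilate (hf : ContDiff ℝ ∞ f) : ContDiff ℝ ∞ (dilate A a b t f) := by
  have : ContDiff ℝ ∞ fun p : ℝ × ℝ => ((p.1 - a) / b, p.2 / t) :=
    ((contDiff_fst.sub contDiff_const).div_const b).prodMk (contDiff_snd.div_const t)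
  exact contDiff_const.mul (hf.comp this)

theorem partialX_dilate (hf : ContDiff ℝ ∞ f) (p : ℝ × ℝ) :
    partialX (dilate A a b t f) p = A / b * partialX f ((p.1 - a) / b, p.2 / t) := by
  have h1 := hasDerivAt_partialX (p := p)
    (((contDiff_dilate (A := A) (a := a) (b := b) (t := t) hf).differentiable (by simp)) p)
  have h2 := hasDerivAt_partialX (p := ((p.1 - a) / b, p.2 / t)) ((hf.differentiable (by simp)) _)
  have h3 : HasDerivAt (fun x => (x - a) / b) (1 / b) p.1 :=
    ((hasDerivAt_id p.1).sub_const a).div_const b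
  have h4 := (HasDerivAt.comp p.1 h2 h3).const_mul A
  rw [h1.unique h4]
  ring

theorem partialY_dilate (hf : ContDiff ℝ ∞ f) (p : ℝ × ℝ) :
    partialY (dilate A a b t f) p = A / t * partialY f ((p.1 - a) / b, p.2 / t) := by
  have h1 := hasDerivAt_partialY (p := p)
    (((contDiff_dilate (A := A) (a := a) (b := b) (t := t) hf).differentiable (by simp)) p)
  have h2 := hasDerivAt_partialY (p := ((p.1 - a) / b, p.2 / t)) ((hf.differentiable (by simp)) _)
  have h3 : HasDerivAt (fun x => x / t) (1 / t) p.2 := (hasDerivAt_id p.2).div_const t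
  have h4 := (HasDerivAt.comp p.2 h2 h3).const_mul A
  rw [h1.unique h4]
  ring

theorem dilate_eq_comp (hb : b ≠ 0) (ht : t ≠ 0) :
    dilate A a b t f = fun p => A * f (dilation a hb ht p) := by
  ext p
  rw [dilation_apply]
  rfl

theorem tsupport_dilate_subset (hb : b ≠ 0) (ht : t ≠ 0) :
    tsupport (dilate A a b t f) ⊆ dilation a hb ht ⁻¹' tsupport f := by
  rw [dilate_eq_comp hb ht]
  refine tsupport_mul_subset_right.trans ?_
  exact tsupport_comp_subset_preimage f (dilation a hb ht).continuous

theorem hasCompactSupport_dilate (hb : b ≠ 0) (ht : t ≠ 0) (hc : HasCompactSupport f) :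
    HasCompactSupport (dilate A a b t f) := by
  rw [dilate_eq_comp hb ht]
  exact (hc.comp_homeomorph (dilation a hb ht)).mul_left

/-- The two directions are dilated independently: the coarse bound has to squeeze a test function
under a level lower than the width, while the sharp bound uses `t = b`. -/
theorem dualValue_dilate (hb : 0 < b) (ht : 0 < t) (hf : ContDiff ℝ ∞ f)
    (hc : HasCompactSupport f) :
    dualValue (dilate A a b t f) = 2 * A * b * (∫ x, f (x, 0))
      - A ^ 2 * (t / b * (∫ p in univ ×ˢ Ioi (0 : ℝ), partialX f p ^ 2)
        + b / t * (∫ p in univ ×ˢ Ioi (0 : ℝ), partialY f p ^ 2)) := by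
  have hX : IntegrableOn (fun p => partialX f p ^ 2) (univ ×ˢ Ioi (0 : ℝ)) :=
    (((contDiff_partialX hf).continuous.pow 2).integrable_of_hasCompactSupport
      (HasCompactSupport.intro hc fun p hp => by simp [partialX_eq_zero hp])).integrableOn
  have hY : IntegrableOn (fun p => partialY f p ^ 2) (univ ×ˢ Ioi (0 : ℝ)) :=
    (((contDiff_partialY hf).continuous.pow 2).integrable_of_hasCompactSupport
      (HasCompactSupport.intro hc fun p hp => by simp [partialY_eq_zero hp])).integrableOn
  have hpre : dilation a hb.ne' ht.ne' ⁻¹' (univ ×ˢ Ioi (0 : ℝ)) = univ ×ˢ Ioi (0 : ℝ) := by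
    ext p
    simp [dilation_apply, div_pos_iff_of_pos_right ht]
  have e1 : ∫ p in univ ×ˢ Ioi (0 : ℝ),
      (partialX (dilate A a b t f) p ^ 2 + partialY (dilate A a b t f) p ^ 2)
      = b * t * ∫ p in univ ×ˢ Ioi (0 : ℝ),
        ((A / b) ^ 2 * partialX f p ^ 2 + (A / t) ^ 2 * partialY f p ^ 2) := by
    rw [← setIntegral_dilation a hb ht, hpre]
    refine integral_congr_ae (Eventually.of_forall fun p => ?_)
    simp only [partialX_dilate hf, partialY_dilate hf, dilation_apply]
    ring
  have e2 : ∫ x, dilate A a b t f (x, 0) = A * b * ∫ x, f (x, 0) := by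
    simp only [dilate, zero_div]
    rw [integral_const_mul, integral_sub_right_eq_self (fun x => f (x / b, 0)) a,
      Measure.integral_comp_div (fun x => f (x, 0)) b, abs_of_pos hb, smul_eq_mul, mul_assoc]
  unfold dualValue
  rw [e1, e2, integral_add (hX.const_mul _) (hY.const_mul _), integral_const_mul,
    integral_const_mul]
  field_simp

end Scaling

end Island

end

noncomputable section

namespace Island

/-! ### The sine series of the constant one on the unit interval. -/

section Fourier

/-- The odd frequencies `(2k+1)π`. -/
def freq (k : ℕ) : ℝ := (2 * k + 1) * Real.pi

theorem freq_pos (k : ℕ) : 0 < freq k := by unfold freq; positivity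

theorem one_le_freq (k : ℕ) : 1 ≤ freq k := by
  have := Real.pi_gt_three
  have hk : (0 : ℝ) ≤ k := Nat.cast_nonneg k
  unfold freq
  nlinarith

theorem integral_cos_int_mul_pi {m : ℤ} (hm : m ≠ 0) :
    ∫ x in (0 : ℝ)..1, Real.cos (m * Real.pi * x) = 0 := by
  have h : (m : ℝ) * Real.pi ≠ 0 := mul_ne_zero (by exact_mod_cast hm) Real.pi_ne_zero
  rw [intervalIntegral.integral_comp_mul_left (fun x => Real.cos x) h]
  simp [Real.sin_int_mul_pi]

theorem integral_sin_freq (k : ℕ) : ∫ x in (0 : ℝ)..1, Real.sin (freq k * x) = 2 / freq k := by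
  rw [intervalIntegral.integral_comp_mul_left (fun x => Real.sin x) (freq_pos k).ne']
  have : Real.cos (freq k) = -1 := by
    unfold freq
    rw [show (2 * (k : ℝ) + 1) * Real.pi = Real.pi + (k : ℤ) * (2 * Real.pi) by push_cast; ring,
      Real.cos_add_int_mul_two_pi, Real.cos_pi]
  simp [this]
  ring

theorem integral_sin_freq_mul_sin_freq (j k : ℕ) :
    ∫ x in (0 : ℝ)..1, Real.sin (freq j * x) * Real.sin (freq k * x) = if j = k then 1 / 2 else 0 := by
  have h : ∀ x, Real.sin (freq j * x) * Real.sin (freq k * x)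
      = (Real.cos (((2 * j - 2 * k : ℤ) : ℝ) * Real.pi * x)
        - Real.cos (((2 * j + 2 * k + 2 : ℤ) : ℝ) * Real.pi * x)) / 2 := by
    intro x
    have e1 : ((2 * j - 2 * k : ℤ) : ℝ) * Real.pi * x = freq j * x - freq k * x := by
      unfold freq; push_cast; ring
    have e2 : ((2 * j + 2 * k + 2 : ℤ) : ℝ) * Real.pi * x = freq j * x + freq k * x := by
      unfold freq; push_cast; ring
    rw [e1, e2, Real.cos_sub, Real.cos_add]
    ring
  simp_rw [h]
  rw [intervalIntegral.integral_div, intervalIntegral.integral_sub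
    (Continuous.intervalIntegrable (by fun_prop) _ _)
    (Continuous.intervalIntegrable (by fun_prop) _ _),
    integral_cos_int_mul_pi (m := 2 * j + 2 * k + 2) (by omega)]
  split_ifs with hjk
  · subst hjk
    simp
  · rw [integral_cos_int_mul_pi (m := 2 * j - 2 * k) (by omega)]
    simp

/-- The defect of the partial sine series of the constant one. -/
def sineDefect (N : ℕ) (x : ℝ) : ℝ := 1 - ∑ k ∈ Finset.range N, 4 / freq k * Real.sin (freq k * x)

@[fun_prop]
theorem continuous_sineDefect (N : ℕ) : Continuous (sineDefect N) := by
  unfold sineDefect; fun_prop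

/-- The subtracted modes are orthogonal to the later mode `m`, so only the constant one contributes.
-/
theorem integral_sineDefect_mul_sin (N : ℕ) {m : ℕ} (hm : N ≤ m) :
    ∫ x in (0 : ℝ)..1, sineDefect N x * Real.sin (freq m * x) = 2 / freq m := by
  induction N with
  | zero => simp [sineDefect, integral_sin_freq]
  | succ n ih =>
    have : ∀ x, sineDefect (n + 1) x * Real.sin (freq m * x)
        = sineDefect n x * Real.sin (freq m * x)
          - 4 / freq n * (Real.sin (freq n * x) * Real.sin (freq m * x)) := by
      intro x
      simp only [sineDefect, Finset.sum_range_succ]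
      ring
    simp_rw [this]
    rw [intervalIntegral.integral_sub (Continuous.intervalIntegrable (by fun_prop) _ _)
      (Continuous.intervalIntegrable (by fun_prop) _ _), ih (by omega),
      intervalIntegral.integral_const_mul, integral_sin_freq_mul_sin_freq,
      if_neg (by omega : n ≠ m)]
    simp

theorem integral_sineDefect_sq (N : ℕ) :
    ∫ x in (0 : ℝ)..1, sineDefect N x ^ 2 = 1 - ∑ k ∈ Finset.range N, 8 / freq k ^ 2 := by
  induction N with
  | zero => simp [sineDefect]
  | succ n ih =>
    have : ∀ x, sineDefect (n + 1) x ^ 2 = (sineDefect n x ^ 2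
        - 8 / freq n * (sineDefect n x * Real.sin (freq n * x)))
        + 16 / freq n ^ 2 * (Real.sin (freq n * x) * Real.sin (freq n * x)) := by
      intro x
      simp only [sineDefect, Finset.sum_range_succ]
      ring
    simp_rw [this]
    rw [intervalIntegral.integral_add (Continuous.intervalIntegrable (by fun_prop) _ _)
      (Continuous.intervalIntegrable (by fun_prop) _ _),
      intervalIntegral.integral_sub (Continuous.intervalIntegrable (by fun_prop) _ _)
      (Continuous.intervalIntegrable (by fun_prop) _ _), ih,
      intervalIntegral.integral_const_mul, intervalIntegral.integral_const_mul,
      integral_sin_freq_mul_sin_freq, integral_sineDefect_mul_sin n le_rfl, if_pos rfl,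
      Finset.sum_range_succ]
    have := (freq_pos n).ne'
    field_simp
    ring

/-- Parseval for the constant one: removing the even terms from `ζ(2) = π²/6` leaves `∑ 1/(2k+1)² =
π²/8`. -/
theorem hasSum_freq : HasSum (fun k : ℕ => 8 / freq k ^ 2) 1 := by
  have h := hasSum_zeta_two
  have hs : Summable fun n : ℕ => (1 : ℝ) / (n : ℝ) ^ 2 := h.summable
  have he : Summable fun k : ℕ => (1 : ℝ) / ((2 * k : ℕ) : ℝ) ^ 2 :=
    hs.comp_injective (i := fun k : ℕ => 2 * k) fun a b (hab : 2 * a = 2 * b) => by omega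
  have ho : Summable fun k : ℕ => (1 : ℝ) / ((2 * k + 1 : ℕ) : ℝ) ^ 2 :=
    hs.comp_injective (i := fun k : ℕ => 2 * k + 1)
      fun a b (hab : 2 * a + 1 = 2 * b + 1) => by omega
  have hsum := tsum_even_add_odd (f := fun n : ℕ => (1 : ℝ) / (n : ℝ) ^ 2) he ho
  rw [h.tsum_eq] at hsum
  have he' : ∑' k : ℕ, (1 : ℝ) / ((2 * k : ℕ) : ℝ) ^ 2 = Real.pi ^ 2 / 6 / 4 := by
    rw [← h.tsum_eq, ← tsum_div_const]
    refine tsum_congr fun k => ?_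
    push_cast
    rw [mul_pow, one_div, one_div, mul_inv]
    ring
  rw [he'] at hsum
  have ho' : ∑' k : ℕ, (1 : ℝ) / ((2 * k + 1 : ℕ) : ℝ) ^ 2 = Real.pi ^ 2 / 8 := by linarith
  have := (ho.hasSum.mul_left (8 / Real.pi ^ 2))
  rw [ho'] at this
  have hpi := Real.pi_ne_zero
  rw [show 8 / Real.pi ^ 2 * (Real.pi ^ 2 / 8) = 1 by field_simp] at this
  refine (funext fun k => ?_ : (fun k : ℕ => 8 / freq k ^ 2) = _) ▸ this
  unfold freq
  push_cast
  rw [mul_pow, mul_comm ((2 * (k : ℝ) + 1) ^ 2), div_mul_div_comm, mul_one]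

theorem tendsto_integral_sineDefect_sq :
    Tendsto (fun N => ∫ x in (0 : ℝ)..1, sineDefect N x ^ 2) atTop (𝓝 0) := by
  simp_rw [integral_sineDefect_sq]
  simpa using hasSum_freq.tendsto_sum_nat.const_sub 1

/-- The difference of `x` and the partial cosine series on the axis. -/
def cosineDefect (N : ℕ) (x : ℝ) : ℝ :=
  x - 1 / 2 + ∑ k ∈ Finset.range N, 4 / freq k ^ 2 * Real.cos (freq k * x)

theorem hasDerivAt_cosineDefect (N : ℕ) (x : ℝ) :
    HasDerivAt (cosineDefect N) (sineDefect N x) x := by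
  unfold cosineDefect sineDefect
  have h : ∀ k ∈ Finset.range N, HasDerivAt (fun x => 4 / freq k ^ 2 * Real.cos (freq k * x))
      (-(4 / freq k * Real.sin (freq k * x))) x := by
    intro k _
    have h1 := ((hasDerivAt_id x).const_mul (freq k)).cos.const_mul (4 / freq k ^ 2)
    refine h1.congr_deriv ?_
    have := (freq_pos k).ne'
    simp only [id]
    field_simp
  have := ((hasDerivAt_id x).sub_const (1 / 2)).add (HasDerivAt.fun_sum h)
  refine this.congr_deriv ?_
  rw [Finset.sum_neg_distrib]
  ring

theorem cosineDefect_half (N : ℕ) : cosineDefect N (1 / 2) = 0 := by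
  unfold cosineDefect
  rw [Finset.sum_eq_zero, sub_self, zero_add]
  intro k _
  have : Real.cos (freq k * (1 / 2)) = 0 := by
    rw [Real.cos_eq_zero_iff]
    exact ⟨k, by unfold freq; push_cast; ring⟩
  rw [this, mul_zero]

/-- The derivative of `cosineDefect` is `sineDefect`, and the midpoint is a zero, so the `L²` bound
on the derivative gives a uniform bound. The Cauchy–Schwarz step takes the form `|d| ≤ s/2 +
d²/(2s)`. -/
theorem abs_cosineDefect_le (N : ℕ) {s : ℝ} (hs : 0 < s)
    (h : ∫ x in (0 : ℝ)..1, sineDefect N x ^ 2 ≤ s ^ 2) {x : ℝ} (hx : x ∈ Icc (0 : ℝ) 1) :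
    |cosineDefect N x| ≤ s := by
  have hftc : ∫ t in (1 / 2 : ℝ)..x, sineDefect N t = cosineDefect N x := by
    rw [intervalIntegral.integral_eq_sub_of_hasDerivAt (fun t _ => hasDerivAt_cosineDefect N t)
      ((continuous_sineDefect N).intervalIntegrable _ _), cosineDefect_half, sub_zero]
  have h1 : |∫ t in (1 / 2 : ℝ)..x, sineDefect N t|
      ≤ |∫ t in (1 / 2 : ℝ)..x, (|sineDefect N t|)| :=
    intervalIntegral.norm_integral_le_abs_integral_norm (f := sineDefect N)
  have h2 : |∫ t in (1 / 2 : ℝ)..x, (|sineDefect N t|)|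
      ≤ |∫ t in (0 : ℝ)..1, (|sineDefect N t|)| := by
    refine intervalIntegral.abs_integral_mono_interval ?_
      (Eventually.of_forall fun t => abs_nonneg _)
      ((continuous_sineDefect N).abs.intervalIntegrable _ _)
    rw [uIoc_of_le zero_le_one]
    rcases le_total (1 / 2) x with h | h
    · rw [uIoc_of_le h]
      exact Ioc_subset_Ioc (by norm_num) hx.2
    · rw [uIoc_of_ge h]
      exact Ioc_subset_Ioc hx.1 (by norm_num)
  have h3 : ∫ t in (0 : ℝ)..1, |sineDefect N t| ≤
      ∫ t in (0 : ℝ)..1, (s / 2 + sineDefect N t ^ 2 / (2 * s)) := by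
    refine intervalIntegral.integral_mono_on zero_le_one
      ((continuous_sineDefect N).abs.intervalIntegrable _ _)
      (Continuous.intervalIntegrable (by fun_prop) _ _) fun t _ => ?_
    have := sq_nonneg (|sineDefect N t| - s)
    rw [← sq_abs (sineDefect N t)]
    rw [show s / 2 + |sineDefect N t| ^ 2 / (2 * s) = (s ^ 2 + |sineDefect N t| ^ 2) / (2 * s) by
      field_simp, le_div_iff₀ (by positivity)]
    linarith
  rw [intervalIntegral.integral_add (Continuous.intervalIntegrable (by fun_prop) _ _)
    (Continuous.intervalIntegrable (by fun_prop) _ _),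
    intervalIntegral.integral_div (2 * s)] at h3
  have h4 : (∫ t in (0 : ℝ)..1, sineDefect N t ^ 2) / (2 * s) ≤ s / 2 := by
    rw [div_le_iff₀ (by positivity)]
    linarith [h, show s / 2 * (2 * s) = s ^ 2 by ring]
  have h5 : 0 ≤ ∫ t in (0 : ℝ)..1, |sineDefect N t| :=
    intervalIntegral.integral_nonneg zero_le_one fun t _ => abs_nonneg _
  rw [abs_of_nonneg h5] at h2
  rw [hftc] at h1
  have h6 : ∫ _ in (0 : ℝ)..1, s / 2 = s / 2 := by simp
  linarith

end Fourier

/-! ### Cutoffs for the half strip. -/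

section Transition

theorem deriv_smoothTransition_eq_zero {s : ℝ} (h : s ≤ 0 ∨ 1 ≤ s) :
    deriv Real.smoothTransition s = 0 := by
  rcases h with h | h
  · refine IsLocalMin.deriv_eq_zero (Eventually.of_forall fun t => ?_)
    rw [Real.smoothTransition.zero_of_nonpos h]
    exact Real.smoothTransition.nonneg t
  · refine IsLocalMax.deriv_eq_zero (Eventually.of_forall fun t => ?_)
    rw [Real.smoothTransition.one_of_one_le h]
    exact Real.smoothTransition.le_one t

theorem exists_abs_deriv_smoothTransition_le :
    ∃ C : ℝ, 0 < C ∧ ∀ s, |deriv Real.smoothTransition s| ≤ C := by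
  have hc : Continuous (deriv Real.smoothTransition) :=
    (Real.smoothTransition.contDiff (n := 1)).continuous_deriv le_rfl
  obtain ⟨C, hC⟩ := (isCompact_Icc (a := (0 : ℝ)) (b := 1)).exists_bound_of_continuousOn
    hc.continuousOn
  refine ⟨max C 1, by positivity, fun s => ?_⟩
  by_cases hs : s ∈ Icc (0 : ℝ) 1
  · exact (hC s hs).trans (le_max_left _ _)
  · rw [deriv_smoothTransition_eq_zero, abs_zero]
    · positivity
    · rw [mem_Icc, not_and_or, not_le, not_le] at hs
      exact hs.imp le_of_lt le_of_lt

theorem hasDerivAt_smoothTransition (s : ℝ) :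
    HasDerivAt Real.smoothTransition (deriv Real.smoothTransition s) s :=
  ((Real.smoothTransition.contDiff (n := 1)).differentiable one_ne_zero s).hasDerivAt

/-- A smooth cutoff that vanishes within `1/n` of the ends of the unit interval. -/
def cutX (n : ℕ) (x : ℝ) : ℝ :=
  Real.smoothTransition (n * x - 1) * Real.smoothTransition (n * (1 - x) - 1)

/-- The derivative of `cutX`. -/
def cutX' (n : ℕ) (x : ℝ) : ℝ :=
  n * deriv Real.smoothTransition (n * x - 1) * Real.smoothTransition (n * (1 - x) - 1)
    - Real.smoothTransition (n * x - 1) * (n * deriv Real.smoothTransition (n * (1 - x) - 1))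

/-- A smooth cutoff that vanishes outside `(-2, n+1)`. -/
def cutY (n : ℕ) (y : ℝ) : ℝ :=
  Real.smoothTransition (n + 1 - y) * Real.smoothTransition (y + 2)

/-- The derivative of `cutY` on the positive axis. -/
def cutY' (n : ℕ) (y : ℝ) : ℝ := -deriv Real.smoothTransition (n + 1 - y)

theorem contDiff_cutX (n : ℕ) : ContDiff ℝ ∞ (cutX n) :=
  (Real.smoothTransition.contDiff.comp (by fun_prop)).mul
    (Real.smoothTransition.contDiff.comp (by fun_prop))

theorem contDiff_cutY (n : ℕ) : ContDiff ℝ ∞ (cutY n) :=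
  (Real.smoothTransition.contDiff.comp (by fun_prop)).mul
    (Real.smoothTransition.contDiff.comp (by fun_prop))

theorem hasDerivAt_cutX (n : ℕ) (x : ℝ) : HasDerivAt (cutX n) (cutX' n x) x := by
  have h1 : HasDerivAt (fun x : ℝ => (n : ℝ) * x - 1) n x := by
    simpa using ((hasDerivAt_id x).const_mul (n : ℝ)).sub_const 1
  have h2 : HasDerivAt (fun x : ℝ => (n : ℝ) * (1 - x) - 1) (-n) x := by
    simpa using (((hasDerivAt_id x).const_sub 1).const_mul (n : ℝ)).sub_const 1
  have := ((hasDerivAt_smoothTransition _).comp x h1).mul ((hasDerivAt_smoothTransition _).comp x h2)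
  refine this.congr_deriv ?_
  simp only [cutX', Function.comp]
  ring

theorem hasDerivAt_cutY (n : ℕ) {y : ℝ} (hy : 0 < y) : HasDerivAt (cutY n) (cutY' n y) y := by
  have h1 : HasDerivAt (fun y : ℝ => (n : ℝ) + 1 - y) (-1) y := by
    simpa using (hasDerivAt_id y).const_sub ((n : ℝ) + 1)
  have h2 : HasDerivAt (fun y : ℝ => y + 2) 1 y := by
    simpa using (hasDerivAt_id y).add_const 2
  have := ((hasDerivAt_smoothTransition _).comp y h1).mul ((hasDerivAt_smoothTransition _).comp y h2)
  refine this.congr_deriv ?_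
  simp only [cutY', Function.comp]
  rw [deriv_smoothTransition_eq_zero (s := y + 2) (Or.inr (by linarith)),
    Real.smoothTransition.one_of_one_le (x := y + 2) (by linarith)]
  ring

theorem abs_smoothTransition_le (s : ℝ) : |Real.smoothTransition s| ≤ 1 := by
  rw [abs_of_nonneg (Real.smoothTransition.nonneg _)]
  exact Real.smoothTransition.le_one _

theorem abs_cutX_le (n : ℕ) (x : ℝ) : |cutX n x| ≤ 1 := by
  rw [cutX, abs_mul]
  exact mul_le_one₀ (abs_smoothTransition_le _) (abs_nonneg _) (abs_smoothTransition_le _)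

theorem abs_cutY_le (n : ℕ) (y : ℝ) : |cutY n y| ≤ 1 := by
  rw [cutY, abs_mul]
  exact mul_le_one₀ (abs_smoothTransition_le _) (abs_nonneg _) (abs_smoothTransition_le _)

/-- The derivative of the cutoff has size `n`, but only within distance `2/n` of the ends, where a
factor vanishing linearly compensates it. The bound is uniform in `n`, as dominated convergence
requires. -/
theorem abs_cutX'_mul_le {C : ℝ} (hC : ∀ s, |deriv Real.smoothTransition s| ≤ C) (hC0 : 0 < C)
    (n : ℕ) {x v A : ℝ} (hA : 0 ≤ A) (hx : x ∈ Ioo (0 : ℝ) 1) (h1 : |v| ≤ A * x)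
    (h2 : |v| ≤ A * (1 - x)) : |cutX' n x * v| ≤ 4 * C * A := by
  have key : ∀ t : ℝ, 0 < t → |v| ≤ A * t →
      |n * deriv Real.smoothTransition (n * t - 1)| * |v| ≤ 2 * C * A := by
    intro t ht hv
    by_cases hs : 2 ≤ n * t
    · rw [deriv_smoothTransition_eq_zero (Or.inr (by linarith))]
      simp only [mul_zero, abs_zero, zero_mul]
      positivity
    · rw [abs_mul, Nat.abs_cast]
      calc (n : ℝ) * |deriv Real.smoothTransition (n * t - 1)| * |v|
          ≤ n * C * (A * t) := by gcongr; exact hC _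
        _ = n * t * (C * A) := by ring
        _ ≤ 2 * (C * A) := by
            have : (0 : ℝ) ≤ C * A := by positivity
            nlinarith
        _ = 2 * C * A := by ring
  have k1 := key x hx.1 h1
  have k2 := key (1 - x) (by linarith [hx.2]) h2
  have t1 := abs_smoothTransition_le (n * (1 - x) - 1)
  have t2 := abs_smoothTransition_le (n * x - 1)
  rw [abs_mul, cutX']
  calc _ ≤ (|n * deriv Real.smoothTransition (n * x - 1)| * |Real.smoothTransition (n * (1 - x) - 1)|
        + |Real.smoothTransition (n * x - 1)| * |n * deriv Real.smoothTransition (n * (1 - x) - 1)|)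
          * |v| := by
        refine mul_le_mul_of_nonneg_right ((abs_sub _ _).trans (le_of_eq ?_)) (abs_nonneg _)
        rw [abs_mul, abs_mul (Real.smoothTransition _)]
    _ ≤ (|n * deriv Real.smoothTransition (n * x - 1)| * 1
        + 1 * |n * deriv Real.smoothTransition (n * (1 - x) - 1)|) * |v| := by gcongr
    _ ≤ 4 * C * A := by linarith

theorem eventually_cutX (x : ℝ) (hx : x ∈ Ioo (0 : ℝ) 1) :
    ∀ᶠ n : ℕ in atTop, cutX n x = 1 ∧ cutX' n x = 0 := by
  obtain ⟨N1, h1⟩ := exists_nat_gt (2 / x)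
  obtain ⟨N2, h2⟩ := exists_nat_gt (2 / (1 - x))
  filter_upwards [eventually_ge_atTop (max N1 N2)] with n hn
  have a1 : 2 / x < n := h1.trans_le (by exact_mod_cast (le_max_left _ _).trans hn)
  have a2 : 2 / (1 - x) < n := h2.trans_le (by exact_mod_cast (le_max_right _ _).trans hn)
  rw [div_lt_iff₀ hx.1] at a1
  rw [div_lt_iff₀ (by linarith [hx.2])] at a2
  refine ⟨?_, ?_⟩
  · rw [cutX, Real.smoothTransition.one_of_one_le (by linarith),
      Real.smoothTransition.one_of_one_le (by linarith), mul_one]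
  · rw [cutX', deriv_smoothTransition_eq_zero (Or.inr (by linarith)),
      deriv_smoothTransition_eq_zero (Or.inr (by linarith))]
    simp

theorem eventually_cutY (y : ℝ) (hy : 0 < y) :
    ∀ᶠ n : ℕ in atTop, cutY n y = 1 ∧ cutY' n y = 0 := by
  obtain ⟨N, h1⟩ := exists_nat_gt y
  filter_upwards [eventually_ge_atTop N] with n hn
  have a1 : y < n := h1.trans_le (by exact_mod_cast hn)
  refine ⟨?_, ?_⟩
  · rw [cutY, Real.smoothTransition.one_of_one_le (by linarith),
      Real.smoothTransition.one_of_one_le (by linarith), mul_one]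
  · rw [cutY', deriv_smoothTransition_eq_zero (Or.inr (by linarith)), neg_zero]

end Transition

end Island

end

/-! ### Closing the duality gap on the half strip over the unit interval. -/

noncomputable section

namespace Island

theorem HasBottomTrace.integral_grad_mul_rotated {Ω : Set (ℝ × ℝ)} {I : Set ℝ} {u : ℝ × ℝ → ℝ}
    {g : ℝ × ℝ → ℝ × ℝ} {ψ : ℝ × ℝ → ℝ} (hΩ : IsOpen Ω) (hpos : ∀ p ∈ Ω, 0 < p.2)
    (h : HasBottomTrace Ω I u (fun x => x)) (hg : IsWeakGrad Ω u g)
    (hψ : ContDiff ℝ ∞ ψ) (hc : HasCompactSupport ψ) (hs : tsupport ψ ⊆ Ω ∪ I ×ˢ Iic 0) :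
    ∫ p in Ω, ((g p).2 * partialX ψ p - (g p).1 * partialY ψ p) = ∫ x, ψ (x, 0) := by
  obtain ⟨g', hg', hu, hgi, htr⟩ := h
  rw [← (Island.integral_grad_mul_rotated hΩ hpos hg' hu hgi htr hψ hc hs).2]
  refine integral_congr_ae ?_
  filter_upwards [hg.ae_eq hΩ hg'] with p hp
  rw [hp]

/-- The half strip over the unit interval. -/
abbrev unitStrip : Set (ℝ × ℝ) := Ioo (0 : ℝ) 1 ×ˢ Ioi (0 : ℝ)

/-- The partial sine series of the conjugate function of the optimal profile on the half strip. -/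
def conjProfile (N : ℕ) (p : ℝ × ℝ) : ℝ :=
  ∑ k ∈ Finset.range N, 4 / freq k ^ 2 * (Real.sin (freq k * p.1) * Real.exp (-(freq k * p.2)))

/-- The partial cosine series of the optimal profile, corrected to have the trace `x`. -/
def stripProfile (N : ℕ) (p : ℝ × ℝ) : ℝ :=
  1 / 2 - (∑ k ∈ Finset.range N,
      4 / freq k ^ 2 * (Real.cos (freq k * p.1) * Real.exp (-(freq k * p.2))))
    + cosineDefect N p.1 * Real.exp (-p.2)

variable {N : ℕ}

theorem contDiff_conjProfile : ContDiff ℝ ∞ (conjProfile N) := by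
  unfold conjProfile
  refine ContDiff.sum fun k _ => contDiff_const.mul ?_
  exact (Real.contDiff_sin.comp (contDiff_const.mul contDiff_fst)).mul
    (Real.contDiff_exp.comp (contDiff_const.mul contDiff_snd).neg)

theorem contDiff_stripProfile : ContDiff ℝ ∞ (stripProfile N) := by
  unfold stripProfile cosineDefect
  refine (contDiff_const.sub (ContDiff.sum fun k _ => contDiff_const.mul ?_)).add
    (((contDiff_fst.sub contDiff_const).add (ContDiff.sum fun k _ => contDiff_const.mul ?_)).mul ?_)
  · exact (Real.contDiff_cos.comp (contDiff_const.mul contDiff_fst)).mul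
      (Real.contDiff_exp.comp (contDiff_const.mul contDiff_snd).neg)
  · exact Real.contDiff_cos.comp (contDiff_const.mul contDiff_fst)
  · exact Real.contDiff_exp.comp contDiff_snd.neg

theorem stripProfile_zero (x : ℝ) : stripProfile N (x, 0) = x := by
  simp [stripProfile, cosineDefect]

/-- The sum `∑ (4/ω) cos(ωx) exp(-ωy)`. -/
def cosSum (N : ℕ) (p : ℝ × ℝ) : ℝ :=
  ∑ k ∈ Finset.range N, 4 / freq k * (Real.cos (freq k * p.1) * Real.exp (-(freq k * p.2)))

/-- The sum `∑ (4/ω) sin(ωx) exp(-ωy)`. -/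
def sinSum (N : ℕ) (p : ℝ × ℝ) : ℝ :=
  ∑ k ∈ Finset.range N, 4 / freq k * (Real.sin (freq k * p.1) * Real.exp (-(freq k * p.2)))

theorem hasDerivAt_sin_freq (k : ℕ) (x : ℝ) :
    HasDerivAt (fun x => Real.sin (freq k * x)) (freq k * Real.cos (freq k * x)) x := by
  simpa [mul_comm] using ((hasDerivAt_id x).const_mul (freq k)).sin

theorem hasDerivAt_cos_freq (k : ℕ) (x : ℝ) :
    HasDerivAt (fun x => Real.cos (freq k * x)) (-(freq k * Real.sin (freq k * x))) x := by
  simpa [mul_comm] using ((hasDerivAt_id x).const_mul (freq k)).cos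

theorem hasDerivAt_exp_freq (k : ℕ) (y : ℝ) :
    HasDerivAt (fun y => Real.exp (-(freq k * y))) (-(freq k * Real.exp (-(freq k * y)))) y := by
  simpa [mul_comm] using ((hasDerivAt_id y).const_mul (freq k)).neg.exp

theorem partialX_conjProfile (p : ℝ × ℝ) : partialX (conjProfile N) p = cosSum N p := by
  refine (hasDerivAt_partialX
    ((contDiff_conjProfile.differentiable (by simp)) p)).unique ?_
  unfold conjProfile cosSum
  dsimp only
  refine HasDerivAt.fun_sum fun k _ => ?_
  refine (((hasDerivAt_sin_freq k p.1).mul_const _).const_mul _).congr_deriv ?_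
  have := (freq_pos k).ne'
  field_simp

theorem partialY_conjProfile (p : ℝ × ℝ) : partialY (conjProfile N) p = -sinSum N p := by
  refine (hasDerivAt_partialY
    ((contDiff_conjProfile.differentiable (by simp)) p)).unique ?_
  unfold conjProfile sinSum
  dsimp only
  rw [← Finset.sum_neg_distrib]
  refine HasDerivAt.fun_sum fun k _ => ?_
  refine (((hasDerivAt_exp_freq k p.2).const_mul _).const_mul _).congr_deriv ?_
  have := (freq_pos k).ne'
  field_simp

theorem partialX_stripProfile (p : ℝ × ℝ) :
    partialX (stripProfile N) p = sinSum N p + sineDefect N p.1 * Real.exp (-p.2) := by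
  refine (hasDerivAt_partialX
    ((contDiff_stripProfile.differentiable (by simp)) p)).unique ?_
  unfold stripProfile sinSum
  dsimp only
  refine HasDerivAt.add ?_ ((hasDerivAt_cosineDefect N p.1).mul_const _)
  rw [← neg_neg (Finset.sum _ _), ← Finset.sum_neg_distrib]
  refine HasDerivAt.const_sub _ (HasDerivAt.fun_sum fun k _ => ?_)
  refine (((hasDerivAt_cos_freq k p.1).mul_const _).const_mul _).congr_deriv ?_
  have := (freq_pos k).ne'
  field_simp

theorem partialY_stripProfile (p : ℝ × ℝ) :
    partialY (stripProfile N) p = cosSum N p - cosineDefect N p.1 * Real.exp (-p.2) := by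
  refine (hasDerivAt_partialY
    ((contDiff_stripProfile.differentiable (by simp)) p)).unique ?_
  unfold stripProfile cosSum
  dsimp only
  have h0 : HasDerivAt (fun y => Real.exp (-y)) (-Real.exp (-p.2)) p.2 := by
    simpa using (hasDerivAt_id p.2).neg.exp
  rw [sub_eq_add_neg, ← mul_neg]
  refine HasDerivAt.add ?_ (h0.const_mul _)
  rw [← neg_neg (Finset.sum _ _), ← Finset.sum_neg_distrib]
  refine HasDerivAt.const_sub _ (HasDerivAt.fun_sum fun k _ => ?_)
  refine (((hasDerivAt_exp_freq k p.2).const_mul _).const_mul _).congr_deriv ?_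
  have := (freq_pos k).ne'
  field_simp

/-- A common bound for the sine and cosine sums at height zero. -/
def sumBound (N : ℕ) : ℝ := ∑ k ∈ Finset.range N, 4 / freq k

theorem sumBound_nonneg : 0 ≤ sumBound N :=
  Finset.sum_nonneg fun k _ => by have := freq_pos k; positivity

theorem exp_freq_le (k : ℕ) {y : ℝ} (hy : 0 < y) : Real.exp (-(freq k * y)) ≤ Real.exp (-y) := by
  have := one_le_freq k
  rw [Real.exp_le_exp]
  nlinarith

theorem abs_sum_mul_exp_le {c s : ℕ → ℝ} {y : ℝ} (hy : 0 < y) (hc : ∀ k, |s k| ≤ c k) :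
    |∑ k ∈ Finset.range N, s k * Real.exp (-(freq k * y))|
      ≤ (∑ k ∈ Finset.range N, c k) * Real.exp (-y) := by
  rw [Finset.sum_mul]
  refine (Finset.abs_sum_le_sum_abs _ _).trans (Finset.sum_le_sum fun k _ => ?_)
  rw [abs_mul, abs_of_pos (Real.exp_pos _)]
  exact mul_le_mul (hc k) (exp_freq_le k hy) (Real.exp_pos _).le ((abs_nonneg _).trans (hc k))

theorem abs_cosSum_le {p : ℝ × ℝ} (hp : 0 < p.2) :
    |cosSum N p| ≤ sumBound N * Real.exp (-p.2) := by
  have := abs_sum_mul_exp_le (N := N) (s := fun k => 4 / freq k * Real.cos (freq k * p.1))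
    (c := fun k => 4 / freq k) hp fun k => by
      have := freq_pos k
      rw [abs_mul, abs_of_pos (by positivity)]
      exact mul_le_of_le_one_right (by positivity) (Real.abs_cos_le_one _)
  simpa only [cosSum, sumBound, mul_assoc] using this

theorem abs_sinSum_le {p : ℝ × ℝ} (hp : 0 < p.2) :
    |sinSum N p| ≤ sumBound N * Real.exp (-p.2) := by
  have := abs_sum_mul_exp_le (N := N) (s := fun k => 4 / freq k * Real.sin (freq k * p.1))
    (c := fun k => 4 / freq k) hp fun k => by
      have := freq_pos k
      rw [abs_mul, abs_of_pos (by positivity)]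
      exact mul_le_of_le_one_right (by positivity) (Real.abs_sin_le_one _)
  simpa only [sinSum, sumBound, mul_assoc] using this

/-- The parameter `t` will be the distance to a lateral side. This linear decay pays for the
derivative of the horizontal cutoff. -/
theorem abs_conjProfile_le_of {p : ℝ × ℝ} (hp : 0 < p.2) {t : ℝ}
    (h : ∀ k, |Real.sin (freq k * p.1)| ≤ freq k * t) :
    |conjProfile N p| ≤ sumBound N * Real.exp (-p.2) * t := by
  have := abs_sum_mul_exp_le (N := N) (s := fun k => 4 / freq k ^ 2 * Real.sin (freq k * p.1))
    (c := fun k => 4 / freq k * t) hp fun k => by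
      have h0 := freq_pos k
      rw [abs_mul, abs_of_pos (by positivity)]
      calc _ ≤ 4 / freq k ^ 2 * (freq k * t) := by gcongr; exact h k
        _ = _ := by field_simp
  rw [← Finset.sum_mul] at this
  simp only [mul_assoc] at this
  rw [conjProfile, sumBound]
  linarith

theorem abs_conjProfile_le_left {p : ℝ × ℝ} (hp : p ∈ unitStrip) :
    |conjProfile N p| ≤ sumBound N * Real.exp (-p.2) * p.1 := by
  refine abs_conjProfile_le_of hp.2 fun k => ?_
  refine Real.abs_sin_le_abs.trans (le_of_eq ?_)
  rw [abs_of_pos (mul_pos (freq_pos k) hp.1.1)]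

theorem abs_conjProfile_le_right {p : ℝ × ℝ} (hp : p ∈ unitStrip) :
    |conjProfile N p| ≤ sumBound N * Real.exp (-p.2) * (1 - p.1) := by
  refine abs_conjProfile_le_of hp.2 fun k => ?_
  -- Odd multiples of `π` make every mode symmetric about `1/2`.
  have : Real.sin (freq k * p.1) = Real.sin (freq k * (1 - p.1)) := by
    have e : freq k * (1 - p.1) = Real.pi - freq k * p.1 + (k : ℤ) * (2 * Real.pi) := by
      unfold freq; push_cast; ring
    rw [e, Real.sin_add_int_mul_two_pi, Real.sin_pi_sub]
  rw [this]
  refine Real.abs_sin_le_abs.trans (le_of_eq ?_)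
  rw [abs_of_pos (mul_pos (freq_pos k) (by linarith [hp.1.2]))]

/-- The conjugate profile with cutoffs. -/
def cutProfile (N n : ℕ) (p : ℝ × ℝ) : ℝ := cutX n p.1 * cutY n p.2 * conjProfile N p

variable {n : ℕ}

theorem contDiff_cutProfile : ContDiff ℝ ∞ (cutProfile N n) :=
  (((contDiff_cutX n).comp contDiff_fst).mul ((contDiff_cutY n).comp contDiff_snd)).mul
    contDiff_conjProfile

theorem tsupport_cutProfile_subset (hn : 0 < n) :
    tsupport (cutProfile N n) ⊆ Icc (1 / n : ℝ) (1 - 1 / n) ×ˢ Icc (-2 : ℝ) (n + 1) := by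
  have hn' : (0 : ℝ) < n := by exact_mod_cast hn
  refine closure_minimal (fun p hp => ?_) (isClosed_Icc.prod isClosed_Icc)
  have h1 : Real.smoothTransition (n * p.1 - 1) ≠ 0 := fun h => hp (by simp [cutProfile, cutX, h])
  have h2 : Real.smoothTransition (n * (1 - p.1) - 1) ≠ 0 :=
    fun h => hp (by simp [cutProfile, cutX, h])
  have h3 : Real.smoothTransition (n + 1 - p.2) ≠ 0 := fun h => hp (by simp [cutProfile, cutY, h])
  have h4 : Real.smoothTransition (p.2 + 2) ≠ 0 := fun h => hp (by simp [cutProfile, cutY, h])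
  have key : ∀ {s}, Real.smoothTransition s ≠ 0 → 0 < s := fun h => by
    by_contra hs
    exact h (Real.smoothTransition.zero_of_nonpos (not_lt.1 hs))
  have k1 := key h1
  have k2 := key h2
  have k3 := key h3
  have k4 := key h4
  refine ⟨⟨?_, ?_⟩, ⟨by linarith, by linarith⟩⟩
  · rw [div_le_iff₀ hn']; linarith
  · have : 1 / (n : ℝ) ≤ 1 - p.1 := by rw [div_le_iff₀ hn']; linarith
    linarith

theorem hasCompactSupport_cutProfile (hn : 0 < n) : HasCompactSupport (cutProfile N n) :=
  (isCompact_Icc.prod isCompact_Icc).of_isClosed_subset (isClosed_tsupport _)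
    (tsupport_cutProfile_subset hn)

theorem tsupport_cutProfile_subset' (hn : 0 < n) :
    tsupport (cutProfile N n) ⊆ Ioo (0 : ℝ) 1 ×ˢ univ := by
  refine (tsupport_cutProfile_subset hn).trans fun p hp => ⟨⟨?_, ?_⟩, trivial⟩
  · exact lt_of_lt_of_le (by positivity) hp.1.1
  · exact lt_of_le_of_lt hp.1.2 (by simpa using hn)

theorem partialX_cutProfile (p : ℝ × ℝ) :
    partialX (cutProfile N n) p
      = cutY n p.2 * (cutX' n p.1 * conjProfile N p + cutX n p.1 * cosSum N p) := by
  refine (hasDerivAt_partialX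
    ((contDiff_cutProfile.differentiable (by simp)) p)).unique ?_
  have h1 := hasDerivAt_partialX (φ := conjProfile N)
    ((contDiff_conjProfile.differentiable (by simp)) p)
  rw [partialX_conjProfile] at h1
  refine (((hasDerivAt_cutX n p.1).mul_const (cutY n p.2)).mul h1).congr_deriv ?_
  ring

theorem partialY_cutProfile {p : ℝ × ℝ} (hp : 0 < p.2) :
    partialY (cutProfile N n) p
      = cutX n p.1 * (cutY' n p.2 * conjProfile N p - cutY n p.2 * sinSum N p) := by
  refine (hasDerivAt_partialY
    ((contDiff_cutProfile.differentiable (by simp)) p)).unique ?_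
  have h1 := hasDerivAt_partialY (φ := conjProfile N)
    ((contDiff_conjProfile.differentiable (by simp)) p)
  rw [partialY_conjProfile] at h1
  refine (((hasDerivAt_cutY n hp).const_mul (cutX n p.1)).mul h1).congr_deriv ?_
  ring

/-- The bound does not depend on `n`; its square is integrable over the half strip and dominates the
passage to the limit in the cutoffs. -/
theorem exists_bound_grad_cutProfile (N : ℕ) : ∃ K : ℝ, 0 ≤ K ∧ ∀ n : ℕ, ∀ p ∈ unitStrip,
    |partialX (cutProfile N n) p| ≤ K * Real.exp (-p.2) ∧
    |partialY (cutProfile N n) p| ≤ K * Real.exp (-p.2) := by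
  obtain ⟨C, hC0, hC⟩ := exists_abs_deriv_smoothTransition_le
  have hB := sumBound_nonneg (N := N)
  refine ⟨4 * C * sumBound N + C * sumBound N + sumBound N, by positivity, fun n p hp => ?_⟩
  have he := Real.exp_pos (-p.2)
  have l := abs_conjProfile_le_left (N := N) hp
  have r := abs_conjProfile_le_right (N := N) hp
  have hX := abs_cutX'_mul_le hC hC0 n (A := sumBound N * Real.exp (-p.2)) (by positivity) hp.1 l r
  have hc := abs_cosSum_le (N := N) (p := p) hp.2
  have hs := abs_sinSum_le (N := N) (p := p) hp.2
  have hCB : 0 ≤ C * (sumBound N * Real.exp (-p.2)) := by positivity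
  constructor
  · rw [partialX_cutProfile, abs_mul]
    refine (mul_le_of_le_one_left (abs_nonneg _) (abs_cutY_le n _)).trans ?_
    refine (abs_add_le _ _).trans ?_
    have : |cutX n p.1 * cosSum N p| ≤ sumBound N * Real.exp (-p.2) := by
      rw [abs_mul]
      exact (mul_le_of_le_one_left (abs_nonneg _) (abs_cutX_le n _)).trans hc
    linarith
  · rw [partialY_cutProfile hp.2, abs_mul]
    refine (mul_le_of_le_one_left (abs_nonneg _) (abs_cutX_le n _)).trans ?_
    refine (abs_sub _ _).trans ?_
    have h1 : |cutY n p.2 * sinSum N p| ≤ sumBound N * Real.exp (-p.2) := by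
      rw [abs_mul]
      exact (mul_le_of_le_one_left (abs_nonneg _) (abs_cutY_le n _)).trans hs
    have h2 : |cutY' n p.2 * conjProfile N p| ≤ C * (sumBound N * Real.exp (-p.2)) := by
      rw [abs_mul, cutY', abs_neg]
      refine mul_le_mul (hC _) (l.trans ?_) (abs_nonneg _) hC0.le
      exact mul_le_of_le_one_right (by positivity) hp.1.2.le
    linarith

theorem exists_bound_grad_stripProfile (N : ℕ) : ∃ K : ℝ, 0 ≤ K ∧ ∀ p ∈ unitStrip,
    |partialX (stripProfile N) p| ≤ K * Real.exp (-p.2) ∧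
    |partialY (stripProfile N) p| ≤ K * Real.exp (-p.2) := by
  have hc : Continuous (cosineDefect N) :=
    continuous_iff_continuousAt.2 fun x => (hasDerivAt_cosineDefect N x).continuousAt
  obtain ⟨A, hA⟩ := (isCompact_Icc (a := (0 : ℝ)) (b := 1)).exists_bound_of_continuousOn
    hc.continuousOn
  obtain ⟨B, hB⟩ := (isCompact_Icc (a := (0 : ℝ)) (b := 1)).exists_bound_of_continuousOn
    (continuous_sineDefect N).continuousOn
  have hA0 : 0 ≤ A := (norm_nonneg _).trans (hA 0 (by simp))
  have hB0 : 0 ≤ B := (norm_nonneg _).trans (hB 0 (by simp))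
  have hS := sumBound_nonneg (N := N)
  refine ⟨sumBound N + A + B, by positivity, fun p hp => ?_⟩
  have he := Real.exp_pos (-p.2)
  have a1 := mul_le_mul_of_nonneg_right (hA p.1 ⟨hp.1.1.le, hp.1.2.le⟩) he.le
  have a2 := mul_le_mul_of_nonneg_right (hB p.1 ⟨hp.1.1.le, hp.1.2.le⟩) he.le
  have a3 := mul_nonneg hA0 he.le
  have a4 := mul_nonneg hB0 he.le
  rw [Real.norm_eq_abs] at a1 a2
  constructor
  · rw [partialX_stripProfile]
    refine (abs_add_le _ _).trans ?_
    rw [abs_mul, abs_of_pos he]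
    linarith [abs_sinSum_le (N := N) (p := p) hp.2]
  · rw [partialY_stripProfile]
    refine (abs_sub _ _).trans ?_
    rw [abs_mul, abs_of_pos he]
    linarith [abs_cosSum_le (N := N) (p := p) hp.2]

theorem integrableOn_exp_unitStrip (K : ℝ) :
    IntegrableOn (fun p : ℝ × ℝ => K * Real.exp (-p.2) ^ 2) unitStrip := by
  have h1 : Integrable (fun _ : ℝ => K) (volume.restrict (Ioo (0 : ℝ) 1)) :=
    integrable_const _
  have h2 : Integrable (fun y : ℝ => Real.exp (-y) ^ 2) (volume.restrict (Ioi (0 : ℝ))) := by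
    have := integrableOn_exp_mul_Ioi (a := -2) (by norm_num) 0
    refine this.congr (Eventually.of_forall fun y => ?_)
    simp only
    rw [← Real.exp_nat_mul]
    congr 1
    push_cast
    ring
  have := h1.mul_prod h2
  rw [Measure.prod_restrict] at this
  exact this

theorem integral_exp_sq : ∫ y in Ioi (0 : ℝ), Real.exp (-y) ^ 2 = 1 / 2 := by
  have := integral_exp_mul_Ioi (a := -2) (by norm_num) 0
  have e : ∀ y : ℝ, Real.exp (-y) ^ 2 = Real.exp (-2 * y) := fun y => by
    rw [← Real.exp_nat_mul]
    congr 1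
    push_cast
    ring
  simp_rw [e]
  rw [this]
  norm_num

theorem isOpen_unitStrip : IsOpen unitStrip := isOpen_Ioo.prod isOpen_Ioi

/-- The squared distance of the gradient of the profile from the rotated gradient of the cut
conjugate profile. -/
def dualityGap (N n : ℕ) (p : ℝ × ℝ) : ℝ :=
  (partialX (stripProfile N) p + partialY (cutProfile N n) p) ^ 2
    + (partialY (stripProfile N) p - partialX (cutProfile N n) p) ^ 2

theorem continuous_dualityGap : Continuous (dualityGap N n) :=
  (((contDiff_partialX contDiff_stripProfile).continuous.add
    (contDiff_partialY contDiff_cutProfile).continuous).pow 2).add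
  (((contDiff_partialY contDiff_stripProfile).continuous.sub
    (contDiff_partialX contDiff_cutProfile).continuous).pow 2)

/-- Once the cutoffs are removed, the Cauchy–Riemann equations cancel the two harmonic sums. What
remains is the squared gradient of the trace correction `cosineDefect(x) exp(-y)`. -/
theorem tendsto_integral_dualityGap (N : ℕ) :
    Tendsto (fun n => ∫ p in unitStrip, dualityGap N n p) atTop
      (𝓝 (∫ p in unitStrip, (sineDefect N p.1 ^ 2 + cosineDefect N p.1 ^ 2) * Real.exp (-p.2) ^ 2)) := by
  obtain ⟨K, hK0, hK⟩ := exists_bound_grad_cutProfile N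
  obtain ⟨K', hK0', hK'⟩ := exists_bound_grad_stripProfile N
  refine tendsto_integral_of_dominated_convergence
    (fun p => 2 * (K + K') ^ 2 * Real.exp (-p.2) ^ 2)
    (fun n => continuous_dualityGap.aestronglyMeasurable) (integrableOn_exp_unitStrip _) ?_ ?_
  · intro n
    filter_upwards [ae_restrict_mem isOpen_unitStrip.measurableSet] with p hp
    obtain ⟨a1, a2⟩ := hK n p hp
    obtain ⟨b1, b2⟩ := hK' p hp
    have c1 : |partialX (stripProfile N) p + partialY (cutProfile N n) p|
        ≤ (K + K') * Real.exp (-p.2) := (abs_add_le _ _).trans (by linarith)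
    have c2 : |partialY (stripProfile N) p - partialX (cutProfile N n) p|
        ≤ (K + K') * Real.exp (-p.2) := (abs_sub _ _).trans (by linarith)
    have d1 := pow_le_pow_left₀ (abs_nonneg _) c1 2
    have d2 := pow_le_pow_left₀ (abs_nonneg _) c2 2
    rw [sq_abs, mul_pow] at d1 d2
    rw [Real.norm_eq_abs, dualityGap, abs_of_nonneg (by positivity)]
    linarith
  · filter_upwards [ae_restrict_mem isOpen_unitStrip.measurableSet] with p hp
    refine tendsto_const_nhds.congr' ?_
    filter_upwards [eventually_cutX p.1 hp.1, eventually_cutY p.2 hp.2] with n hx hy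
    rw [dualityGap, partialX_cutProfile, partialY_cutProfile hp.2, hx.1, hx.2, hy.1, hy.2,
      partialX_stripProfile, partialY_stripProfile]
    ring

theorem integral_limitGap (N : ℕ) :
    ∫ p in unitStrip, (sineDefect N p.1 ^ 2 + cosineDefect N p.1 ^ 2) * Real.exp (-p.2) ^ 2
      = (∫ x in (0 : ℝ)..1, (sineDefect N x ^ 2 + cosineDefect N x ^ 2)) / 2 := by
  have h := setIntegral_prod_mul (μ := (volume : Measure ℝ)) (ν := (volume : Measure ℝ))
    (fun x => sineDefect N x ^ 2 + cosineDefect N x ^ 2) (fun y => Real.exp (-y) ^ 2)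
    (Ioo (0 : ℝ) 1) (Ioi (0 : ℝ))
  rw [Measure.volume_eq_prod, h, integral_exp_sq, intervalIntegral.integral_of_le zero_le_one,
    integral_Ioc_eq_integral_Ioo]
  ring

/-- Expand the square in `dualityGap`: its mixed term is the pairing with the rotated gradient,
which equals `∫ ψ(x,0)`. -/
theorem energy_eq_dualValue_add_gap (hn : 0 < n) :
    IntegrableOn (fun p => partialX (stripProfile N) p ^ 2 + partialY (stripProfile N) p ^ 2)
      unitStrip ∧
    ∫ p in unitStrip, (partialX (stripProfile N) p ^ 2 + partialY (stripProfile N) p ^ 2)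
      = dualValue (cutProfile N n) + ∫ p in unitStrip, dualityGap N n p := by
  have hψ := contDiff_cutProfile (N := N) (n := n)
  have hU := contDiff_stripProfile (N := N)
  have hc := hasCompactSupport_cutProfile (N := N) hn
  have hpos : ∀ p ∈ unitStrip, 0 < p.2 := fun p hp => hp.2
  have hs : tsupport (cutProfile N n) ⊆ unitStrip ∪ Ioo (0 : ℝ) 1 ×ˢ Iic 0 := by
    refine (tsupport_cutProfile_subset' hn).trans fun p hp => ?_
    rcases le_or_gt p.2 0 with h | h
    · exact Or.inr ⟨hp.1, h⟩
    · exact Or.inl ⟨hp.1, h⟩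
  have hid := (hasBottomTrace_of_contDiff (I := Ioo (0 : ℝ) 1) isOpen_unitStrip hpos hU
    stripProfile_zero).integral_grad_mul_rotated isOpen_unitStrip hpos
    (isWeakGrad_of_contDiff hU) hψ hc hs
  have hsq := integrable_partial_sq hψ hc
  obtain ⟨K, hK0, hK⟩ := exists_bound_grad_stripProfile N
  have hiE : IntegrableOn
      (fun p => partialX (stripProfile N) p ^ 2 + partialY (stripProfile N) p ^ 2) unitStrip := by
    refine Integrable.mono' (integrableOn_exp_unitStrip (2 * K ^ 2))
      (((contDiff_partialX hU).continuous.pow 2).add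
        ((contDiff_partialY hU).continuous.pow 2)).aestronglyMeasurable ?_
    filter_upwards [ae_restrict_mem isOpen_unitStrip.measurableSet] with p hp
    obtain ⟨c1, c2⟩ := hK p hp
    have d1 := pow_le_pow_left₀ (abs_nonneg _) c1 2
    have d2 := pow_le_pow_left₀ (abs_nonneg _) c2 2
    rw [sq_abs, mul_pow] at d1 d2
    rw [Real.norm_eq_abs, abs_of_nonneg (by positivity)]
    linarith
  refine ⟨hiE, ?_⟩
  have hiC : IntegrableOn (fun p => (grad (stripProfile N) p).2 * partialX (cutProfile N n) p
      - (grad (stripProfile N) p).1 * partialY (cutProfile N n) p) unitStrip := by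
    refine (Integrable.sub ?_ ?_).integrableOn
    · exact ((contDiff_partialY hU).continuous.mul
        (contDiff_partialX hψ).continuous).integrable_of_hasCompactSupport hc.partialX.mul_left
    · exact ((contDiff_partialX hU).continuous.mul
        (contDiff_partialY hψ).continuous).integrable_of_hasCompactSupport hc.partialY.mul_left
  have e1 : ∫ p in univ ×ˢ Ioi (0 : ℝ),
      (partialX (cutProfile N n) p ^ 2 + partialY (cutProfile N n) p ^ 2)
      = ∫ p in unitStrip, (partialX (cutProfile N n) p ^ 2 + partialY (cutProfile N n) p ^ 2) := by
    refine setIntegral_eq_of_subset_of_forall_sdiff_eq_zero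
      (MeasurableSet.univ.prod measurableSet_Ioi) (fun p hp => ⟨trivial, hp.2⟩) fun p hp => ?_
    have : p ∉ tsupport (cutProfile N n) := fun h =>
      hp.2 ⟨(tsupport_cutProfile_subset' hn h).1, hp.1.2⟩
    simp [partialX_eq_zero this, partialY_eq_zero this]
  have e2 : ∀ p, dualityGap N n p
      = (partialX (stripProfile N) p ^ 2 + partialY (stripProfile N) p ^ 2)
        + (partialX (cutProfile N n) p ^ 2 + partialY (cutProfile N n) p ^ 2)
        - 2 * ((grad (stripProfile N) p).2 * partialX (cutProfile N n) p
      - (grad (stripProfile N) p).1 * partialY (cutProfile N n) p) := fun p => by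
    simp only [dualityGap, grad]
    ring
  simp_rw [e2]
  have hadd : IntegrableOn (fun p => (partialX (stripProfile N) p ^ 2
      + partialY (stripProfile N) p ^ 2)
      + (partialX (cutProfile N n) p ^ 2 + partialY (cutProfile N n) p ^ 2)) unitStrip :=
    hiE.add hsq.integrableOn
  rw [integral_sub hadd (hiC.const_mul 2), integral_add hiE hsq.integrableOn,
    integral_const_mul, hid, dualValue, e1]
  ring

/-- The primal and the dual problem on the half strip over the unit interval have the same value. -/
theorem exists_strip_duality {η : ℝ} (hη : 0 < η) :
    ∃ U ψ : ℝ × ℝ → ℝ, ContDiff ℝ ∞ U ∧ (∀ x, U (x, 0) = x) ∧ ContDiff ℝ ∞ ψ ∧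
      HasCompactSupport ψ ∧ tsupport ψ ⊆ Ioo (0 : ℝ) 1 ×ˢ univ ∧
      ∫⁻ p in unitStrip, ENNReal.ofReal (partialX U p ^ 2 + partialY U p ^ 2)
        ≤ ENNReal.ofReal (dualValue ψ + η) := by
  -- Both the sine defect and the squared cosine defect then integrate to at most `η/2`, and the
  -- vertical integral contributes another factor `1/2`. The number `n` of the cutoff is chosen
  -- after `N`.
  obtain ⟨N, hN⟩ := (tendsto_integral_sineDefect_sq.eventually
    (gt_mem_nhds (show (0 : ℝ) < η / 2 by positivity))).exists
  have hs : ∫ x in (0 : ℝ)..1, sineDefect N x ^ 2 ≤ Real.sqrt (η / 2) ^ 2 := by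
    rw [Real.sq_sqrt (by positivity)]
    exact hN.le
  have hcd : Continuous (cosineDefect N) :=
    continuous_iff_continuousAt.2 fun x => (hasDerivAt_cosineDefect N x).continuousAt
  have hr : ∫ x in (0 : ℝ)..1, cosineDefect N x ^ 2 ≤ ∫ _ in (0 : ℝ)..1, η / 2 := by
    refine intervalIntegral.integral_mono_on zero_le_one
      ((hcd.pow 2).intervalIntegrable _ _) (by simp) fun x hx => ?_
    have := pow_le_pow_left₀ (abs_nonneg _)
      (abs_cosineDefect_le N (Real.sqrt_pos.2 (by positivity)) hs hx) 2
    rwa [sq_abs, Real.sq_sqrt (by positivity)] at this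
  have hlim : ∫ p in unitStrip,
      (sineDefect N p.1 ^ 2 + cosineDefect N p.1 ^ 2) * Real.exp (-p.2) ^ 2 < η := by
    have hadd : ∫ x in (0 : ℝ)..1, (sineDefect N x ^ 2 + cosineDefect N x ^ 2)
        = (∫ x in (0 : ℝ)..1, sineDefect N x ^ 2) + ∫ x in (0 : ℝ)..1, cosineDefect N x ^ 2 :=
      intervalIntegral.integral_add
        (((continuous_sineDefect N).pow 2).intervalIntegrable _ _)
        ((hcd.pow 2).intervalIntegrable _ _)
    rw [integral_limitGap, hadd]
    have : ∫ _ in (0 : ℝ)..1, η / 2 = η / 2 := by simp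
    linarith
  obtain ⟨n, hn, hn0⟩ := (((tendsto_integral_dualityGap N).eventually (gt_mem_nhds hlim)).and
    (eventually_gt_atTop 0)).exists
  obtain ⟨hi, he⟩ := energy_eq_dualValue_add_gap (N := N) hn0
  refine ⟨stripProfile N, cutProfile N n, contDiff_stripProfile, stripProfile_zero,
    contDiff_cutProfile, hasCompactSupport_cutProfile hn0, tsupport_cutProfile_subset' hn0, ?_⟩
  rw [← ofReal_integral_eq_lintegral_ofReal hi (Eventually.of_forall fun p => by positivity), he]
  exact ENNReal.ofReal_le_ofReal (by linarith)

end Island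

end

/-! ### Lower bounds for the energy above an interval. -/

noncomputable section

namespace Island

/-- The measure `ν` on the line bounds the dual functional of the test functions that are supported
in boxes below the graph of `h`. -/
def DualBounded (ν : Measure ℝ) (h : ℝ → ℝ) : Prop :=
  ∀ a b T : ℝ, 0 < b → 0 < T → (∀ x ∈ Ioo a (a + b), T ≤ h x) →
    ∀ ψ : ℝ × ℝ → ℝ, ContDiff ℝ ∞ ψ → HasCompactSupport ψ → tsupport ψ ⊆ Ioo a (a + b) ×ˢ Iio T →
      ENNReal.ofReal (dualValue ψ) ≤ ν (Ioo a (a + b))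

/-- `ν` is the projection of the energy density to the horizontal axis. It is chosen before `h`, so
for a half strip, which contains profiles of every height, one measure serves all vertical
stretches. -/
theorem HasBottomTrace.exists_dualBounded {Ω : Set (ℝ × ℝ)} {I : Set ℝ} {u : ℝ × ℝ → ℝ}
    (hΩ : IsOpen Ω) (hpos : ∀ p ∈ Ω, 0 < p.2) (htr : HasBottomTrace Ω I u (fun x => x)) :
    ∃ ν : Measure ℝ, ν univ = dirichletEnergy Ω u ∧ ∀ h : ℝ → ℝ, (∀ x, 0 < h x → x ∈ I) →
      (∀ p : ℝ × ℝ, 0 < p.2 → p.2 < h p.1 → p ∈ Ω) → DualBounded ν h := by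
  obtain ⟨g, hg, -⟩ := id htr
  refine ⟨((volume.restrict Ω).withDensity
    fun p => ENNReal.ofReal ((g p).1 ^ 2 + (g p).2 ^ 2)).map Prod.fst, ?_, ?_⟩
  · rw [Measure.map_apply measurable_fst MeasurableSet.univ, preimage_univ,
      withDensity_apply _ MeasurableSet.univ, Measure.restrict_univ, hg.dirichletEnergy_eq hΩ]
  · intro h hI hΩh a b T hb hT hle ψ hψ hc hs
    have hm : MeasurableSet (Prod.fst ⁻¹' Ioo a (a + b) : Set (ℝ × ℝ)) :=
      measurable_fst measurableSet_Ioo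
    rw [Measure.map_apply measurable_fst measurableSet_Ioo, withDensity_apply _ hm,
      Measure.restrict_restrict hm]
    refine htr.dualValue_le hΩ hpos hg hψ hc (hs.trans fun p hp => ?_) hm
      fun p hp => Or.inl (hs hp).1
    rcases le_or_gt p.2 0 with h0 | h0
    · exact Or.inr ⟨hI _ (hT.trans_le (hle _ hp.1)), h0⟩
    · exact Or.inl (hΩh p h0 (lt_of_lt_of_le hp.2 (hle _ hp.1)))

theorem isOpen_subgraph {h : ℝ → ℝ} (hl : LowerSemicontinuous h) : IsOpen (subgraph h) := by
  have h1 : IsOpen {p : ℝ × ℝ | 0 < p.2} := isOpen_lt continuous_const continuous_snd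
  have h2 : IsOpen {p : ℝ × ℝ | p.2 < h p.1} := by
    rw [isOpen_iff_mem_nhds]
    intro p hp
    obtain ⟨c, hc1, hc2⟩ := exists_between (show p.2 < h p.1 from hp)
    have e1 : ∀ᶠ q : ℝ × ℝ in 𝓝 p, q.2 < c := continuous_snd.continuousAt.eventually_lt_const hc1
    have e2 : ∀ᶠ q : ℝ × ℝ in 𝓝 p, c < h q.1 :=
      continuous_fst.continuousAt.eventually (hl p.1 c hc2)
    filter_upwards [e1, e2] with q hq1 hq2 using hq1.trans hq2
  exact h1.inter h2

theorem isOpen_positivity {h : ℝ → ℝ} (hl : LowerSemicontinuous h) : IsOpen {x | 0 < h x} :=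
  lowerSemicontinuous_iff_isOpen_preimage.1 hl 0

theorem IsAdmissible.exists_dualBounded {V : ℝ} {u : ℝ × ℝ → ℝ} {h : ℝ → ℝ}
    (ha : IsAdmissible V u h) :
    ∃ ν : Measure ℝ, ν univ = dirichletEnergy (subgraph h) u ∧ DualBounded ν h := by
  obtain ⟨ν, hν, hd⟩ := ha.trace.exists_dualBounded (isOpen_subgraph ha.profile.lsc) fun _ hp => hp.1
  exact ⟨ν, hν, hd h (fun _ hx => hx) fun _ h1 h2 => ⟨h1, h2⟩⟩

theorem exists_dualBounded_strip {u : ℝ × ℝ → ℝ} {I : Set ℝ} (hI : IsOpen I)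
    (htr : HasBottomTrace (I ×ˢ Ioi 0) I u (fun x => x)) :
    ∃ ν : Measure ℝ, ν univ = dirichletEnergy (I ×ˢ Ioi 0) u ∧
      ∀ h : ℝ → ℝ, (∀ x, 0 < h x → x ∈ I) → DualBounded ν h := by
  obtain ⟨ν, hν, hd⟩ := htr.exists_dualBounded (hI.prod isOpen_Ioi) fun _ hp => hp.2
  exact ⟨ν, hν, fun h hh => hd h hh fun p h1 h2 => ⟨hh _ (h1.trans h2), h1⟩⟩

theorem exists_testFunction : ∃ ψ : ℝ × ℝ → ℝ, ContDiff ℝ ∞ ψ ∧ HasCompactSupport ψ ∧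
    tsupport ψ ⊆ Ioo (0 : ℝ) 1 ×ˢ Iio 1 ∧ 0 < ∫ x, ψ (x, 0) := by
  let f : ContDiffBump ((1 / 2, 0) : ℝ × ℝ) := ⟨1 / 8, 1 / 4, by norm_num, by norm_num⟩
  refine ⟨f, f.contDiff, f.hasCompactSupport, ?_, ?_⟩
  · rw [f.tsupport_eq]
    intro p hp
    rw [Metric.mem_closedBall, Prod.dist_eq, max_le_iff, Real.dist_eq, Real.dist_eq, abs_le,
      abs_le] at hp
    have e : f.rOut = 1 / 4 := rfl
    rw [e] at hp
    obtain ⟨⟨h1, h2⟩, h3, h4⟩ := hp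
    simp only at h1 h2 h3 h4
    exact ⟨⟨by linarith, by linarith⟩, by rw [mem_Iio]; linarith⟩
  · have hc : Continuous fun x : ℝ => f (x, 0) :=
      f.continuous.comp (continuous_id.prodMk continuous_const)
    refine hc.integral_pos_of_hasCompactSupport_nonneg_nonzero (x := 1 / 2)
      (hasCompactSupport_slice f.hasCompactSupport 0) (fun x => f.nonneg) ?_
    rw [f.one_of_mem_closedBall (Metric.mem_closedBall_self f.rIn_pos.le)]
    exact one_ne_zero

theorem tsupport_dilate_subset_box {A a b t s : ℝ} {f : ℝ × ℝ → ℝ} (hb : 0 < b) (ht : 0 < t)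
    (h : tsupport f ⊆ Ioo (0 : ℝ) 1 ×ˢ Iio s) :
    tsupport (dilate A a b t f) ⊆ Ioo a (a + b) ×ˢ Iio (s * t) := by
  refine (tsupport_dilate_subset hb.ne' ht.ne').trans fun p hp => ?_
  have := h hp
  rw [dilation_apply] at this
  obtain ⟨⟨h1, h2⟩, h3⟩ := this
  simp only at h1 h2 h3
  rw [div_lt_one hb] at h2
  have h1' := (div_pos_iff_of_pos_right hb).1 h1
  rw [mem_Iio, div_lt_iff₀ ht] at h3
  exact ⟨⟨by linarith, by linarith⟩, h3⟩

/-- A fixed bump is dilated to width `b` and height `t = min b T` and given the amplitude `A = λ t`.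
The linear term is `2 λ m b t`, the quadratic one at most `λ² (X + Y) b t`; with `λ = m / (X + Y +
1)` the difference is at least `m² / (X + Y + 1) · b t`. -/
theorem exists_coarse_cell_bound : ∃ c : ℝ, 0 < c ∧ ∀ (ν : Measure ℝ) (h : ℝ → ℝ),
    DualBounded ν h → ∀ a b T : ℝ, 0 < b → 0 < T → (∀ x ∈ Ioo a (a + b), T ≤ h x) →
      ENNReal.ofReal (c * (b * min b T)) ≤ ν (Ioo a (a + b)) := by
  obtain ⟨ψ, hψ, hc, hs, hm⟩ := exists_testFunction
  set m := ∫ x, ψ (x, 0)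
  have hX : 0 ≤ ∫ p in univ ×ˢ Ioi (0 : ℝ), partialX ψ p ^ 2 :=
    integral_nonneg fun p => sq_nonneg _
  have hY : 0 ≤ ∫ p in univ ×ˢ Ioi (0 : ℝ), partialY ψ p ^ 2 :=
    integral_nonneg fun p => sq_nonneg _
  set X := ∫ p in univ ×ˢ Ioi (0 : ℝ), partialX ψ p ^ 2
  set Y := ∫ p in univ ×ˢ Ioi (0 : ℝ), partialY ψ p ^ 2
  have hK : 0 < X + Y + 1 := by positivity
  refine ⟨m ^ 2 / (X + Y + 1), by positivity, fun ν h hν a b T hb hT hle => ?_⟩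
  set t := min b T
  have ht : 0 < t := lt_min hb hT
  have htb : t ≤ b := min_le_left _ _
  have htT : t ≤ T := min_le_right _ _
  have hsup : tsupport (dilate (m / (X + Y + 1) * t) a b t ψ) ⊆ Ioo a (a + b) ×ˢ Iio T := by
    refine (tsupport_dilate_subset_box hb ht hs).trans (prod_mono le_rfl ?_)
    exact Iio_subset_Iio (by linarith)
  refine le_trans (ENNReal.ofReal_le_ofReal ?_)
    (hν a b T hb hT hle _ (contDiff_dilate hψ) (hasCompactSupport_dilate hb.ne' ht.ne' hc) hsup)
  rw [dualValue_dilate hb ht hψ hc]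
  change _ ≤ 2 * (m / (X + Y + 1) * t) * b * m
    - (m / (X + Y + 1) * t) ^ 2 * (t / b * X + b / t * Y)
  have h1 : t ^ 2 * (t / b * X + b / t * Y) ≤ b * t * (X + Y) := by
    have e1 : t ^ 2 * (t / b * X) ≤ b * t * X := by
      have : t ^ 2 * (t / b) ≤ b * t := by
        rw [mul_div_assoc', div_le_iff₀ hb]
        nlinarith [mul_le_mul htb htb ht.le hb.le]
      nlinarith
    have e2 : t ^ 2 * (b / t * Y) = b * t * Y := by field_simp
    linarith
  have h2 : (m / (X + Y + 1) * t) ^ 2 * (t / b * X + b / t * Y)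
      ≤ (m / (X + Y + 1)) ^ 2 * (b * t * (X + Y + 1)) := by
    rw [mul_pow, mul_assoc]
    refine mul_le_mul_of_nonneg_left (h1.trans ?_) (sq_nonneg _)
    have : 0 < b * t := by positivity
    linarith
  have h3 : (m / (X + Y + 1)) ^ 2 * (b * t * (X + Y + 1)) = m ^ 2 / (X + Y + 1) * (b * t) := by
    field_simp
  have h4 : 2 * (m / (X + Y + 1) * t) * b * m = 2 * (m ^ 2 / (X + Y + 1) * (b * t)) := by
    field_simp
  linarith

theorem stripEnergy_le_of_contDiff {U : ℝ × ℝ → ℝ} (hU : ContDiff ℝ ∞ U) (hU0 : ∀ x, U (x, 0) = x)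
    {I : Set ℝ} (hI : IsOpen I) :
    stripEnergy I ≤ ∫⁻ p in I ×ˢ Ioi 0, ENNReal.ofReal (partialX U p ^ 2 + partialY U p ^ 2) := by
  have hΩ : IsOpen (I ×ˢ Ioi (0 : ℝ)) := hI.prod isOpen_Ioi
  rw [← dirichletEnergy_of_contDiff hΩ hU]
  exact iInf₂_le U (hasBottomTrace_of_contDiff hΩ (fun p hp => hp.2) hU hU0)

theorem stripEnergy_unit_ne_top : stripEnergy (Ioo 0 1) ≠ ⊤ := by
  obtain ⟨U, ψ, hU, hU0, -, -, -, hle⟩ := exists_strip_duality one_pos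
  exact ne_top_of_le_ne_top ENNReal.ofReal_ne_top
    ((stripEnergy_le_of_contDiff hU hU0 isOpen_Ioo).trans hle)

theorem dualValue_le_stripEnergy {ψ : ℝ × ℝ → ℝ} (hψ : ContDiff ℝ ∞ ψ) (hc : HasCompactSupport ψ)
    (hs : tsupport ψ ⊆ Ioo (0 : ℝ) 1 ×ˢ univ) :
    ENNReal.ofReal (dualValue ψ) ≤ stripEnergy (Ioo 0 1) := by
  refine le_iInf₂ fun u hu => ?_
  obtain ⟨g, hg, -⟩ := id hu
  rw [hg.dirichletEnergy_eq isOpen_unitStrip]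
  have := hu.dualValue_le isOpen_unitStrip (fun p hp => hp.2) hg hψ hc
    (hs.trans fun p hp => ?_) (B := univ) MeasurableSet.univ (fun p _ => Or.inl trivial)
  · rwa [univ_inter] at this
  · rcases le_or_gt p.2 0 with h0 | h0
    · exact Or.inr ⟨hp.1, h0⟩
    · exact Or.inl ⟨hp.1, h0⟩

theorem ofReal_CW : ENNReal.ofReal CW = stripEnergy (Ioo 0 1) :=
  ENNReal.ofReal_toReal stripEnergy_unit_ne_top

theorem CW_nonneg : 0 ≤ CW := ENNReal.toReal_nonneg

theorem CW_pos : 0 < CW := by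
  obtain ⟨c, hc, h⟩ := exists_coarse_cell_bound
  have : ENNReal.ofReal c ≤ stripEnergy (Ioo 0 1) := by
    refine le_iInf₂ fun u hu => ?_
    obtain ⟨ν, hν, hd⟩ := exists_dualBounded_strip isOpen_Ioo hu
    have := h ν ((Ioo (0 : ℝ) 1).indicator fun _ => 1) (hd _ fun x hx => ?_) 0 1 1 one_pos one_pos
      fun x hx => ?_
    · rw [← hν]
      simp only [min_self, mul_one] at this
      exact this.trans (measure_mono (subset_univ _))
    · by_contra hn
      simp [hn] at hx
    · rw [zero_add] at hx
      simp [hx]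
  rw [← ofReal_CW] at this
  by_contra hn
  rw [ENNReal.ofReal_of_nonpos (not_lt.1 hn), nonpos_iff_eq_zero, ENNReal.ofReal_eq_zero] at this
  linarith

/-- A near-optimal dual function for the unit half strip has compact support, so its copy dilated by
`b` fits below every level that is large compared with `b`. With amplitude `b` its dual value is
multiplied by `b²`. -/
theorem exists_fine_cell_bound {η : ℝ} (hη : 0 < η) : ∃ S : ℝ, ∀ (ν : Measure ℝ) (h : ℝ → ℝ),
    DualBounded ν h → ∀ a b T : ℝ, 0 < b → 0 < T → (∀ x ∈ Ioo a (a + b), T ≤ h x) → S * b ≤ T →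
      ENNReal.ofReal ((CW - η) * b ^ 2) ≤ ν (Ioo a (a + b)) := by
  obtain ⟨U, ψ, hU, hU0, hψ, hc, hs, hle⟩ := exists_strip_duality hη
  obtain ⟨S, hS⟩ := ((hc.image continuous_snd).bddAbove)
  -- The additional one keeps the support strictly below the top of the box.
  refine ⟨S + 1, fun ν h hν a b T hb hT hle' hST => ?_⟩
  have hs' : tsupport ψ ⊆ Ioo (0 : ℝ) 1 ×ˢ Iio (S + 1) := fun p hp =>
    ⟨(hs hp).1, lt_of_le_of_lt (hS ⟨p, hp, rfl⟩) (by linarith)⟩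
  have hsup : tsupport (dilate b a b b ψ) ⊆ Ioo a (a + b) ×ˢ Iio T :=
    (tsupport_dilate_subset_box hb hb hs').trans
      (prod_mono le_rfl (Iio_subset_Iio hST))
  have hdual := hν a b T hb hT hle' _ (contDiff_dilate hψ)
    (hasCompactSupport_dilate hb.ne' hb.ne' hc) hsup
  have hdv : dualValue (dilate b a b b ψ) = dualValue ψ * b ^ 2 := by
    have e : dilate 1 0 1 1 ψ = ψ := by ext p; simp [dilate]
    have e1 := dualValue_dilate (A := 1) (a := 0) one_pos one_pos hψ hc
    rw [e] at e1
    rw [dualValue_dilate hb hb hψ hc, e1, div_self hb.ne']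
    ring
  rw [hdv] at hdual
  refine le_trans (ENNReal.ofReal_le_ofReal_iff'.2 ?_) hdual
  have h1 := (stripEnergy_le_of_contDiff hU hU0 isOpen_Ioo).trans hle
  rw [← ofReal_CW, ENNReal.ofReal_le_ofReal_iff'] at h1
  rcases h1 with h1 | h1
  · left
    exact mul_le_mul_of_nonneg_right (by linarith) (sq_nonneg _)
  · right
    exact mul_nonpos_of_nonpos_of_nonneg (by linarith) (sq_nonneg _)

/-- Dilating arguments and values by the same factor `B` leaves the gradient unchanged and
multiplies areas by `B²`. Near optimality on the unit strip follows from `dualValue ≤ C_W`. -/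
theorem exists_competitor {η B : ℝ} (hη : 0 < η) (hB : 0 < B) :
    ∃ U : ℝ × ℝ → ℝ, ContDiff ℝ ∞ U ∧ (∀ x, U (x, 0) = x) ∧
      ∫⁻ p in Ioo 0 B ×ˢ Ioi 0, ENNReal.ofReal (partialX U p ^ 2 + partialY U p ^ 2)
        ≤ ENNReal.ofReal (B ^ 2 * (CW + η)) := by
  obtain ⟨U, ψ, hU, hU0, hψ, hc, hs, hle⟩ := exists_strip_duality hη
  have hdv := dualValue_le_stripEnergy hψ hc hs
  rw [← ofReal_CW, ENNReal.ofReal_le_ofReal_iff CW_nonneg] at hdv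
  refine ⟨dilate B 0 B B U, contDiff_dilate hU, fun x => ?_, ?_⟩
  · simp only [dilate, hU0, sub_zero, zero_div]
    field_simp
  · have hpre : dilation 0 hB.ne' hB.ne' ⁻¹' unitStrip = Ioo 0 B ×ˢ Ioi 0 := by
      ext p
      simp [dilation_apply, div_pos_iff_of_pos_right hB, div_lt_one hB]
    have h1 := setLIntegral_dilation 0 hB hB
      (fun p => ENNReal.ofReal (partialX U p ^ 2 + partialY U p ^ 2)) unitStrip
    rw [hpre] at h1
    have e : ∀ p, ENNReal.ofReal (partialX (dilate B 0 B B U) p ^ 2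
        + partialY (dilate B 0 B B U) p ^ 2)
        = ENNReal.ofReal (partialX U (dilation 0 hB.ne' hB.ne' p) ^ 2
          + partialY U (dilation 0 hB.ne' hB.ne' p) ^ 2) := fun p => by
      rw [partialX_dilate hU, partialY_dilate hU, dilation_apply, div_self hB.ne', one_mul, one_mul]
    simp_rw [e]
    rw [h1, pow_two, ENNReal.ofReal_mul (by positivity : 0 ≤ B * B)]
    gcongr
    exact hle.trans (ENNReal.ofReal_le_ofReal (by linarith))

/-- Lower bounds for a measure on intervals over which the profile `k`, stretched by `L`, stays above
a level. -/
structure CellBound (c C : ℝ) (S : ℝ → ℝ) (k : ℝ → ℝ) (L : ℝ) (μ : Measure ℝ) : Prop where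
  coarse : ∀ a b T : ℝ, 0 < b → 0 < T → (∀ x ∈ Ioo a (a + b), T ≤ L * k x) →
    ENNReal.ofReal (c * (b * min b T)) ≤ μ (Ioo a (a + b))
  fine : ∀ η a b T : ℝ, 0 < η → 0 < b → 0 < T → (∀ x ∈ Ioo a (a + b), T ≤ L * k x) →
    S η * b ≤ T → ENNReal.ofReal ((C - η) * b ^ 2) ≤ μ (Ioo a (a + b))

theorem exists_cellConstants : ∃ (c : ℝ) (S : ℝ → ℝ), 0 < c ∧
    ∀ (ν : Measure ℝ) (k : ℝ → ℝ) (L : ℝ), DualBounded ν (fun x => L * k x) →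
      CellBound c CW S k L ν := by
  obtain ⟨c, hc, h1⟩ := exists_coarse_cell_bound
  choose S hS using fun η : {η : ℝ // 0 < η} => exists_fine_cell_bound η.2
  -- The value `0` for `η ≤ 0` is never used, since the fine bound assumes `0 < η`.
  refine ⟨c, fun η => if hη : 0 < η then S ⟨η, hη⟩ else 0, hc, fun ν k L hν => ⟨?_, ?_⟩⟩
  · exact fun a b T hb hT hle => h1 ν _ hν a b T hb hT hle
  · intro η a b T hη hb hT hle hST
    simp only [hη, dif_pos] at hST
    exact hS ⟨η, hη⟩ ν _ hν a b T hb hT hle hST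

/-- Rescaling of the cell bounds to unit volume. -/
theorem CellBound.rescale {c C : ℝ} {S : ℝ → ℝ} {h : ℝ → ℝ} {ν : Measure ℝ} {V : ℝ} (hV : 0 < V)
    (hν : CellBound c C S h 1 ν) :
    ∃ μ : Measure ℝ, μ univ = ENNReal.ofReal (V ^ (-(2 / 3) : ℝ)) * ν univ ∧
      CellBound c C S (Island.rescale V h) (V ^ (1 / 3 : ℝ)) μ := by
  -- Lengths scale by `r` and heights by `r²`, so `h(r x) = r · (r k(x))`: in units of length `r`
  -- the film has the profile `r k`. Both cell bounds are homogeneous of degree two in `(b, T)`,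
  -- which cancels the prefactor `r⁻²`.
  set r := V ^ (1 / 3 : ℝ) with hr
  have hr0 : 0 < r := Real.rpow_pos_of_pos hV _
  have hV2 : V ^ (-(2 / 3) : ℝ) = (r ^ 2)⁻¹ := by
    rw [hr, ← Real.rpow_natCast, ← Real.rpow_mul hV.le, Real.rpow_neg hV.le]
    norm_num
  refine ⟨ENNReal.ofReal (V ^ (-(2 / 3) : ℝ)) • ν.map (fun x => r⁻¹ * x), ?_, ?_⟩
  · rw [Measure.smul_apply, Measure.map_apply (by fun_prop) MeasurableSet.univ, preimage_univ,
      smul_eq_mul]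
  have hIoo : ∀ a b : ℝ, (ENNReal.ofReal (V ^ (-(2 / 3) : ℝ)) • ν.map (fun x => r⁻¹ * x))
      (Ioo a (a + b)) = ENNReal.ofReal (r ^ 2)⁻¹ * ν (Ioo (r * a) (r * a + r * b)) := by
    intro a b
    rw [Measure.smul_apply, Measure.map_apply (by fun_prop) measurableSet_Ioo, smul_eq_mul, hV2]
    congr 2
    ext x
    simp only [mem_preimage, mem_Ioo, inv_mul_eq_div]
    rw [lt_div_iff₀ hr0, div_lt_iff₀ hr0, mul_comm a r, mul_comm (a + b) r, mul_add]
  have hlev : ∀ a b T : ℝ, (∀ x ∈ Ioo a (a + b), T ≤ r * Island.rescale V h x) →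
      ∀ x ∈ Ioo (r * a) (r * a + r * b), r * T ≤ 1 * h x := by
    intro a b T hle x hx
    have hx' : x / r ∈ Ioo a (a + b) := by
      rw [mem_Ioo, lt_div_iff₀ hr0, div_lt_iff₀ hr0]
      exact ⟨by linarith [hx.1], by linarith [hx.2]⟩
    have := hle _ hx'
    rw [Island.rescale, hV2, ← hr, mul_div_cancel₀ x hr0.ne'] at this
    rw [one_mul]
    calc r * T ≤ r * (r * ((r ^ 2)⁻¹ * h x)) := by gcongr
      _ = h x := by field_simp
  constructor
  · intro a b T hb hT hle
    have := hν.coarse (r * a) (r * b) (r * T) (by positivity) (by positivity) (hlev a b T hle)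
    rw [hIoo]
    refine le_trans (le_of_eq ?_) (mul_le_mul_right this _)
    rw [← ENNReal.ofReal_mul (by positivity), ← mul_min_of_nonneg _ _ hr0.le]
    congr 1
    field_simp
  · intro η a b T hη hb hT hle hS
    have := hν.fine η (r * a) (r * b) (r * T) hη (by positivity) (by positivity) (hlev a b T hle)
      (by nlinarith)
    rw [hIoo]
    refine le_trans (le_of_eq ?_) (mul_le_mul_right this _)
    rw [← ENNReal.ofReal_mul (by positivity)]
    congr 1
    field_simp

end Island

end

noncomputable section

namespace Island

/-! ### Variation over disjoint intervals and heights of profiles. -/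

section Variation

variable {f : ℝ → ℝ}

/-- Induction on the interval with the largest left end point: all others end before it begins,
which is why the claim is formulated on half lines `Iic c`. -/
theorem sum_eVariationOn_Icc_le_Iic {ι : Type*} (f : ℝ → ℝ) (a b : ι → ℝ) (s : Finset ι) :
    (∀ i ∈ s, a i < b i) → (∀ i ∈ s, ∀ j ∈ s, i ≠ j → b i ≤ a j ∨ b j ≤ a i) →
    ∀ c : ℝ, (∀ i ∈ s, b i ≤ c) →
      ∑ i ∈ s, eVariationOn f (Icc (a i) (b i)) ≤ eVariationOn f (Iic c) := by
  classical
  induction s using Finset.induction_on_max_value a with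
  | empty => intro _ _ c _; simp
  | insert i s hi hmax ih =>
    intro hab hd c hc
    have hbi : b i ≤ c := hc i (Finset.mem_insert_self _ _)
    have hai : a i < b i := hab i (Finset.mem_insert_self _ _)
    have h1 := ih (fun j hj => hab j (Finset.mem_insert_of_mem hj))
      (fun j hj l hl => hd j (Finset.mem_insert_of_mem hj) l (Finset.mem_insert_of_mem hl))
      (a i) fun j hj => by
        have hji : j ≠ i := fun h => hi (h ▸ hj)
        rcases hd j (Finset.mem_insert_of_mem hj) i (Finset.mem_insert_self _ _) hji with h | h
        · exact h
        · exact absurd (hai.trans_le h) (not_lt.2 (hmax j hj))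
    rw [Finset.sum_insert hi, add_comm]
    calc _ ≤ eVariationOn f (Iic (a i)) + eVariationOn f (Icc (a i) (b i)) := by gcongr
      _ ≤ eVariationOn f (Iic (a i) ∪ Icc (a i) (b i)) :=
        eVariationOn.add_le_union f fun x hx y hy => le_trans hx hy.1
      _ ≤ eVariationOn f (Iic c) := eVariationOn.mono f (union_subset
        (Iic_subset_Iic.2 (hai.le.trans hbi)) fun x hx => hx.2.trans hbi)

theorem sum_eVariationOn_Icc_le {ι : Type*} (f : ℝ → ℝ) {a b : ι → ℝ} {s : Finset ι}
    (hab : ∀ i ∈ s, a i < b i) (hd : ∀ i ∈ s, ∀ j ∈ s, i ≠ j → b i ≤ a j ∨ b j ≤ a i) :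
    ∑ i ∈ s, eVariationOn f (Icc (a i) (b i)) ≤ eVariationOn f univ := by
  classical
  obtain ⟨c, hc⟩ := (s.image b).bddAbove
  exact (sum_eVariationOn_Icc_le_Iic f a b s hab hd c
    fun i hi => hc (Finset.mem_coe.2 (Finset.mem_image_of_mem b hi))).trans
    (eVariationOn.mono f (subset_univ _))

theorem sub_le_variation {s : Set ℝ} (h : eVariationOn f s ≠ ⊤) {x y : ℝ} (hx : x ∈ s) (hy : y ∈ s) :
    f x - f y ≤ (eVariationOn f s).toReal := BoundedVariationOn.sub_le h hx hy

theorem peak_le_variation {a b x : ℝ} (h : eVariationOn f (Icc a b) ≠ ⊤) (hx : x ∈ Icc a b) :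
    (f x - f a) + (f x - f b) ≤ (eVariationOn f (Icc a b)).toReal := by
  have e : eVariationOn f (Icc a x) + eVariationOn f (Icc x b) = eVariationOn f (Icc a b) := by
    simpa using eVariationOn.Icc_add_Icc f (s := univ) hx.1 hx.2 trivial
  have n1 : eVariationOn f (Icc a x) ≠ ⊤ := ne_top_of_le_ne_top h (e ▸ le_self_add)
  have n2 : eVariationOn f (Icc x b) ≠ ⊤ := ne_top_of_le_ne_top h (e ▸ le_add_self)
  rw [← e, ENNReal.toReal_add n1 n2]
  exact add_le_add (sub_le_variation n1 (right_mem_Icc.2 hx.1) (left_mem_Icc.2 hx.1))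
    (sub_le_variation n2 (left_mem_Icc.2 hx.2) (right_mem_Icc.2 hx.2))

end Variation

variable {V : ℝ} {k : ℝ → ℝ}

theorem IsProfile.measurable (hk : IsProfile V k) : Measurable k := hk.lsc.measurable

theorem IsProfile.exists_lt_le (hk : IsProfile V k) (x : ℝ) {ρ : ℝ} (hρ : 0 < ρ) :
    ∃ y < x, k y ≤ ρ := by
  by_contra! h
  have h1 := hk.integrable.measure_ge_lt_top hρ
  have h2 : volume (Iio x) ≤ volume {y | ρ ≤ k y} := measure_mono fun y hy => (h y hy).le
  rw [Real.volume_Iio] at h2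
  exact absurd (h2.trans_lt h1) (lt_irrefl _)

theorem IsProfile.exists_gt_le (hk : IsProfile V k) (x : ℝ) {ρ : ℝ} (hρ : 0 < ρ) :
    ∃ y, x < y ∧ k y ≤ ρ := by
  by_contra! h
  have h1 := hk.integrable.measure_ge_lt_top hρ
  have h2 : volume (Ioi x) ≤ volume {y | ρ ≤ k y} := measure_mono fun y hy => (h y hy).le
  rw [Real.volume_Ioi] at h2
  exact absurd (h2.trans_lt h1) (lt_irrefl _)

theorem IsProfile.variation_Icc_ne_top (hk : IsProfile V k) (s : Set ℝ) : eVariationOn k s ≠ ⊤ :=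
  ne_top_of_le_ne_top hk.finite_variation (eVariationOn.mono k (subset_univ _))

/-- Integrability forces arbitrarily small values on both sides of `x`, so the graph has to rise to
`k x` and to descend again. -/
theorem IsProfile.two_mul_le_variation (hk : IsProfile V k) (x : ℝ) :
    2 * k x ≤ (eVariationOn k univ).toReal := by
  refine le_of_forall_pos_le_add fun ρ hρ => ?_
  obtain ⟨y, hy, hky⟩ := hk.exists_lt_le x (half_pos hρ)
  obtain ⟨z, hz, hkz⟩ := hk.exists_gt_le x (half_pos hρ)
  have h1 := peak_le_variation (hk.variation_Icc_ne_top (Icc y z)) ⟨hy.le, hz.le⟩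
  have h2 := ENNReal.toReal_mono hk.finite_variation (eVariationOn.mono k (subset_univ (Icc y z)))
  linarith

/-! ### Volume below a small level. -/

section Thin

variable {c C L : ℝ} {S : ℝ → ℝ} {μ : Measure ℝ}

/-- On the cell, `k` exceeds its infimum `m` by at most its variation. If `L m ≥ δ`, the cell pays
`c δ²`, enough to control `δ ε`; if `L m ≤ δ`, it pays `c δ L m`, enough to control `δ m`. The two
summands of the constant correspond to these cases. -/
theorem lintegral_min_cell_le (hk : IsProfile V k) (hμ : CellBound c C S k L μ) (hc : 0 < c)
    (hL : 0 < L) {ε δ : ℝ} (hε : 0 < ε) (hδ : 0 < δ) (a : ℝ) :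
    ∫⁻ x in Ioc a (a + δ), ENNReal.ofReal (min (k x) ε)
      ≤ ENNReal.ofReal (1 / (c * L) + ε / (c * δ)) * μ (Ioo a (a + δ))
        + ENNReal.ofReal δ * eVariationOn k (Icc a (a + δ)) := by
  have haδ : a ≤ a + δ := by linarith
  have hbdd : BddBelow (k '' Icc a (a + δ)) := ⟨0, by rintro _ ⟨x, -, rfl⟩; exact hk.nonneg x⟩
  have hne : (k '' Icc a (a + δ)).Nonempty := ⟨_, a, left_mem_Icc.2 haδ, rfl⟩
  set m := sInf (k '' Icc a (a + δ)) with hm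
  have hm0 : 0 ≤ m := le_csInf hne (by rintro _ ⟨x, -, rfl⟩; exact hk.nonneg x)
  have hv := hk.variation_Icc_ne_top (Icc a (a + δ))
  set v := (eVariationOn k (Icc a (a + δ))).toReal with hvdef
  have hv0 : 0 ≤ v := ENNReal.toReal_nonneg
  have hpt : ∀ x ∈ Icc a (a + δ), min (k x) ε ≤ min m ε + v := by
    intro x hx
    have h1 : k x - v ≤ m := by
      refine le_csInf hne ?_
      rintro _ ⟨y, hy, rfl⟩
      linarith [sub_le_variation hv hx hy]
    rw [← min_add_add_right]
    exact min_le_min (by linarith) (by linarith)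
  have hmin0 : 0 ≤ min m ε := le_min hm0 hε.le
  have hcell : ENNReal.ofReal (δ * min m ε)
      ≤ ENNReal.ofReal (1 / (c * L) + ε / (c * δ)) * μ (Ioo a (a + δ)) := by
    rcases hm0.eq_or_lt with h0 | h0
    · rw [← h0, min_eq_left hε.le, mul_zero, ENNReal.ofReal_zero]
      exact zero_le
    · have h1 := hμ.coarse a δ (L * m) hδ (by positivity) fun x hx =>
        mul_le_mul_of_nonneg_left (csInf_le hbdd ⟨x, Ioo_subset_Icc_self hx, rfl⟩) hL.le
      refine le_trans ?_ (mul_le_mul_right h1 _)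
      rw [← ENNReal.ofReal_mul (by positivity)]
      refine ENNReal.ofReal_le_ofReal ?_
      rcases le_total δ (L * m) with h | h
      · rw [min_eq_left h]
        calc δ * min m ε ≤ δ * ε := by gcongr; exact min_le_right _ _
          _ = (0 + ε / (c * δ)) * (c * (δ * δ)) := by field_simp; ring
          _ ≤ _ := by gcongr; positivity
      · rw [min_eq_right h]
        calc δ * min m ε ≤ δ * m := by gcongr; exact min_le_left _ _
          _ = (1 / (c * L) + 0) * (c * (δ * (L * m))) := by field_simp; ring
          _ ≤ _ := by gcongr; positivity
  calc ∫⁻ x in Ioc a (a + δ), ENNReal.ofReal (min (k x) ε)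
      ≤ ∫⁻ _ in Ioc a (a + δ), ENNReal.ofReal (min m ε + v) :=
        setLIntegral_mono measurable_const fun x hx =>
          ENNReal.ofReal_le_ofReal (hpt x (Ioc_subset_Icc_self hx))
    _ = ENNReal.ofReal (δ * min m ε) + ENNReal.ofReal δ * eVariationOn k (Icc a (a + δ)) := by
        rw [setLIntegral_const, Real.volume_Ioc, add_sub_cancel_left, ENNReal.ofReal_add hmin0 hv0,
          hvdef, ENNReal.ofReal_toReal hv, ENNReal.ofReal_mul hδ.le]
        ring
    _ ≤ _ := by gcongr

theorem lintegral_min_le (hk : IsProfile V k) (hμ : CellBound c C S k L μ) (hc : 0 < c)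
    (hL : 0 < L) {ε δ : ℝ} (hε : 0 < ε) (hδ : 0 < δ) :
    ∫⁻ x, ENNReal.ofReal (min (k x) ε)
      ≤ ENNReal.ofReal (1 / (c * L) + ε / (c * δ)) * μ univ
        + ENNReal.ofReal δ * eVariationOn k univ := by
  have hIoc : ∀ j : ℤ, Ioc (j • δ) ((j + 1) • δ) = Ioc (j • δ) (j • δ + δ) := fun j => by
    rw [add_smul, one_smul]
  have hcover := iUnion_Ioc_zsmul hδ
  have hdisj := pairwise_disjoint_Ioc_zsmul δ
  simp_rw [hIoc] at hcover hdisj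
  have h1 := lintegral_iUnion_le (μ := volume) (fun j : ℤ => Ioc (j • δ) (j • δ + δ))
    (fun x => ENNReal.ofReal (min (k x) ε))
  rw [hcover, Measure.restrict_univ] at h1
  refine h1.trans ((ENNReal.tsum_le_tsum fun j =>
    lintegral_min_cell_le hk hμ hc hL hε hδ (j • δ)).trans ?_)
  rw [ENNReal.tsum_add, ENNReal.tsum_mul_left, ENNReal.tsum_mul_left]
  gcongr
  · refine tsum_measure_le_measure_univ (fun j => measurableSet_Ioo.nullMeasurableSet) ?_
    intro i j hij
    exact ((hdisj hij).mono Ioo_subset_Ioc_self Ioo_subset_Ioc_self).aedisjoint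
  · rw [ENNReal.tsum_eq_iSup_sum]
    refine iSup_le fun s => sum_eVariationOn_Icc_le k (fun j _ => by linarith) ?_
    intro i _ j _ hij
    simp only [zsmul_eq_mul]
    rcases lt_or_gt_of_ne hij with h | h
    · left
      have : (i : ℝ) + 1 ≤ j := by exact_mod_cast h
      nlinarith
    · right
      have : (j : ℝ) + 1 ≤ i := by exact_mod_cast h
      nlinarith

/-- The volume below a small level is controlled by the energies. -/
theorem integral_min_le (hk : IsProfile V k) (hμ : CellBound c C S k L μ) (hc : 0 < c)
    (hL : 0 < L) {ε δ D : ℝ} (hε : 0 < ε) (hδ : 0 < δ) (hD0 : 0 ≤ D) (hD : μ univ ≤ ENNReal.ofReal D) :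
    ∫ x, min (k x) ε
      ≤ (1 / (c * L) + ε / (c * δ)) * D + δ * (eVariationOn k univ).toReal := by
  rw [integral_eq_lintegral_of_nonneg_ae (Eventually.of_forall fun x => le_min (hk.nonneg x) hε.le)
    (hk.measurable.min measurable_const).aestronglyMeasurable]
  refine ENNReal.toReal_le_of_le_ofReal (by positivity) ((lintegral_min_le hk hμ hc hL hε hδ).trans ?_)
  rw [ENNReal.ofReal_add (p := (1 / (c * L) + ε / (c * δ)) * D) (by positivity) (by positivity),
    ENNReal.ofReal_mul (q := D) (by positivity), ENNReal.ofReal_mul hδ.le, ENNReal.ofReal_toReal hk.finite_variation]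
  gcongr

end Thin

/-! ### Components of a superlevel set and the dominant one. -/

section Components

/-- The end points of the components of `{k > ε}` on which `k` exceeds `2 ε`. -/
def peaks (k : ℝ → ℝ) (ε : ℝ) : Set (ℝ × ℝ) :=
  {J | k J.1 ≤ ε ∧ k J.2 ≤ ε ∧ (∀ x ∈ Ioo J.1 J.2, ε < k x) ∧ ∃ x ∈ Ioo J.1 J.2, 2 * ε < k x}

theorem peaks_lt {ε : ℝ} {J : ℝ × ℝ} (hJ : J ∈ peaks k ε) : J.1 < J.2 := by
  obtain ⟨-, -, -, x, hx, -⟩ := hJ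
  exact hx.1.trans hx.2

theorem peaks_disjoint {ε : ℝ} {J J' : ℝ × ℝ} (hJ : J ∈ peaks k ε) (hJ' : J' ∈ peaks k ε)
    (hne : J ≠ J') : J.2 ≤ J'.1 ∨ J'.2 ≤ J.1 := by
  by_contra! h
  obtain ⟨h1, h2⟩ := h
  have hlt := peaks_lt hJ
  have hlt' := peaks_lt hJ'
  refine hne (Prod.ext ?_ ?_)
  · rcases lt_trichotomy J.1 J'.1 with h | h | h
    · exact absurd (hJ.2.2.1 _ ⟨h, h1⟩) (not_lt.2 hJ'.1)
    · exact h
    · exact absurd (hJ'.2.2.1 _ ⟨h, h2⟩) (not_lt.2 hJ.1)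
  · rcases lt_trichotomy J.2 J'.2 with h | h | h
    · exact absurd (hJ'.2.2.1 _ ⟨h1, h⟩) (not_lt.2 hJ.2.1)
    · exact h
    · exact absurd (hJ.2.2.1 _ ⟨h2, h⟩) (not_lt.2 hJ'.2.1)

/-- Half of the variation of `k` on a closed interval. -/
def halfVariation (k : ℝ → ℝ) (J : ℝ × ℝ) : ℝ := (eVariationOn k (Icc J.1 J.2)).toReal / 2

theorem halfVariation_nonneg (J : ℝ × ℝ) : 0 ≤ halfVariation k J :=
  div_nonneg ENNReal.toReal_nonneg zero_le_two

theorem IsProfile.sub_le_halfVariation (hk : IsProfile V k) {ε : ℝ} {J : ℝ × ℝ} (hJ : J ∈ peaks k ε)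
    {x : ℝ} (hx : x ∈ Ioo J.1 J.2) : k x - ε ≤ halfVariation k J := by
  have := peak_le_variation (hk.variation_Icc_ne_top (Icc J.1 J.2)) (Ioo_subset_Icc_self hx)
  have h1 := hJ.1
  have h2 := hJ.2.1
  unfold halfVariation
  linarith

theorem IsProfile.sum_halfVariation_le (hk : IsProfile V k) {ε : ℝ} {s : Finset (ℝ × ℝ)}
    (hs : (s : Set (ℝ × ℝ)) ⊆ peaks k ε) :
    ∑ J ∈ s, halfVariation k J ≤ (eVariationOn k univ).toReal / 2 := by
  have h := sum_eVariationOn_Icc_le k (s := s) (a := Prod.fst) (b := Prod.snd)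
    (fun J hJ => peaks_lt (hs hJ)) fun J hJ J' hJ' hne => peaks_disjoint (hs hJ) (hs hJ') hne
  have h2 := ENNReal.toReal_mono hk.finite_variation h
  rw [ENNReal.toReal_sum fun J _ => hk.variation_Icc_ne_top _] at h2
  unfold halfVariation
  rw [← Finset.sum_div]
  linarith

/-- A peak climbs from at most `ε` to above `2 ε`, so it uses at least `ε` of half variation. This
is the purpose of the second level in `peaks`. -/
theorem IsProfile.finite_peaks (hk : IsProfile V k) {ε : ℝ} (hε : 0 < ε) : (peaks k ε).Finite := by
  by_contra hinf
  obtain ⟨n, hn⟩ := exists_nat_gt ((eVariationOn k univ).toReal / 2 / ε)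
  obtain ⟨t, ht, hcard⟩ := Set.Infinite.exists_subset_card_eq hinf n
  have h1 := hk.sum_halfVariation_le ht
  have h2 : ∑ _J ∈ t, ε ≤ ∑ J ∈ t, halfVariation k J := by
    refine Finset.sum_le_sum fun J hJ => ?_
    obtain ⟨x, hx, hx2⟩ := (ht hJ).2.2.2
    linarith [hk.sub_le_halfVariation (ht hJ) hx]
  rw [Finset.sum_const, hcard, nsmul_eq_mul] at h2
  rw [div_lt_iff₀ hε] at hn
  linarith

/-- By lower semicontinuity `{k ≤ ε}` is closed, so it has points nearest to `x` on either side;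
these are the end points. -/
theorem IsProfile.exists_peak (hk : IsProfile V k) {ε : ℝ} (hε : 0 < ε) {x : ℝ} (hx : 2 * ε < k x) :
    ∃ J ∈ peaks k ε, x ∈ Ioo J.1 J.2 := by
  have hcl : IsClosed {y | k y ≤ ε} := by
    have := lowerSemicontinuous_iff_isOpen_preimage.1 hk.lsc ε
    have e : {y | k y ≤ ε} = (k ⁻¹' Ioi ε)ᶜ := by ext y; simp
    rw [e]
    exact this.isClosed_compl
  obtain ⟨y, hy, hky⟩ := hk.exists_lt_le x hε
  obtain ⟨z, hz, hkz⟩ := hk.exists_gt_le x hε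
  have hA : IsClosed ({y | k y ≤ ε} ∩ Iic x) := hcl.inter isClosed_Iic
  have hB : IsClosed ({y | k y ≤ ε} ∩ Ici x) := hcl.inter isClosed_Ici
  have bA : BddAbove ({y | k y ≤ ε} ∩ Iic x) := ⟨x, fun t ht => ht.2⟩
  have bB : BddBelow ({y | k y ≤ ε} ∩ Ici x) := ⟨x, fun t ht => ht.2⟩
  have mA := hA.csSup_mem ⟨y, hky, hy.le⟩ bA
  have mB := hB.csInf_mem ⟨z, hkz, hz.le⟩ bB
  set α := sSup ({y | k y ≤ ε} ∩ Iic x)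
  set β := sInf ({y | k y ≤ ε} ∩ Ici x)
  have hα : α < x := lt_of_le_of_ne mA.2 fun h => by
    have : k α ≤ ε := mA.1
    rw [h] at this
    linarith
  have hβ : x < β := lt_of_le_of_ne mB.2 fun h => by
    have : k β ≤ ε := mB.1
    rw [← h] at this
    linarith
  refine ⟨(α, β), ⟨mA.1, mB.1, fun t ht => ?_, x, ⟨hα, hβ⟩, hx⟩, hα, hβ⟩
  by_contra! hn
  rcases le_total t x with h | h
  · exact absurd ht.1 (not_lt.2 (le_csSup bA ⟨hn, h⟩))
  · exact absurd ht.2 (not_lt.2 (csInf_le bB ⟨hn, h⟩))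

theorem IsProfile.integrable_excess (hk : IsProfile V k) {ε : ℝ} (hε : 0 < ε) :
    Integrable (fun x => max (k x - 2 * ε) 0) := by
  refine hk.integrable.mono' ((hk.measurable.sub_const _).max measurable_const).aestronglyMeasurable
    (Eventually.of_forall fun x => ?_)
  rw [Real.norm_eq_abs, abs_of_nonneg (le_max_right _ _)]
  exact max_le (by linarith) (hk.nonneg x)

/-- The volume above the level `2 ε` outside a peak is carried by the other peaks. -/
theorem IsProfile.setIntegral_excess_le (hk : IsProfile V k) {ε : ℝ} (hε : 0 < ε)
    {s : Finset (ℝ × ℝ)} (hs : (s : Set (ℝ × ℝ)) ⊆ peaks k ε) {A : Set ℝ} (hA : MeasurableSet A)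
    (hcov : ∀ x ∈ A, 2 * ε < k x → ∃ J ∈ s, x ∈ Ioo J.1 J.2) :
    ∫ x in A, max (k x - 2 * ε) 0 ≤ ∑ J ∈ s, halfVariation k J * (J.2 - J.1) := by
  have hi := hk.integrable_excess hε
  have hnn : ∀ x, 0 ≤ max (k x - 2 * ε) 0 := fun x => le_max_right _ _
  rw [← integral_indicator hA]
  calc ∫ x, A.indicator (fun x => max (k x - 2 * ε) 0) x
      ≤ ∫ x, ∑ J ∈ s, (Ioo J.1 J.2).indicator (fun _ => halfVariation k J) x := by
        refine integral_mono (hi.indicator hA) (integrable_finsetSum _ fun J _ =>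
          (integrable_indicator_iff measurableSet_Ioo).2 (integrableOn_const (by simp))) fun x => ?_
        have hnn' : ∀ J ∈ s, 0 ≤ (Ioo J.1 J.2).indicator (fun _ => halfVariation k J) x :=
          fun J _ => indicator_nonneg (fun _ _ => halfVariation_nonneg J) x
        by_cases hx : x ∈ A
        · rw [indicator_of_mem hx]
          rcases le_or_gt (k x) (2 * ε) with h | h
          · rw [max_eq_right (by linarith)]
            exact Finset.sum_nonneg hnn'
          · obtain ⟨J, hJ, hxJ⟩ := hcov x hx h
            refine le_trans ?_ (Finset.single_le_sum hnn' hJ)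
            rw [indicator_of_mem hxJ, max_eq_left (by linarith)]
            linarith [hk.sub_le_halfVariation (hs hJ) hxJ]
        · rw [indicator_of_notMem hx]
          exact Finset.sum_nonneg hnn'
    _ = ∑ J ∈ s, halfVariation k J * (J.2 - J.1) := by
        rw [integral_finsetSum _ fun J _ =>
          (integrable_indicator_iff measurableSet_Ioo).2 (integrableOn_const (by simp))]
        refine Finset.sum_congr rfl fun J hJ => ?_
        rw [integral_indicator measurableSet_Ioo, setIntegral_const, measureReal_def,
          Real.volume_Ioo, ENNReal.toReal_ofReal (by linarith [peaks_lt (hs hJ)]), smul_eq_mul,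
          mul_comm]

/-- With `h1` the coarse bound excludes peaks wider than `L ε`. For the others it gives `c b² ≤ D`,
so `h2` makes the level high enough for the fine bound. The peaks are disjoint and the measure has
total mass at most `D`. -/
theorem IsProfile.sum_sq_length_le {c C L : ℝ} {S : ℝ → ℝ} {μ : Measure ℝ}
    (hμ : CellBound c C S k L μ) (hL : 0 < L) {D ε η : ℝ} (hD0 : 0 ≤ D)
    (hD : μ univ ≤ ENNReal.ofReal D) (hc : 0 < c) (hε : 0 < ε) (hη : 0 < η) (hηC : η < C)
    (h1 : D < c * (L * ε) ^ 2) (h2 : ∀ b : ℝ, 0 < b → c * b ^ 2 ≤ D → S η * b ≤ L * ε)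
    {s : Finset (ℝ × ℝ)} (hs : (s : Set (ℝ × ℝ)) ⊆ peaks k ε) :
    ∑ J ∈ s, (J.2 - J.1) ^ 2 ≤ D / (C - η) := by
  have hLε : 0 < L * ε := mul_pos hL hε
  have hfine : ∀ J ∈ s, ENNReal.ofReal ((C - η) * (J.2 - J.1) ^ 2) ≤ μ (Ioo J.1 J.2) := by
    intro J hJ
    have hb : 0 < J.2 - J.1 := sub_pos.2 (peaks_lt (hs hJ))
    have hIoo : Ioo J.1 (J.1 + (J.2 - J.1)) = Ioo J.1 J.2 := by rw [add_sub_cancel]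
    have hlev : ∀ x ∈ Ioo J.1 (J.1 + (J.2 - J.1)), L * ε ≤ L * k x := fun x hx =>
      mul_le_mul_of_nonneg_left ((hs hJ).2.2.1 x (hIoo ▸ hx)).le hL.le
    have hco := (hμ.coarse J.1 (J.2 - J.1) (L * ε) hb hLε hlev).trans
      ((measure_mono (subset_univ _)).trans hD)
    rw [ENNReal.ofReal_le_ofReal_iff hD0] at hco
    have hle : J.2 - J.1 ≤ L * ε := by
      by_contra! hn
      rw [min_eq_right hn.le] at hco
      have : c * (L * ε * (L * ε)) ≤ c * ((J.2 - J.1) * (L * ε)) := by gcongr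
      nlinarith
    rw [min_eq_left hle] at hco
    have := hμ.fine η J.1 (J.2 - J.1) (L * ε) hη hb hLε hlev (h2 _ hb (by linarith [sq (J.2 - J.1)]))
    rwa [hIoo] at this
  have hsum : ∑ J ∈ s, ENNReal.ofReal ((C - η) * (J.2 - J.1) ^ 2) ≤ ENNReal.ofReal D := by
    refine (Finset.sum_le_sum hfine).trans ?_
    rw [← measure_biUnion_finset _ fun J _ => measurableSet_Ioo]
    · exact (measure_mono (subset_univ _)).trans hD
    · intro J hJ J' hJ' hne
      rw [Function.onFun, Set.disjoint_left]
      intro x hx hx'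
      rcases peaks_disjoint (hs hJ) (hs hJ') hne with h | h
      · exact absurd (hx'.1.trans hx.2) (not_lt.2 h)
      · exact absurd (hx.1.trans hx'.2) (not_lt.2 h)
  have hCη : 0 < C - η := sub_pos.2 hηC
  rw [← ENNReal.ofReal_sum_of_nonneg fun J _ => by positivity, ENNReal.ofReal_le_ofReal_iff hD0,
    ← Finset.mul_sum] at hsum
  rw [le_div_iff₀ hCη]
  linarith

/-- A profile of finite energy has a peak that carries most of the volume if the energies are almost
optimal. -/
theorem IsProfile.exists_dominant_peak (hk : IsProfile V k) {c C L : ℝ} {S : ℝ → ℝ} {μ : Measure ℝ}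
    (hμ : CellBound c C S k L μ) (hL : 0 < L) {D ε η : ℝ} (hD0 : 0 ≤ D)
    (hD : μ univ ≤ ENNReal.ofReal D) (hc : 0 < c) (hε : 0 < ε) (hη : 0 < η) (hηC : η < C)
    (h1 : D < c * (L * ε) ^ 2) (h2 : ∀ b : ℝ, 0 < b → c * b ^ 2 ≤ D → S η * b ≤ L * ε)
    (hv : 0 < ∫ x, max (k x - 2 * ε) 0) {X : ℝ} (hX : X = (eVariationOn k univ).toReal / 2) :
    ∃ α β M : ℝ, α < β ∧ 0 ≤ M ∧ M ≤ X ∧ (β - α) ^ 2 ≤ D / (C - η) ∧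
      (∫ x, max (k x - 2 * ε) 0) ^ 2 ≤ M * X * (D / (C - η)) ∧
      ∫ x in (Ioo α β)ᶜ, max (k x - 2 * ε) 0 ≤ (X - M) * Real.sqrt (D / (C - η)) := by
  classical
  set F := (hk.finite_peaks hε).toFinset with hF
  have hFs : (F : Set (ℝ × ℝ)) ⊆ peaks k ε := by simp [hF]
  have hall := hk.setIntegral_excess_le hε hFs MeasurableSet.univ fun x _ hx => by
    obtain ⟨J, hJ, hxJ⟩ := hk.exists_peak hε hx
    exact ⟨J, by simpa [hF] using hJ, hxJ⟩
  rw [Measure.restrict_univ] at hall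
  have hne : F.Nonempty := by
    by_contra hn
    rw [Finset.not_nonempty_iff_eq_empty] at hn
    rw [hn, Finset.sum_empty] at hall
    linarith
  -- The dominant peak is the one with the largest half variation, which becomes `M`.
  obtain ⟨J, hJ, hmax⟩ := F.exists_max_image (halfVariation k) hne
  have hsumv := hk.sum_halfVariation_le hFs
  rw [← hX] at hsumv
  have hsq := IsProfile.sum_sq_length_le hμ hL hD0 hD hc hε hη hηC h1 h2 hFs
  have hnn := halfVariation_nonneg (k := k)
  have hmem : ∀ J ∈ F, (J.2 - J.1) ^ 2 ≤ D / (C - η) := fun J' hJ' =>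
    (Finset.single_le_sum (f := fun J : ℝ × ℝ => (J.2 - J.1) ^ 2)
      (fun _ _ => sq_nonneg _) hJ').trans hsq
  have hQ : 0 ≤ D / (C - η) := (sq_nonneg _).trans (hmem J hJ)
  refine ⟨J.1, J.2, halfVariation k J, peaks_lt (hFs hJ), hnn J, ?_, hmem J hJ, ?_, ?_⟩
  · exact (Finset.single_le_sum (fun J _ => hnn J) hJ).trans hsumv
  -- Cauchy–Schwarz over the peaks, followed by `∑ Mᵢ² ≤ M ∑ Mᵢ ≤ M X`. Keeping `M` here instead of
  -- a second `X` is what later forces `M` close to `X`.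
  · calc (∫ x, max (k x - 2 * ε) 0) ^ 2
        ≤ (∑ J ∈ F, halfVariation k J * (J.2 - J.1)) ^ 2 := pow_le_pow_left₀ hv.le hall 2
      _ ≤ (∑ J ∈ F, halfVariation k J ^ 2) * ∑ J ∈ F, (J.2 - J.1) ^ 2 :=
        Finset.sum_mul_sq_le_sq_mul_sq _ _ _
      _ ≤ (halfVariation k J * X) * (D / (C - η)) := by
        refine mul_le_mul ?_ hsq (Finset.sum_nonneg fun _ _ => sq_nonneg _)
          (mul_nonneg (hnn J) ((Finset.sum_nonneg fun J _ => hnn J).trans hsumv))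
        calc ∑ J ∈ F, halfVariation k J ^ 2
            ≤ ∑ J' ∈ F, halfVariation k J * halfVariation k J' := by
              refine Finset.sum_le_sum fun J' hJ' => ?_
              rw [sq]
              exact mul_le_mul_of_nonneg_right (hmax J' hJ') (hnn J')
          _ = halfVariation k J * ∑ J' ∈ F, halfVariation k J' := by rw [Finset.mul_sum]
          _ ≤ _ := mul_le_mul_of_nonneg_left hsumv (hnn J)
  -- The other peaks share the half variation `X - M`, and none is longer than the square root.
  · have hF' : ((F.erase J : Finset _) : Set (ℝ × ℝ)) ⊆ peaks k ε :=
      (Finset.coe_subset.2 (Finset.erase_subset _ _)).trans hFs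
    refine (hk.setIntegral_excess_le hε hF' measurableSet_Ioo.compl fun x hxA hx => ?_).trans ?_
    · obtain ⟨J', hJ', hxJ⟩ := hk.exists_peak hε hx
      refine ⟨J', Finset.mem_erase.2 ⟨fun h => hxA (h ▸ hxJ), by simpa [hF] using hJ'⟩, hxJ⟩
    · calc ∑ J' ∈ F.erase J, halfVariation k J' * (J'.2 - J'.1)
          ≤ ∑ J' ∈ F.erase J, halfVariation k J' * Real.sqrt (D / (C - η)) := by
            refine Finset.sum_le_sum fun J' hJ' => mul_le_mul_of_nonneg_left ?_ (hnn J')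
            exact Real.le_sqrt_of_sq_le (hmem J' (Finset.mem_of_mem_erase hJ'))
        _ = (∑ J' ∈ F.erase J, halfVariation k J') * Real.sqrt (D / (C - η)) := by
            rw [Finset.sum_mul]
        _ ≤ _ := by
            refine mul_le_mul_of_nonneg_right ?_ (Real.sqrt_nonneg _)
            have := Finset.add_sum_erase F (halfVariation k) hJ
            linarith

end Components

end Island

end

/-! ### Concentration and convergence to a rectangle in `L¹`. -/

noncomputable section

namespace Island

variable {k : ℝ → ℝ}

theorem IsProfile.integral_min_add_max (hk : IsProfile 1 k) {ε : ℝ} (hε : 0 < ε) :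
    Integrable (fun x => min (k x) (2 * ε)) ∧
    (∫ x, min (k x) (2 * ε)) + ∫ x, max (k x - 2 * ε) 0 = 1 := by
  have h1 : ∀ x, min (k x) (2 * ε) = k x - max (k x - 2 * ε) 0 := by
    intro x
    rcases le_total (k x) (2 * ε) with h | h
    · rw [min_eq_left h, max_eq_right (by linarith), sub_zero]
    · rw [min_eq_right h, max_eq_left (by linarith)]; ring
  have hi := hk.integrable_excess hε
  constructor
  · simp_rw [h1]
    exact hk.integrable.sub hi
  · simp_rw [h1]
    rw [integral_sub hk.integrable hi, hk.volume_eq]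
    ring

/-- Almost all volume lies over one interval, with bounds that become sharp as `ρ → 0`. -/
theorem exists_concentration {c C : ℝ} {S : ℝ → ℝ} (hc : 0 < c) {K ρ : ℝ} (hK : 0 ≤ K) (hρ : 0 < ρ)
    (hρC : ρ < C) (hA : (1 + 2 * K / c + 2 * K) * ρ < 1) :
    ∃ Λ : ℝ, 0 < Λ ∧ ∀ (k : ℝ → ℝ) (L : ℝ) (μ : Measure ℝ) (D X : ℝ), IsProfile 1 k →
      CellBound c C S k L μ → Λ ≤ L → 0 ≤ D → D ≤ K → μ univ ≤ ENNReal.ofReal D →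
      X = (eVariationOn k univ).toReal / 2 → X ≤ K →
      ∃ α β M : ℝ, α < β ∧ 0 ≤ M ∧ M ≤ X ∧ (β - α) ^ 2 ≤ D / (C - ρ) ∧
        (1 - (1 + 2 * K / c + 2 * K) * ρ) ^ 2 ≤ M * X * (D / (C - ρ)) ∧
        ∫ x in (Ioo α β)ᶜ, k x
          ≤ (1 + 2 * K / c + 2 * K) * ρ + (X - M) * Real.sqrt (D / (C - ρ)) := by
  set A := 1 + 2 * K / c + 2 * K with hAdef
  have hKc : 0 ≤ K / c := by positivity
  -- The level is `ε = ρ²`. The summands ensure, in this order, that `D / (c L) ≤ ρ`, that no peak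
  -- is wider than `L ρ²`, and that `S ρ · b ≤ L ρ²` for every `b` with `c b² ≤ D`, hence `b ≤ K / c
  -- + 1`.
  refine ⟨K / c / ρ + (K / c + 1) / ρ ^ 2 + |S ρ| * (K / c + 1) / ρ ^ 2, by positivity, ?_⟩
  intro k L μ D X hk hμ hΛ hD0 hDK hD hX hXK
  have q1 : 0 ≤ K / c / ρ := by positivity
  have q2 : 0 < (K / c + 1) / ρ ^ 2 := by positivity
  have q3 : 0 ≤ |S ρ| * (K / c + 1) / ρ ^ 2 := by positivity
  have hL : 0 < L := by linarith
  have l1 : K / c / ρ ≤ L := by linarith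
  have l2 : (K / c + 1) / ρ ^ 2 ≤ L := by linarith
  have l3 : |S ρ| * (K / c + 1) / ρ ^ 2 ≤ L := by linarith
  rw [div_le_iff₀ (by positivity)] at l1 l2 l3
  have hε : 0 < ρ ^ 2 := by positivity
  have h1 : D < c * (L * ρ ^ 2) ^ 2 := by
    have : K / c < (L * ρ ^ 2) ^ 2 := by
      calc K / c < (K / c + 1) ^ 2 := by nlinarith
        _ ≤ _ := pow_le_pow_left₀ (by positivity) l2 2
    rw [div_lt_iff₀ hc] at this
    linarith
  have h2 : ∀ b : ℝ, 0 < b → c * b ^ 2 ≤ D → S ρ * b ≤ L * ρ ^ 2 := by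
    intro b hb hcb
    have hb1 : b ≤ K / c + 1 := by
      have : b ^ 2 ≤ K / c := by rw [le_div_iff₀ hc]; linarith
      by_contra! hn
      nlinarith
    calc S ρ * b ≤ |S ρ| * b := by gcongr; exact le_abs_self _
      _ ≤ |S ρ| * (K / c + 1) := by gcongr
      _ ≤ _ := l3
  obtain ⟨himin, hsplit⟩ := hk.integral_min_add_max hε
  have hX0 : 0 ≤ X := by rw [hX]; positivity
  have hs : ∫ x, min (k x) (2 * ρ ^ 2) ≤ A * ρ := by
    -- A level quadratic in the cell length `ρ` makes `ε / δ` of order `ρ`; the three error terms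
    -- add up to at most `A ρ`.
    refine (integral_min_le hk hμ hc hL (ε := 2 * ρ ^ 2) (by positivity) hρ hD0 hD).trans ?_
    have e1 : 1 / (c * L) * D ≤ ρ := by
      rw [one_div_mul_eq_div, div_le_iff₀ (by positivity)]
      rw [div_le_iff₀ hc] at l1
      nlinarith
    have e2 : 2 * ρ ^ 2 / (c * ρ) * D ≤ 2 * K / c * ρ := by
      calc 2 * ρ ^ 2 / (c * ρ) * D = 2 * D / c * ρ := by field_simp
        _ ≤ _ := by gcongr
    have e3 : ρ * (eVariationOn k univ).toReal ≤ 2 * K * ρ := by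
      have : (eVariationOn k univ).toReal = 2 * X := by rw [hX]; ring
      rw [this]
      nlinarith
    rw [hAdef]
    linarith
  have hv : 1 - A * ρ ≤ ∫ x, max (k x - 2 * ρ ^ 2) 0 := by linarith
  obtain ⟨α, β, M, hαβ, hM0, hMX, hb, hM, hout⟩ := hk.exists_dominant_peak hμ hL hD0 hD hc hε hρ hρC
    h1 h2 (by linarith) hX
  refine ⟨α, β, M, hαβ, hM0, hMX, hb, (pow_le_pow_left₀ (by linarith) hv 2).trans hM, ?_⟩
  have hi := hk.integrable_excess hε
  have e : ∀ x, k x = min (k x) (2 * ρ ^ 2) + max (k x - 2 * ρ ^ 2) 0 := by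
    intro x
    rcases le_total (k x) (2 * ρ ^ 2) with h | h
    · rw [min_eq_left h, max_eq_right (by linarith), add_zero]
    · rw [min_eq_right h, max_eq_left (by linarith)]; ring
  have e' : ∫ x in (Ioo α β)ᶜ, k x = (∫ x in (Ioo α β)ᶜ, min (k x) (2 * ρ ^ 2))
      + ∫ x in (Ioo α β)ᶜ, max (k x - 2 * ρ ^ 2) 0 := by
    rw [← integral_add himin.integrableOn hi.integrableOn]
    exact integral_congr_ae (Eventually.of_forall e)
  have hmono : ∫ x in (Ioo α β)ᶜ, min (k x) (2 * ρ ^ 2) ≤ ∫ x, min (k x) (2 * ρ ^ 2) :=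
    setIntegral_le_integral himin
      (Eventually.of_forall fun x => le_min (hk.nonneg x) (by positivity))
  linarith

theorem rectangle_apply_of_mem {a b x : ℝ} (hx : x ∈ Ioo a (a + b)) : rectangle a b x = 1 / b :=
  indicator_of_mem hx _

theorem rectangle_apply_of_notMem {a b x : ℝ} (hx : x ∉ Ioo a (a + b)) : rectangle a b x = 0 :=
  indicator_of_notMem hx _

theorem rectangle_nonneg {a b : ℝ} (hb : 0 < b) (x : ℝ) : 0 ≤ rectangle a b x :=
  indicator_nonneg (fun _ _ => by positivity) x

theorem integrable_rectangle (a b : ℝ) : Integrable (rectangle a b) :=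
  (integrable_indicator_iff measurableSet_Ioo).2 (integrableOn_const (by simp))

theorem integral_rectangle (a : ℝ) {b : ℝ} (hb : 0 < b) : ∫ x, rectangle a b x = 1 := by
  unfold rectangle
  rw [integral_indicator measurableSet_Ioo, setIntegral_const, measureReal_def, Real.volume_Ioo,
    add_sub_cancel_left, ENNReal.toReal_ofReal hb.le, smul_eq_mul, mul_one_div_cancel hb.ne']

/-- The distance of a profile of volume one from a rectangle. -/
theorem IsProfile.integral_abs_sub_rectangle_le (hk : IsProfile 1 k) {X α β b : ℝ} (hb : 0 < b)
    (hX : ∀ x, k x ≤ X) :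
    ∫ x, |k x - rectangle α b x| ≤ 2 * ((∫ x in (Ioo α β)ᶜ, k x) + b * |X - 1 / b|
      + X * max (β - α - b) 0) := by
  have hX0 : 0 ≤ X := (hk.nonneg 0).trans (hX 0)
  have hR := integrable_rectangle α b
  have hdiff : Integrable fun x => k x - rectangle α b x := hk.integrable.sub hR
  have hpos : Integrable fun x => max (k x - rectangle α b x) 0 := hdiff.pos_part
  have e1 : ∀ x, |k x - rectangle α b x|
      = 2 * max (k x - rectangle α b x) 0 - (k x - rectangle α b x) := by
    intro x
    rcases le_total (k x - rectangle α b x) 0 with h | h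
    · rw [abs_of_nonpos h, max_eq_right h]; ring
    · rw [abs_of_nonneg h, max_eq_left h]; ring
  -- Both functions have integral one, so the distance is twice the integral of the positive part
  -- and only upper bounds for `k` are needed.
  have e2 : ∫ x, |k x - rectangle α b x| = 2 * ∫ x, max (k x - rectangle α b x) 0 := by
    simp_rw [e1]
    rw [integral_sub (hpos.const_mul 2) hdiff, integral_const_mul,
      integral_sub hk.integrable hR, hk.volume_eq, integral_rectangle α hb]
    ring
  rw [e2]
  refine mul_le_mul_of_nonneg_left ?_ zero_le_two
  have i1 : Integrable ((Ioo α β)ᶜ.indicator k) := hk.integrable.indicator measurableSet_Ioo.compl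
  have i2 : Integrable ((Ioo α (α + b)).indicator fun _ => |X - 1 / b|) :=
    (integrable_indicator_iff measurableSet_Ioo).2 (integrableOn_const (by simp))
  have i3 : Integrable ((Ico (α + b) β).indicator fun _ => X) :=
    (integrable_indicator_iff measurableSet_Ico).2 (integrableOn_const (by simp))
  have i12 : Integrable fun x => (Ioo α β)ᶜ.indicator k x
      + (Ioo α (α + b)).indicator (fun _ => |X - 1 / b|) x := i1.add i2
  calc ∫ x, max (k x - rectangle α b x) 0
      ≤ ∫ x, ((Ioo α β)ᶜ.indicator k x + (Ioo α (α + b)).indicator (fun _ => |X - 1 / b|) x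
        + (Ico (α + b) β).indicator (fun _ => X) x) := by
        refine integral_mono hpos (i12.add i3) fun x => ?_
        have n1 : 0 ≤ (Ioo α β)ᶜ.indicator k x := indicator_nonneg (fun x _ => hk.nonneg x) x
        have n2 : 0 ≤ (Ioo α (α + b)).indicator (fun _ => |X - 1 / b|) x :=
          indicator_nonneg (fun _ _ => abs_nonneg _) x
        have n3 : 0 ≤ (Ico (α + b) β).indicator (fun _ => X) x := indicator_nonneg (fun _ _ => hX0) x
        have nR := rectangle_nonneg (a := α) hb x
        refine max_le ?_ (by positivity)
        by_cases hx : x ∈ Ioo α β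
        · by_cases hx' : x ∈ Ioo α (α + b)
          · rw [rectangle_apply_of_mem hx', indicator_of_mem hx']
            linarith [hX x, le_abs_self (X - 1 / b)]
          · have : x ∈ Ico (α + b) β := by
              refine ⟨?_, hx.2⟩
              by_contra! hn
              exact hx' ⟨hx.1, hn⟩
            rw [indicator_of_mem this]
            linarith [hX x]
        · rw [indicator_of_mem (show x ∈ (Ioo α β)ᶜ from hx)]
          linarith
    _ = _ := by
        rw [integral_add i12 i3, integral_add i1 i2, integral_indicator measurableSet_Ioo.compl,
          integral_indicator measurableSet_Ioo, integral_indicator measurableSet_Ico,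
          setIntegral_const, setIntegral_const, measureReal_def, measureReal_def, Real.volume_Ioo,
          Real.volume_Ico, add_sub_cancel_left, ENNReal.toReal_ofReal hb.le, ENNReal.toReal_ofReal',
          smul_eq_mul, smul_eq_mul, show β - (α + b) = β - α - b by ring]
        ring

/-- The energies `D` and `2 X` of almost optimal profiles converge to their optimal values. -/
theorem tendsto_of_almost_optimal {H : ℝ} (hH : 0 < H) {A ρ₀ : ℝ} (hρ₀ : 0 < ρ₀) {D X : ℕ → ℝ}
    (hX : ∀ n, 0 ≤ X n) (hDX : ∀ n, D n + 2 * X n ≤ 3 * H)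
    (h : ∀ ρ, 0 < ρ → ρ < ρ₀ → ∀ᶠ n in atTop, (1 - A * ρ) ^ 2 * (H ^ 3 - ρ) ≤ X n ^ 2 * D n) :
    Tendsto X atTop (𝓝 H) := by
  have hF : Tendsto (fun ρ : ℝ => (H ^ 3 - (1 - A * ρ) ^ 2 * (H ^ 3 - ρ)) / H) (𝓝[>] 0) (𝓝 0) := by
    have : Continuous fun ρ : ℝ => (H ^ 3 - (1 - A * ρ) ^ 2 * (H ^ 3 - ρ)) / H := by fun_prop
    have := this.tendsto 0
    simp only [mul_zero, sub_zero, one_pow, one_mul, sub_self, zero_div] at this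
    exact this.mono_left nhdsWithin_le_nhds
  rw [Metric.tendsto_atTop']
  intro r hr
  have e1 : ∀ᶠ ρ in 𝓝[>] (0 : ℝ), (H ^ 3 - (1 - A * ρ) ^ 2 * (H ^ 3 - ρ)) / H < r ^ 2 :=
    hF.eventually (gt_mem_nhds (by positivity))
  have e2 : ∀ᶠ ρ in 𝓝[>] (0 : ℝ), ρ ∈ Ioo 0 ρ₀ := Ioo_mem_nhdsGT hρ₀
  obtain ⟨ρ, hρ1, hρ2⟩ := (e1.and e2).exists
  obtain ⟨N, hN⟩ := eventually_atTop.1 (h ρ hρ2.1 hρ2.2)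
  refine ⟨N, fun n hn => ?_⟩
  have h1 := hN n hn.le
  have h2 : X n ^ 2 * D n ≤ X n ^ 2 * (3 * H - 2 * X n) :=
    mul_le_mul_of_nonneg_left (by linarith [hDX n]) (sq_nonneg _)
  -- The arithmetic-geometric mean inequality with its remainder: `H³ - X² (3H - 2X) = (X - H)² (2X
  -- + H)`.
  have h3 : (X n - H) ^ 2 * H ≤ H ^ 3 - (1 - A * ρ) ^ 2 * (H ^ 3 - ρ) := by
    have : (X n - H) ^ 2 * (2 * X n + H) = H ^ 3 - X n ^ 2 * (3 * H - 2 * X n) := by ring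
    have : (X n - H) ^ 2 * H ≤ (X n - H) ^ 2 * (2 * X n + H) :=
      mul_le_mul_of_nonneg_left (by linarith [hX n]) (sq_nonneg _)
    linarith
  rw [div_lt_iff₀ hH] at hρ1
  have h4 : (X n - H) ^ 2 < r ^ 2 := lt_of_mul_lt_mul_right (h3.trans_lt hρ1) hH.le
  rw [Real.dist_eq]
  exact abs_lt_of_sq_lt_sq h4 hr.le

/-- Almost optimal profiles converge to a rectangle up to translations. -/
theorem eventually_exists_near_rectangle {c H : ℝ} {S : ℝ → ℝ} (hc : 0 < c) (hH : 0 < H)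
    {k : ℕ → ℝ → ℝ} {L D X : ℕ → ℝ} {μ : ℕ → Measure ℝ} (hk : ∀ n, IsProfile 1 (k n))
    (hμ : ∀ n, CellBound c (H ^ 3) S (k n) (L n) (μ n)) (hL : Tendsto L atTop atTop)
    (hD0 : ∀ n, 0 ≤ D n) (hD : ∀ n, μ n univ ≤ ENNReal.ofReal (D n))
    (hX : ∀ n, X n = (eVariationOn (k n) univ).toReal / 2) (hDX : ∀ n, D n + 2 * X n ≤ 3 * H) :
    Tendsto X atTop (𝓝 H) ∧
    ∀ r : ℝ, 0 < r → ∀ᶠ n in atTop, ∃ α : ℝ, ∫ x, |k n x - rectangle α (1 / H) x| ≤ r := by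
  set K := 3 * H with hK
  set A := 1 + 2 * K / c + 2 * K with hA
  have hK0 : 0 < K := by positivity
  have hA0 : 0 < A := by positivity
  have hX0 : ∀ n, 0 ≤ X n := fun n => by rw [hX n]; positivity
  have hDK : ∀ n, D n ≤ K := fun n => by linarith [hDX n, hX0 n]
  have hXK : ∀ n, X n ≤ K := fun n => by linarith [hDX n, hX0 n, hD0 n]
  set ρ₀ := min (H ^ 3) (1 / A) with hρ₀
  have hρ₀0 : 0 < ρ₀ := by positivity
  have hcon : ∀ ρ, 0 < ρ → ρ < ρ₀ → ∀ᶠ n in atTop, ∃ α β M : ℝ, α < β ∧ 0 ≤ M ∧ M ≤ X n ∧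
      (β - α) ^ 2 ≤ D n / (H ^ 3 - ρ) ∧
        (1 - A * ρ) ^ 2 ≤ M * X n * (D n / (H ^ 3 - ρ)) ∧
        ∫ x in (Ioo α β)ᶜ, k n x ≤ A * ρ + (X n - M) * Real.sqrt (D n / (H ^ 3 - ρ)) := by
    intro ρ hρ hρ1
    have hAρ : A * ρ < 1 := by
      have := hρ1.trans_le (min_le_right _ _)
      rwa [lt_div_iff₀ hA0, mul_comm] at this
    obtain ⟨Λ, -, hΛ⟩ := exists_concentration (S := S) hc hK0.le hρ (hρ1.trans_le (min_le_left _ _))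
      hAρ
    filter_upwards [hL.eventually_ge_atTop Λ] with n hn
    exact hΛ (k n) (L n) (μ n) (D n) (X n) (hk n) (hμ n) hn (hD0 n) (hDK n) (hD n) (hX n) (hXK n)
  have hXlim : Tendsto X atTop (𝓝 H) := by
    refine tendsto_of_almost_optimal (A := A) hH hρ₀0 hX0 hDX fun ρ hρ hρ1 => ?_
    have hCρ : 0 < H ^ 3 - ρ := sub_pos.2 (hρ1.trans_le (min_le_left _ _))
    filter_upwards [hcon ρ hρ hρ1] with n ⟨α, β, M, _, hM0, hMX, _, hM, _⟩
    rw [mul_div_assoc', le_div_iff₀ hCρ] at hM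
    refine hM.trans ?_
    rw [sq]
    exact mul_le_mul_of_nonneg_right (mul_le_mul_of_nonneg_right hMX (hX0 n)) (hD0 n)
  refine ⟨hXlim, fun r hr => ?_⟩
  -- At `q = (ρ, X n)`, `Q` bounds the length of the dominant interval and `G` the distance to the
  -- rectangle; the fraction in `G` is the lower bound for `M`. At `(0, H)` they take the values
  -- `1/H` and `0`.
  let Q : ℝ × ℝ → ℝ := fun q => Real.sqrt ((3 * H - 2 * q.2) / (H ^ 3 - q.1))
  let G : ℝ × ℝ → ℝ := fun q => 2 * ((A * q.1
    + (q.2 - (1 - A * q.1) ^ 2 * (H ^ 3 - q.1) / (q.2 * (3 * H - 2 * q.2))) * Q q)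
    + 1 / H * |q.2 - 1 / (1 / H)| + q.2 * max (Q q - 1 / H) 0)
  have hH3 : H ^ 3 - 0 ≠ 0 := by rw [sub_zero]; positivity
  have hHH : H * (3 * H - 2 * H) ≠ 0 := by
    rw [show H * (3 * H - 2 * H) = H ^ 2 by ring]; positivity
  have hQc : ContinuousAt Q (0, H) := by
    refine Real.continuous_sqrt.continuousAt.comp (ContinuousAt.div (by fun_prop) (by fun_prop) hH3)
  have hGc : ContinuousAt G (0, H) := by
    have : ContinuousAt (fun q : ℝ × ℝ => (1 - A * q.1) ^ 2 * (H ^ 3 - q.1)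
        / (q.2 * (3 * H - 2 * q.2))) (0, H) :=
      ContinuousAt.div (by fun_prop) (by fun_prop) hHH
    fun_prop
  have hQ0 : Q (0, H) = 1 / H := by
    have : (3 * H - 2 * H) / (H ^ 3 - 0) = (1 / H) ^ 2 := by field_simp; ring
    simp only [Q, this]
    exact Real.sqrt_sq (by positivity)
  have hG0 : G (0, H) = 0 := by
    simp only [G, hQ0]
    have : H - (1 - A * 0) ^ 2 * (H ^ 3 - 0) / (H * (3 * H - 2 * H)) = 0 := by
      rw [show H * (3 * H - 2 * H) = H ^ 2 by ring]
      field_simp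
      ring
    rw [this]
    simp
  have hev : ∀ᶠ q in 𝓝 ((0 : ℝ), H), G q < r ∧ 0 < q.2 ∧ 0 < 3 * H - 2 * q.2 := by
    refine (hGc.eventually (gt_mem_nhds (by rw [hG0]; exact hr))).and (.and ?_ ?_)
    · exact continuous_snd.continuousAt.eventually (lt_mem_nhds hH)
    · have : ContinuousAt (fun q : ℝ × ℝ => 3 * H - 2 * q.2) (0, H) := by fun_prop
      exact this.eventually (lt_mem_nhds (by simp only; linarith))
  -- The threshold for `L` depends on `ρ`, so the neighbourhood is curried: `ρ` is fixed first and
  -- `X n` approaches `H` afterwards.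
  rw [nhds_prod_eq] at hev
  have hev1 : ∀ᶠ ρ in 𝓝[>] (0 : ℝ), ∀ᶠ y in 𝓝 H,
      G (ρ, y) < r ∧ 0 < y ∧ 0 < 3 * H - 2 * y := hev.curry.filter_mono nhdsWithin_le_nhds
  obtain ⟨ρ, hρG, hρ, hρ1⟩ := (hev1.and (Ioo_mem_nhdsGT hρ₀0)).exists
  have hCρ : 0 < H ^ 3 - ρ := sub_pos.2 (hρ1.trans_le (min_le_left _ _))
  have hAρ : 0 < 1 - A * ρ := by
    have := hρ1.trans_le (min_le_right _ _)
    rw [lt_div_iff₀ hA0, mul_comm] at this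
    linarith
  filter_upwards [hcon ρ hρ hρ1, hXlim.eventually hρG] with n ⟨α, β, M, hαβ, hM0, hMX, hb, hM, hout⟩
    ⟨hGn, hXn, hYn⟩
  refine ⟨α, ?_⟩
  have hXle : ∀ x, k n x ≤ X n := fun x => by
    have := (hk n).two_mul_le_variation x
    rw [hX n]
    linarith
  refine ((hk n).integral_abs_sub_rectangle_le (β := β) (by positivity) hXle).trans
    (le_trans ?_ hGn.le)
  have hDle : D n ≤ 3 * H - 2 * X n := by linarith [hDX n]
  have hQle : Real.sqrt (D n / (H ^ 3 - ρ)) ≤ Q (ρ, X n) := Real.sqrt_le_sqrt (by simp only; gcongr)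
  have hblen : β - α ≤ Q (ρ, X n) := (Real.le_sqrt_of_sq_le hb).trans hQle
  have hMlow : (1 - A * ρ) ^ 2 * (H ^ 3 - ρ) / (X n * (3 * H - 2 * X n)) ≤ M := by
    rw [div_le_iff₀ (mul_pos hXn hYn)]
    rw [mul_div_assoc', le_div_iff₀ hCρ] at hM
    calc _ ≤ M * X n * D n := hM
      _ ≤ M * X n * (3 * H - 2 * X n) := by gcongr
      _ = _ := by ring
  have hprod : (X n - M) * Real.sqrt (D n / (H ^ 3 - ρ))
      ≤ (X n - (1 - A * ρ) ^ 2 * (H ^ 3 - ρ) / (X n * (3 * H - 2 * X n))) * Q (ρ, X n) :=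
    mul_le_mul (by linarith) hQle (Real.sqrt_nonneg _) (by linarith)
  have hmax : X n * max (β - α - 1 / H) 0 ≤ X n * max (Q (ρ, X n) - 1 / H) 0 := by gcongr
  simp only [G]
  linarith

/-- The lower bound for the energies of a single profile. -/
theorem three_mul_le_of_forall_cellBound {c H : ℝ} {S : ℝ → ℝ} (hc : 0 < c) (hH : 0 < H)
    {k : ℝ → ℝ} {D : ℝ} {μ : Measure ℝ} (hk : IsProfile 1 k)
    (hμ : ∀ L : ℝ, 0 < L → CellBound c (H ^ 3) S k L μ) (hD0 : 0 ≤ D) (hD : μ univ ≤ ENNReal.ofReal D) :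
    3 * H ≤ D + (eVariationOn k univ).toReal := by
  set X := (eVariationOn k univ).toReal / 2 with hX
  have hX0 : 0 ≤ X := by positivity
  set K := max D X
  set A := 1 + 2 * K / c + 2 * K with hA
  have hK0 : 0 ≤ K := hD0.trans (le_max_left _ _)
  have hA0 : 0 < A := by positivity
  have key : ∀ᶠ ρ in 𝓝[>] (0 : ℝ), (1 - A * ρ) ^ 2 * (H ^ 3 - ρ) ≤ X ^ 2 * D := by
    have : (0 : ℝ) < min (H ^ 3) (1 / A) := by positivity
    filter_upwards [Ioo_mem_nhdsGT this] with ρ ⟨hρ, hρ1⟩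
    have hCρ : 0 < H ^ 3 - ρ := sub_pos.2 (hρ1.trans_le (min_le_left _ _))
    have hAρ : A * ρ < 1 := by
      have := hρ1.trans_le (min_le_right _ _)
      rwa [lt_div_iff₀ hA0, mul_comm] at this
    obtain ⟨Λ, hΛ0, hΛ⟩ := exists_concentration (S := S) hc hK0 hρ (hρ1.trans_le (min_le_left _ _))
      hAρ
    -- The cell bounds hold for every stretch, so `L = Λ` is allowed for each `ρ`.
    obtain ⟨α, β, M, _, hM0, hMX, _, hM, _⟩ := hΛ k Λ μ D X hk (hμ Λ hΛ0) le_rfl hD0 (le_max_left _ _)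
      hD rfl (le_max_right _ _)
    rw [mul_div_assoc', le_div_iff₀ hCρ] at hM
    refine hM.trans ?_
    rw [sq]
    exact mul_le_mul_of_nonneg_right (mul_le_mul_of_nonneg_right hMX hX0) hD0
  have hlim : Tendsto (fun ρ : ℝ => (1 - A * ρ) ^ 2 * (H ^ 3 - ρ)) (𝓝[>] 0) (𝓝 (H ^ 3)) := by
    have : Continuous fun ρ : ℝ => (1 - A * ρ) ^ 2 * (H ^ 3 - ρ) := by fun_prop
    have := this.tendsto 0
    simp only [mul_zero, sub_zero, one_pow, one_mul] at this
    exact this.mono_left nhdsWithin_le_nhds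
  have hmain : H ^ 3 ≤ X ^ 2 * D := le_of_tendsto hlim key
  by_contra! hn
  have hXpos : 0 < X := by
    rcases hX0.eq_or_lt with h | h
    · rw [← h] at hmain
      have : 0 < H ^ 3 := by positivity
      simp at hmain
      linarith
    · exact h
  have h1 : X ^ 2 * D < X ^ 2 * (3 * H - 2 * X) :=
    mul_lt_mul_of_pos_left (by linarith [show (eVariationOn k univ).toReal = 2 * X by rw [hX]; ring])
      (by positivity)
  have h2 : X ^ 2 * (3 * H - 2 * X) = H ^ 3 - (X - H) ^ 2 * (2 * X + H) := by ring
  have h3 : 0 ≤ (X - H) ^ 2 * (2 * X + H) := by positivity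
  linarith

end Island

end

/-! ### From `L¹` closeness and variation to Hausdorff distance. -/

noncomputable section

namespace Island

theorem edist_toLp_le (p q : ℝ × ℝ) {r : ℝ} (h : |p.1 - q.1| + |p.2 - q.2| ≤ r) :
    edist (WithLp.toLp 2 p) (WithLp.toLp 2 q) ≤ ENNReal.ofReal r := by
  rw [edist_dist]
  refine ENNReal.ofReal_le_ofReal (le_trans ?_ h)
  rw [WithLp.prod_dist_eq_of_L2]
  refine Real.sqrt_le_iff.2 ⟨by positivity, ?_⟩
  simp only [Real.dist_eq]
  change |p.1 - q.1| ^ 2 + |p.2 - q.2| ^ 2 ≤ _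
  nlinarith [abs_nonneg (p.1 - q.1), abs_nonneg (p.2 - q.2)]

theorem exists_mem_Ioo_abs_lt {f : ℝ → ℝ} (hf : Integrable f) {a b η : ℝ} (hab : a ≤ b)
    (h : ∫ x, |f x| < (b - a) * η) : ∃ x ∈ Ioo a b, |f x| < η := by
  by_contra! hn
  have h1 : ∫ _ in Ioo a b, η ≤ ∫ x in Ioo a b, |f x| :=
    setIntegral_mono_on (integrableOn_const (by simp)) hf.abs.integrableOn measurableSet_Ioo hn
  have h2 : ∫ x in Ioo a b, |f x| ≤ ∫ x, |f x| :=
    setIntegral_le_integral hf.abs (Eventually.of_forall fun x => abs_nonneg _)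
  rw [setIntegral_const, measureReal_def, Real.volume_Ioo, ENNReal.toReal_ofReal (by linarith),
    smul_eq_mul] at h1
  linarith

/-- The path rises to `x₂`, descends to `x`, rises to `x₃` and descends again; each side of the
valley point `x` contains one peak. -/
theorem valley_le_variation {f : ℝ → ℝ} (hf : eVariationOn f univ ≠ ⊤) {x₁ x₂ x x₃ x₄ : ℝ}
    (h₁ : x₁ ≤ x₂) (h₂ : x₂ ≤ x) (h₃ : x ≤ x₃) (h₄ : x₃ ≤ x₄) :
    (f x₂ - f x₁) + (f x₂ - f x) + ((f x₃ - f x) + (f x₃ - f x₄)) ≤ (eVariationOn f univ).toReal := by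
  have hn : ∀ s, eVariationOn f s ≠ ⊤ := fun s =>
    ne_top_of_le_ne_top hf (eVariationOn.mono f (subset_univ s))
  have e : eVariationOn f (Icc x₁ x) + eVariationOn f (Icc x x₄) ≤ eVariationOn f univ :=
    (eVariationOn.add_le_union f fun s hs t ht => hs.2.trans ht.1).trans
      (eVariationOn.mono f (subset_univ _))
  have e' := ENNReal.toReal_mono hf e
  rw [ENNReal.toReal_add (hn _) (hn _)] at e'
  have p1 := peak_le_variation (hn (Icc x₁ x)) (x := x₂) ⟨h₁, h₂⟩
  have p2 := peak_le_variation (hn (Icc x x₄)) (x := x₃) ⟨h₃, h₄⟩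
  linarith

theorem rectangle_subgraph_iff {b : ℝ} {p : ℝ × ℝ} :
    p ∈ subgraph (rectangle 0 b) ↔ 0 < p.2 ∧ p.1 ∈ Ioo 0 b ∧ p.2 < 1 / b := by
  by_cases h : p.1 ∈ Ioo 0 b
  · have : rectangle 0 b p.1 = 1 / b := rectangle_apply_of_mem (by rwa [zero_add])
    simp only [subgraph, mem_ofPred_eq, this, h, true_and]
  · have : rectangle 0 b p.1 = 0 := rectangle_apply_of_notMem (by rwa [zero_add])
    simp only [subgraph, mem_ofPred_eq, this, h, false_and, and_false, iff_false]
    exact fun hp => lt_asymm hp.1 hp.2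

/-- Profiles that are close to a rectangle in `L¹` and in variation have subgraphs with nearby
complements. -/
theorem hausdorffEDist_le_of_near_rectangle {f : ℝ → ℝ} (hf0 : ∀ x, 0 ≤ f x) (hf : Integrable f)
    (hvar : eVariationOn f univ ≠ ⊤) {b δ : ℝ} (hb : 0 < b) (hδ : 0 < δ)
    (hv : (eVariationOn f univ).toReal ≤ 2 * (1 / b) + δ)
    (h1 : ∫ x, |f x - rectangle 0 b x| < δ / 8) (h2 : ∫ x, |f x - rectangle 0 b x| < δ * (δ / 8))
    (h3 : ∫ x, |f x - rectangle 0 b x| < min (δ / 2) (b / 2) * (δ / 2)) :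
    Metric.hausdorffEDist (euclid (subgraph f)ᶜ) (euclid (subgraph (rectangle 0 b))ᶜ)
      ≤ ENNReal.ofReal δ := by
  have hi : Integrable fun x => f x - rectangle 0 b x := hf.sub (integrable_rectangle 0 b)
  have hin : ∀ {x}, x ∈ Ioo 0 b → rectangle 0 b x = 1 / b := fun hx =>
    rectangle_apply_of_mem (by rwa [zero_add])
  have hout : ∀ {x}, x ∉ Ioo 0 b → rectangle 0 b x = 0 := fun hx =>
    rectangle_apply_of_notMem (by rwa [zero_add])
  have hb' : 0 < 1 / b := by positivity
  refine Metric.hausdorffEDist_le_of_mem_edist ?_ ?_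
  · rintro _ ⟨p, hp, rfl⟩
    by_cases hpR : p ∈ subgraph (rectangle 0 b)
    swap
    · exact ⟨_, ⟨p, hpR, rfl⟩, by simp⟩
    obtain ⟨hp0, hpx, hpy⟩ := rectangle_subgraph_iff.1 hpR
    have hfp : f p.1 ≤ p.2 := by
      by_contra! hn
      exact hp ⟨hp0, hn⟩
    have hnot : ∀ q : ℝ × ℝ, (q.1 ∉ Ioo 0 b ∨ 1 / b ≤ q.2) →
        WithLp.toLp 2 q ∈ euclid (subgraph (rectangle 0 b))ᶜ := fun q hq =>
      ⟨q, fun h => by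
        obtain ⟨-, hx, hy⟩ := rectangle_subgraph_iff.1 h
        rcases hq with hq | hq
        · exact hq hx
        · exact absurd hy (not_lt.2 hq), rfl⟩
    rcases lt_or_ge p.1 δ with c1 | c1
    · refine ⟨_, hnot (0, p.2) (Or.inl (by simp)), edist_toLp_le _ _ ?_⟩
      simp only [sub_zero, sub_self, abs_zero, add_zero]
      rw [abs_of_pos hpx.1]
      exact c1.le
    rcases lt_or_ge (b - δ) p.1 with c2 | c2
    · refine ⟨_, hnot (b, p.2) (Or.inl (by simp)), edist_toLp_le _ _ ?_⟩
      simp only [sub_self, abs_zero, add_zero]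
      rw [abs_of_neg (by linarith [hpx.2])]
      linarith
    rcases lt_or_ge (1 / b - δ) p.2 with c3 | c3
    · refine ⟨_, hnot (p.1, 1 / b) (Or.inr le_rfl), edist_toLp_le _ _ ?_⟩
      simp only [sub_self, abs_zero, zero_add]
      rw [abs_of_neg (by linarith)]
      linarith
    -- The point is now at least `δ` away from the sides and from the top of the rectangle, so `f`
    -- has a valley of depth `δ` there. Sample points with errors below `δ/8` outside and inside
    -- both sides give a variation above `2/b + 5δ/4`, contradicting `hv`.
    exfalso
    obtain ⟨x₁, hx₁, hy₁⟩ := exists_mem_Ioo_abs_lt hi (a := -1) (b := 0) (η := δ / 8) (by norm_num)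
      (by linarith)
    obtain ⟨x₂, hx₂, hy₂⟩ := exists_mem_Ioo_abs_lt hi (a := 0) (b := δ) (η := δ / 8) hδ.le
      (by linarith)
    obtain ⟨x₃, hx₃, hy₃⟩ := exists_mem_Ioo_abs_lt hi (a := b - δ) (b := b) (η := δ / 8) (by linarith)
      (by linarith)
    obtain ⟨x₄, hx₄, hy₄⟩ := exists_mem_Ioo_abs_lt hi (a := b) (b := b + 1) (η := δ / 8) (by linarith)
      (by linarith)
    rw [hout (fun h => lt_asymm h.1 hx₁.2), abs_lt] at hy₁
    rw [hin ⟨hx₂.1, by linarith [hx₂.2]⟩, abs_lt] at hy₂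
    rw [hin ⟨by linarith [hx₃.1], hx₃.2⟩, abs_lt] at hy₃
    rw [hout (fun h => lt_asymm h.2 hx₄.1), abs_lt] at hy₄
    have := valley_le_variation hvar (x₁ := x₁) (x₂ := x₂) (x := p.1) (x₃ := x₃) (x₄ := x₄)
      (by linarith [hx₁.2, hx₂.1]) (by linarith [hx₂.2]) (by linarith [hx₃.1])
      (by linarith [hx₃.2, hx₄.1])
    linarith [hy₁.2, hy₂.1, hy₃.1, hy₄.2]
  · rintro _ ⟨p, hp, rfl⟩
    by_cases hpf : p ∈ subgraph f
    swap
    · exact ⟨_, ⟨p, hpf, rfl⟩, by simp⟩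
    obtain ⟨hp0, hpy⟩ := hpf
    have hnot : ∀ q : ℝ × ℝ, f q.1 ≤ q.2 → WithLp.toLp 2 q ∈ euclid (subgraph f)ᶜ := fun q hq =>
      ⟨q, fun h => absurd h.2 (not_lt.2 hq), rfl⟩
    have hδ8 : ∫ x, |f x - rectangle 0 b x| < δ * δ := h2.trans_le (by nlinarith)
    rcases le_or_gt p.2 δ with c0 | c0
    · refine ⟨WithLp.toLp 2 (p.1, 0), ⟨_, fun h => lt_irrefl _ h.1, rfl⟩, edist_toLp_le _ _ ?_⟩
      simp only [sub_self, abs_zero, zero_add, sub_zero]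
      rw [abs_of_pos hp0]
      exact c0
    rcases le_or_gt p.1 0 with c1 | c1
    · obtain ⟨x, hx, hy⟩ := exists_mem_Ioo_abs_lt hi (a := p.1 - δ) (b := p.1) (η := δ) (by linarith)
        (by linarith)
      rw [hout (fun h => by linarith [h.1, hx.2]), sub_zero, abs_of_nonneg (hf0 x)] at hy
      refine ⟨_, hnot (x, p.2) (hy.le.trans c0.le), edist_toLp_le _ _ ?_⟩
      simp only [sub_self, abs_zero, add_zero]
      rw [abs_of_pos (by linarith [hx.2])]
      linarith [hx.1]
    rcases le_or_gt b p.1 with c2 | c2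
    · obtain ⟨x, hx, hy⟩ := exists_mem_Ioo_abs_lt hi (a := p.1) (b := p.1 + δ) (η := δ) (by linarith)
        (by linarith)
      rw [hout (fun h => by linarith [h.2, hx.1]), sub_zero, abs_of_nonneg (hf0 x)] at hy
      refine ⟨_, hnot (x, p.2) (hy.le.trans c0.le), edist_toLp_le _ _ ?_⟩
      simp only [sub_self, abs_zero, add_zero]
      rw [abs_of_neg (by linarith [hx.1])]
      linarith [hx.2]
    have hH : 1 / b ≤ p.2 := by
      by_contra! hn
      exact hp (rectangle_subgraph_iff.2 ⟨hp0, ⟨c1, c2⟩, hn⟩)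
    -- Moving towards the centre of the base by at most `b/2` stays inside it. The distance `δ` is
    -- spent half horizontally, to reach a good sample point, and half vertically, to rise above the
    -- graph.
    set t := min (δ / 2) (b / 2) with ht
    have ht0 : 0 < t := by positivity
    have ht1 : t ≤ δ / 2 := min_le_left _ _
    have ht2 : t ≤ b / 2 := min_le_right _ _
    have hx : ∃ x ∈ Ioo 0 b, |p.1 - x| ≤ δ / 2 ∧ |f x - rectangle 0 b x| < δ / 2 := by
      rcases le_total p.1 (b / 2) with c | c
      · obtain ⟨x, hx, hy⟩ := exists_mem_Ioo_abs_lt hi (a := p.1) (b := p.1 + t) (η := δ / 2)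
          (by linarith) (by linarith)
        exact ⟨x, ⟨by linarith [hx.1], by linarith [hx.2]⟩,
          by rw [abs_of_neg (by linarith [hx.1])]; linarith [hx.2], hy⟩
      · obtain ⟨x, hx, hy⟩ := exists_mem_Ioo_abs_lt hi (a := p.1 - t) (b := p.1) (η := δ / 2)
          (by linarith) (by linarith)
        exact ⟨x, ⟨by linarith [hx.1], by linarith [hx.2]⟩,
          by rw [abs_of_pos (by linarith [hx.2])]; linarith [hx.1], hy⟩
    obtain ⟨x, hxb, hxp, hy⟩ := hx
    rw [hin hxb, abs_lt] at hy
    refine ⟨_, hnot (x, p.2 + δ / 2) (by simp only; linarith [hy.2]), edist_toLp_le _ _ ?_⟩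
    simp only
    rw [show p.2 - (p.2 + δ / 2) = -(δ / 2) by ring, abs_neg, abs_of_pos (by linarith : 0 < δ / 2)]
    linarith

end Island

end

/-! ### The rectangular competitor and the limit functional. -/

noncomputable section

namespace Island

section Box

variable {B m : ℝ}

/-- The box is monotone up to its midpoint, and reflection transfers the bound to the other half. -/
theorem eVariationOn_box_le (hm : 0 ≤ m) :
    eVariationOn ((Ioo 0 B).indicator fun _ => m) univ ≤ ENNReal.ofReal (2 * m) := by
  set f := (Ioo 0 B).indicator fun _ => m with hf
  have h0 : ∀ x, 0 ≤ f x := fun x => indicator_nonneg (fun _ _ => hm) x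
  have h1 : ∀ x, f x ≤ m := fun x => indicator_le' (fun _ _ => le_rfl) (fun _ _ => hm) x
  have hmono : MonotoneOn f (Iic (B / 2)) := by
    intro x hx y hy hxy
    simp only [mem_Iic] at hx hy
    by_cases hx0 : 0 < x
    · rw [hf, indicator_of_mem (show x ∈ Ioo 0 B from ⟨hx0, by linarith⟩),
        indicator_of_mem (show y ∈ Ioo 0 B from ⟨by linarith, by linarith⟩)]
    · rw [hf, indicator_of_notMem (show x ∉ Ioo 0 B from fun h => hx0 h.1)]
      exact h0 y
  have hle : eVariationOn f (Iic (B / 2)) ≤ ENNReal.ofReal m := by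
    rw [eVariationOn.eq_biSup_inter_Icc]
    refine iSup₂_le fun p hp => (hmono.eVariationOn_eq hp.1 hp.2.1).trans_le ?_
    exact ENNReal.ofReal_le_ofReal (by linarith [h0 p.1, h1 p.2])
  have hr : f ∘ (fun x => B - x) = f := by
    ext x
    simp only [hf, Function.comp, indicator_apply, mem_Ioo]
    congr 1
    exact propext ⟨fun h => ⟨by linarith [h.2], by linarith [h.1]⟩,
      fun h => ⟨by linarith [h.2], by linarith [h.1]⟩⟩
  have hge : eVariationOn f (Ici (B / 2)) ≤ ENNReal.ofReal m := by
    refine le_trans ?_ hle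
    conv_lhs => rw [← hr]
    refine eVariationOn.comp_le_of_antitoneOn f _ (fun x _ y _ hxy => ?_) fun x hx => ?_
    · exact sub_le_sub_left hxy B
    · simp only [mem_Ici, mem_Iic] at hx ⊢
      linarith
  rw [← Iic_union_Ici (a := B / 2), eVariationOn.union f isGreatest_Iic isLeast_Ici, two_mul,
    ENNReal.ofReal_add hm hm]
  exact add_le_add hle hge

theorem isProfile_box (hB : 0 ≤ B) (hm : 0 ≤ m) :
    IsProfile (B * m) ((Ioo 0 B).indicator fun _ => m) where
  nonneg := indicator_nonneg fun _ _ => hm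
  lsc := isOpen_Ioo.lowerSemicontinuous_indicator hm
  integrable := (integrableOn_const (by simp)).integrable_indicator measurableSet_Ioo
  finite_variation := ne_top_of_le_ne_top ENNReal.ofReal_ne_top (eVariationOn_box_le hm)
  volume_eq := by
    rw [integral_indicator measurableSet_Ioo, setIntegral_const]
    simp [hB]

theorem positivity_box (hm : 0 < m) : {x | 0 < (Ioo 0 B).indicator (fun _ => m) x} = Ioo 0 B := by
  ext x
  by_cases hx : x ∈ Ioo 0 B
  · simp [hx, hm]
  · simp only [mem_ofPred_eq, indicator_of_notMem hx, lt_irrefl, hx]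

theorem isBounded_subgraph_box (B m : ℝ) :
    Bornology.IsBounded (subgraph ((Ioo 0 B).indicator fun _ => m)) := by
  refine (Metric.isBounded_Ioo 0 B).prod (Metric.isBounded_Ioo 0 m) |>.subset fun p hp => ?_
  have h1 : p.1 ∈ Ioo 0 B := by
    by_contra h
    have := hp.2
    rw [indicator_of_notMem h] at this
    exact absurd hp.1 this.not_gt
  exact ⟨h1, hp.1, by simpa [indicator_of_mem h1] using hp.2⟩

end Box

theorem le_ofReal_of_forall_add {E : ℝ≥0∞} {C a : ℝ}
    (h : ∀ η > 0, E ≤ ENNReal.ofReal (a * (C + η))) : E ≤ ENNReal.ofReal (a * C) := by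
  have ht : Tendsto (fun η : ℝ => ENNReal.ofReal (a * (C + η))) (𝓝[>] 0)
      (𝓝 (ENNReal.ofReal (a * (C + 0)))) := by
    refine (ENNReal.continuous_ofReal.comp (by fun_prop)).continuousAt.tendsto.mono_left
      nhdsWithin_le_nhds
  rw [add_zero] at ht
  exact ge_of_tendsto ht (eventually_mem_nhdsWithin.mono fun η hη => h η hη)

theorem stripEnergy_Ioo_le {B : ℝ} (hB : 0 < B) :
    stripEnergy (Ioo 0 B) ≤ ENNReal.ofReal (B ^ 2 * CW) := by
  refine le_ofReal_of_forall_add fun η hη => ?_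
  obtain ⟨U, hU, hU0, hle⟩ := exists_competitor hη hB
  exact (stripEnergy_le_of_contDiff hU hU0 isOpen_Ioo).trans hle

/-- The only use of minimality. The competitor restricts a near-optimal function of the half strip
to a rectangle of base `B`; boundedness puts it in `H¹`, and its energy there is at most that of the
strip. -/
theorem IsFilmMinimizer.filmEnergy_le {V : ℝ} {u : ℝ × ℝ → ℝ} {h : ℝ → ℝ}
    (hmin : IsFilmMinimizer V u h) (hV : 0 < V) {B : ℝ} (hB : 0 < B) :
    filmEnergy u h ≤ ENNReal.ofReal (B ^ 2 * CW) + ENNReal.ofReal (2 * (V / B)) := by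
  have hm : 0 < V / B := by positivity
  have hp := isProfile_box hB.le hm.le
  rw [mul_div_cancel₀ _ hB.ne'] at hp
  have hopen := isOpen_subgraph hp.lsc
  have key : ∀ η > 0, filmEnergy u h - ENNReal.ofReal (2 * (V / B)) ≤
      ENNReal.ofReal (B ^ 2 * (CW + η)) := by
    intro η hη
    obtain ⟨U, hU, hU0, hle⟩ := exists_competitor hη hB
    have ha : IsAdmissible V U ((Ioo 0 B).indicator fun _ => V / B) :=
      ⟨hp, memH1_of_contDiff hU (isBounded_subgraph_box _ _),
        hasBottomTrace_of_contDiff hopen (fun p hp => hp.1) hU hU0⟩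
    refine tsub_le_iff_right.2 ((hmin.2 _ _ ha).trans (add_le_add ?_ (eVariationOn_box_le hm.le)))
    rw [dirichletEnergy_of_contDiff hopen hU]
    refine (lintegral_mono_set fun p hp => ?_).trans hle
    refine ⟨?_, hp.1⟩
    rw [← positivity_box hm]
    exact hp.1.trans hp.2
  exact tsub_le_iff_right.1 (le_ofReal_of_forall_add key)

section Rescale

variable {V : ℝ} {h : ℝ → ℝ}

theorem eVariationOn_comp_le_univ (f φ : ℝ → ℝ) (hφ : Monotone φ) :
    eVariationOn (fun x => f (φ x)) univ ≤ eVariationOn f univ :=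
  eVariationOn.comp_le_of_monotoneOn f φ (hφ.monotoneOn _) (mapsTo_univ _ _)

theorem eVariationOn_const_mul_le {c : ℝ} (hc : 0 ≤ c) (f : ℝ → ℝ) :
    eVariationOn (fun x => c * f x) univ ≤ ENNReal.ofReal c * eVariationOn f univ := by
  have hl : LipschitzOnWith c.toNNReal (fun y : ℝ => c * y) univ := by
    refine (LipschitzWith.of_dist_le_mul fun x y => ?_).lipschitzOnWith
    rw [Real.dist_eq, Real.dist_eq, ← mul_sub, abs_mul, abs_of_nonneg hc, Real.coe_toNNReal _ hc]
  exact hl.comp_eVariationOn_le (mapsTo_univ f univ)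

theorem eVariationOn_rescale_le (hV : 0 < V) :
    eVariationOn (rescale V h) univ ≤ ENNReal.ofReal (V ^ (-(2 / 3) : ℝ)) * eVariationOn h univ := by
  refine (eVariationOn_const_mul_le (Real.rpow_pos_of_pos hV _).le
    fun x => h (V ^ (1 / 3 : ℝ) * x)).trans ?_
  gcongr
  exact eVariationOn_comp_le_univ h _
    fun x y hxy => mul_le_mul_of_nonneg_left hxy (Real.rpow_pos_of_pos hV _).le

theorem IsProfile.rescale (hV : 0 < V) (hh : IsProfile V h) : IsProfile 1 (rescale V h) where
  nonneg x := mul_nonneg (Real.rpow_pos_of_pos hV _).le (hh.nonneg _)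
  lsc := by
    refine Continuous.comp_lowerSemicontinuous (continuous_const_mul (V ^ (-(2 / 3) : ℝ)))
      (hh.lsc.comp (continuous_const_mul (V ^ (1 / 3 : ℝ)))) fun x y hxy => ?_
    exact mul_le_mul_of_nonneg_left hxy (Real.rpow_pos_of_pos hV _).le
  integrable := (hh.integrable.comp_mul_left' (Real.rpow_pos_of_pos hV _).ne').const_mul _
  finite_variation := ne_top_of_le_ne_top
    (ENNReal.mul_ne_top ENNReal.ofReal_ne_top hh.finite_variation) (eVariationOn_rescale_le hV)
  volume_eq := by
    have hr := Real.rpow_pos_of_pos hV (1 / 3)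
    simp only [Island.rescale]
    rw [integral_const_mul, Measure.integral_comp_mul_left, hh.volume_eq, abs_of_pos (by positivity),
      smul_eq_mul, ← Real.rpow_neg hV.le]
    nth_rewrite 3 [← Real.rpow_one V]
    rw [← Real.rpow_add hV, ← Real.rpow_add hV]
    norm_num

end Rescale

section Rectangle

variable {b : ℝ}

theorem rectangle_zero_eq (b : ℝ) : rectangle 0 b = (Ioo 0 b).indicator fun _ => 1 / b := by
  rw [rectangle, zero_add]

theorem isProfile_rectangle (hb : 0 < b) : IsProfile 1 (rectangle 0 b) := by
  have := isProfile_box hb.le (one_div_pos.2 hb).le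
  rwa [mul_one_div_cancel hb.ne', ← rectangle_zero_eq] at this

theorem rectangle_add (α b x : ℝ) : rectangle α b (x + α) = rectangle 0 b x := by
  simp only [rectangle, indicator_apply, mem_Ioo]
  congr 1
  exact propext ⟨fun h => ⟨by linarith [h.1], by linarith [h.2]⟩,
    fun h => ⟨by linarith [h.1], by linarith [h.2]⟩⟩

/-- Inside the base the function is locally constant. At any other point, the end points included,
it vanishes on one side, so the lower limit is not positive. -/
theorem cuts_rectangle (hb : 0 < b) : cuts (rectangle 0 b) = ∅ := by
  refine eq_empty_of_forall_notMem fun p hp => ?_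
  have h1 := hp.1
  rw [lowerLimit, rectangle_zero_eq] at h1
  set f : ℝ → ℝ := (Ioo 0 b).indicator fun _ => 1 / b
  have hf0 : ∀ x, 0 ≤ f x := indicator_nonneg fun _ _ => (one_div_pos.2 hb).le
  by_cases hx : p.1 ∈ Ioo 0 b
  · have : f =ᶠ[𝓝[≠] p.1] fun _ => 1 / b :=
      nhdsWithin_le_nhds (by
        filter_upwards [isOpen_Ioo.mem_nhds hx] with z hz using indicator_of_mem hz _)
    rw [liminf_congr this, liminf_const] at h1
    simp [f, indicator_of_mem hx] at h1
  · have hfr : ∃ᶠ z in 𝓝[≠] p.1, f z ≤ 0 := by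
      rcases not_and_or.1 hx with h | h
      · refine Frequently.filter_mono (Eventually.frequently ?_) (nhdsLT_le_nhdsNE p.1)
        filter_upwards [self_mem_nhdsWithin] with z hz
        exact (indicator_of_notMem (fun h' => h (h'.1.trans hz)) _).le
      · refine Frequently.filter_mono (Eventually.frequently ?_) (nhdsGT_le_nhdsNE p.1)
        filter_upwards [self_mem_nhdsWithin] with z hz
        exact (indicator_of_notMem (fun h' => h (lt_trans hz h'.2)) _).le
    have := liminf_le_of_frequently_le hfr (isBoundedUnder_of ⟨0, hf0⟩)
    exact absurd (h1.trans_le this) (hf0 _).not_gt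

end Rectangle

theorem euclid_empty : euclid ∅ = ∅ := image_empty _

/-- The cut term is nonnegative and is dropped. The half strips have infinite height, so the
projected energy satisfies the cell bounds for `L k` with every `L > 0`. -/
theorem three_mul_le_limitEnergy {H : ℝ} (hH : 0 < H) (hCW : H ^ 3 = CW) {k : ℝ → ℝ}
    (hk : IsProfile 1 k) : ENNReal.ofReal (3 * H) ≤ limitEnergy k := by
  obtain ⟨c, S, hc, hcell⟩ := exists_cellConstants
  rw [← hCW] at hcell
  refine le_trans ?_ le_self_add
  refine tsub_le_iff_right.1 (le_iInf₂ fun u hu => tsub_le_iff_right.2 ?_)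
  by_cases htop : dirichletEnergy ({x | 0 < k x} ×ˢ Ioi 0) u = ⊤
  · simp [htop]
  obtain ⟨ν, hν, hd⟩ := exists_dualBounded_strip (isOpen_positivity hk.lsc) hu
  have := three_mul_le_of_forall_cellBound hc hH hk
    (fun L hL => hcell ν k L (hd _ fun x hx => (pos_iff_pos_of_mul_pos hx).1 hL))
    ENNReal.toReal_nonneg (by rw [hν, ENNReal.ofReal_toReal htop])
  refine (ENNReal.ofReal_le_ofReal this).trans ?_
  rw [ENNReal.ofReal_add ENNReal.toReal_nonneg ENNReal.toReal_nonneg, ENNReal.ofReal_toReal htop,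
    ENNReal.ofReal_toReal hk.finite_variation]

theorem isLimitMinimizer_rectangle {H : ℝ} (hH : 0 < H) (hCW : H ^ 3 = CW) :
    IsLimitMinimizer (rectangle 0 (1 / H)) := by
  have hb : 0 < 1 / H := by positivity
  refine ⟨isProfile_rectangle hb, fun k hk => le_trans ?_ (three_mul_le_limitEnergy hH hCW hk)⟩
  rw [limitEnergy, cuts_rectangle hb, euclid_empty, measure_empty, mul_zero, add_zero,
    rectangle_zero_eq, positivity_box (one_div_pos.2 hb)]
  refine (add_le_add (stripEnergy_Ioo_le hb) (eVariationOn_box_le (one_div_pos.2 hb).le)).trans ?_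
  rw [← ENNReal.ofReal_add (by rw [← hCW]; positivity) (by positivity), ← hCW]
  refine ENNReal.ofReal_le_ofReal (le_of_eq ?_)
  field_simp
  ring

/-- Choosing each parameter within `1/(n+1)` of the infimum produces one sequence that works for all
tolerances. -/
theorem exists_tendsto_zero_of_forall_eventually {α : Type*} {d : ℕ → α → ℝ} [Nonempty α]
    (h0 : ∀ n a, 0 ≤ d n a) (h : ∀ r > 0, ∀ᶠ n in atTop, ∃ a, d n a ≤ r) :
    ∃ a : ℕ → α, Tendsto (fun n => d n (a n)) atTop (𝓝 0) := by
  have hlt : ∀ n : ℕ, ⨅ a, d n a < (⨅ a, d n a) + 1 / ((n : ℝ) + 1) := fun n =>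
    lt_add_of_pos_right _ (by positivity)
  choose a ha using fun n => exists_lt_of_ciInf_lt (hlt n)
  refine ⟨a, ?_⟩
  have hinf : Tendsto (fun n => ⨅ a, d n a) atTop (𝓝 0) := by
    rw [Metric.tendsto_atTop']
    intro r hr
    obtain ⟨N, hN⟩ := eventually_atTop.1 (h (r / 2) (by positivity))
    refine ⟨N, fun n hn => ?_⟩
    obtain ⟨b, hb⟩ := hN n hn.le
    rw [Real.dist_0_eq_abs, abs_of_nonneg (le_ciInf (h0 n))]
    have := ciInf_le ⟨0, forall_mem_range.2 (h0 n)⟩ b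
    linarith
  have := hinf.add tendsto_one_div_add_atTop_nhds_zero_nat
  rw [add_zero] at this
  exact squeeze_zero (fun n => h0 n _) (fun n => (ha n).le) this

theorem IsFilmMinimizer.exists_cellBound_rescale {V c H : ℝ} {S : ℝ → ℝ} {u : ℝ × ℝ → ℝ} {h : ℝ → ℝ}
    (hH : 0 < H) (hCW : H ^ 3 = CW) (hmin : IsFilmMinimizer V u h) (hV : 0 < V)
    (hcell : ∀ (ν : Measure ℝ) (k : ℝ → ℝ) (L : ℝ), DualBounded ν (fun x => L * k x) →
      CellBound c CW S k L ν) :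
    ∃ (μ : Measure ℝ) (D : ℝ), 0 ≤ D ∧ μ univ ≤ ENNReal.ofReal D ∧
      CellBound c CW S (rescale V h) (V ^ (1 / 3 : ℝ)) μ ∧
      D + (eVariationOn (rescale V h) univ).toReal ≤ 3 * H := by
  set s := V ^ (1 / 3 : ℝ) with hs
  have hs0 : 0 < s := Real.rpow_pos_of_pos hV _
  have hVs : V = s ^ 3 := by
    rw [hs, ← Real.rpow_natCast, ← Real.rpow_mul hV.le]
    norm_num
  have ht : V ^ (-(2 / 3) : ℝ) = (s ^ 2)⁻¹ := by
    rw [hs, ← Real.rpow_natCast, ← Real.rpow_mul hV.le, Real.rpow_neg hV.le]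
    norm_num
  -- The optimal base: it balances the two terms and gives the energy `3 H s²`.
  have hfilm := hmin.filmEnergy_le hV (B := s / H) (by positivity)
  rw [← ENNReal.ofReal_add (by rw [← hCW]; positivity) (by positivity)] at hfilm
  have he : (s / H) ^ 2 * CW + 2 * (V / (s / H)) = s ^ 2 * (3 * H) := by
    rw [← hCW, hVs]
    field_simp
    ring
  rw [he] at hfilm
  have hE : dirichletEnergy (subgraph h) u ≠ ⊤ :=
    ne_top_of_le_ne_top ENNReal.ofReal_ne_top (le_self_add.trans hfilm)
  have hW : eVariationOn h univ ≠ ⊤ := hmin.1.profile.finite_variation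
  obtain ⟨ν, hν, hd⟩ := hmin.1.exists_dualBounded
  obtain ⟨μ, hμ, hc⟩ := (hcell ν h 1 (by simpa using hd)).rescale hV
  refine ⟨μ, V ^ (-(2 / 3) : ℝ) * (dirichletEnergy (subgraph h) u).toReal, by positivity, ?_, hc, ?_⟩
  · rw [hμ, hν, ENNReal.ofReal_mul (by positivity), ENNReal.ofReal_toReal hE]
  · have h1 := ENNReal.toReal_mono (ENNReal.mul_ne_top ENNReal.ofReal_ne_top hW)
      (eVariationOn_rescale_le (h := h) hV)
    rw [ENNReal.toReal_mul, ENNReal.toReal_ofReal (by positivity), ht] at h1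
    have h2 := ENNReal.toReal_mono ENNReal.ofReal_ne_top hfilm
    rw [filmEnergy, ENNReal.toReal_add hE hW, ENNReal.toReal_ofReal (by positivity)] at h2
    rw [ht]
    calc _ ≤ (s ^ 2)⁻¹ * ((dirichletEnergy (subgraph h) u).toReal +
          (eVariationOn h univ).toReal) := by rw [mul_add]; gcongr
      _ ≤ (s ^ 2)⁻¹ * (s ^ 2 * (3 * H)) := by gcongr
      _ = 3 * H := by field_simp

end Island

end

/-! ### Proof of the theorem. -/

open Island in
theorem mainTheorem11 (V : ℕ → ℝ) (u : ℕ → ℝ × ℝ → ℝ) (h : ℕ → ℝ → ℝ)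
    (hVpos : ∀ n, 0 < V n) (hV : Tendsto V atTop atTop)
    (hmin : ∀ n, Island.IsFilmMinimizer (V n) (u n) (h n)) :
    ∃ (σ : ℕ → ℕ) (τ : ℕ → ℝ) (hlim : ℝ → ℝ), StrictMono σ ∧
      Tendsto (fun n => eLpNorm
        (fun x => Island.rescale (V (σ n)) (h (σ n)) (x - τ n) - hlim x) 1 volume)
        atTop (𝓝 0) ∧
      Tendsto (fun n => Metric.hausdorffEDist
        (Island.euclid
          (Island.subgraph (fun x => Island.rescale (V (σ n)) (h (σ n)) (x - τ n)))ᶜ)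
        (Island.euclid (Island.subgraph hlim)ᶜ))
        atTop (𝓝 0) ∧
      Island.IsLimitMinimizer hlim ∧
      0 < Island.CW ∧
      ∃ a : ℝ, hlim = Island.rectangle a (Island.CW ^ (-(1 / 3) : ℝ)) := by
  have hH : 0 < CW ^ (1 / 3 : ℝ) := Real.rpow_pos_of_pos CW_pos _
  have hb : CW ^ (-(1 / 3) : ℝ) = 1 / CW ^ (1 / 3 : ℝ) := by
    rw [Real.rpow_neg CW_nonneg, ← one_div]
  have hCW : (CW ^ (1 / 3 : ℝ)) ^ 3 = CW := by
    rw [← Real.rpow_natCast, ← Real.rpow_mul CW_nonneg]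
    norm_num
  rw [hb]
  generalize CW ^ (1 / 3 : ℝ) = H at hH hCW
  obtain ⟨c, S, hc, hcell⟩ := exists_cellConstants
  choose μ D hD0 hD hμ hDX using fun n =>
    (hmin n).exists_cellBound_rescale hH hCW (hVpos n) hcell
  have hk : ∀ n, IsProfile 1 (rescale (V n) (h n)) := fun n => (hmin n).1.profile.rescale (hVpos n)
  obtain ⟨hX, hnear⟩ := eventually_exists_near_rectangle hc hH hk (by rwa [hCW])
    ((tendsto_rpow_atTop (by norm_num)).comp hV) hD0 hD (fun _ => rfl) fun n => by
      rw [mul_div_cancel₀ _ two_ne_zero]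
      exact hDX n
  generalize hkn : (fun n => rescale (V n) (h n)) = k at *
  replace hkn : ∀ n, rescale (V n) (h n) = k n := fun n => congrFun hkn n
  simp only [hkn] at *
  have hint : ∀ n τ, Integrable fun x => k n (x - τ) := fun n τ => (hk n).integrable.comp_sub_right τ
  obtain ⟨τ, hτ⟩ := exists_tendsto_zero_of_forall_eventually
    (d := fun n τ => ∫ x, |k n (x - τ) - rectangle 0 (1 / H) x|)
    (fun n τ => integral_nonneg fun x => abs_nonneg _) fun r hr => by
      filter_upwards [hnear r hr] with n ⟨α, hα⟩
      refine ⟨-α, le_of_eq_of_le ?_ hα⟩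
      rw [← integral_add_right_eq_self (fun x => |k n x - rectangle α (1 / H) x|) α]
      simp only [rectangle_add, sub_neg_eq_add]
  -- The whole sequence converges, so no subsequence is extracted; the translations place the left
  -- end of the rectangle at `0`.
  refine ⟨id, τ, rectangle 0 (1 / H), strictMono_id, ?_, ?_, isLimitMinimizer_rectangle hH hCW,
    CW_pos, 0, rfl⟩
  · have := (ENNReal.continuous_ofReal.tendsto 0).comp hτ
    rw [ENNReal.ofReal_zero] at this
    refine this.congr fun n => ?_
    rw [eLpNorm_one_eq_lintegral_enorm]
    exact ofReal_integral_norm_eq_lintegral_enorm ((hint n _).sub (integrable_rectangle 0 _))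
  · rw [ENNReal.tendsto_nhds_zero]
    intro ε hε
    obtain ⟨δ, hδ, hδε⟩ : ∃ δ : ℝ, 0 < δ ∧ ENNReal.ofReal δ ≤ ε := by
      obtain ⟨δ, hδ, hlt⟩ := ENNReal.lt_iff_exists_nnreal_btwn.1 hε
      exact ⟨δ, by simpa using hδ, by simpa using hlt.le⟩
    have hb0 : 0 < 1 / H := by positivity
    -- Half the variation tends to `H`, the height of the rectangle, so the variation is eventually
    -- at most `2H + δ`.
    filter_upwards [hX.eventually_le_const (show H < H + δ / 2 by linarith),
      hτ.eventually_lt_const (show (0 : ℝ) < δ / 8 by positivity),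
      hτ.eventually_lt_const (show (0 : ℝ) < δ * (δ / 8) by positivity),
      hτ.eventually_lt_const (show (0 : ℝ) < min (δ / 2) (1 / H / 2) * (δ / 2) by positivity)]
      with n h0 h1 h2 h3
    have hv := eVariationOn_comp_le_univ (k n) (fun x => x - τ n) fun x y hxy =>
      sub_le_sub_right hxy _
    have hfin := (hk n).finite_variation
    refine (hausdorffEDist_le_of_near_rectangle (fun x => (hk n).nonneg _) (hint n _)
      (ne_top_of_le_ne_top hfin hv) hb0 hδ ?_ h1 h2 h3).trans hδε
    have := ENNReal.toReal_mono hfin hv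
    rw [one_div_one_div]
    linarith
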